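/- **Conventions.** Banach spaces $E$ are over a fixed scalar field $\mathbb K\in\{\mathbb R,\mathbb C\}$; an affine isometry is a bijective $\mathbb K$-affine isometry. For $1\le p<\infty$, an $L_p$-space is a space $L_p(\Omega,\mu;\mathbb K)$ for some measure space $(\Omega,\mu)$. A Banach space has nontrivial type if it has Rademacher type $q$ for some $q\in(1,2]$. *Warped cone.* Let $\Gamma$ be a group with finite generating set $S$ and word length $|\cdot|$, acting by homeomorphisms on a compact metrizable space $M$. A linearization of $(\Gamma,M)$ by unitary operators in a (real or complex) Hilbert space $H$ is a topological embedding of $M$ into the unit sphere of $H$ together with a unitary (orthogonal) representation $U$ of $\Gamma$ on $H$ such that each $U_\gamma$ restricts to the given action of $\gamma$ on $M$. The open cone $\mathcal O M\subset H$ is the union of all rays from the origin that meet $M$, with the metric $d$ induced from $H$. The warped cone $\mathcal O_\Gamma(M)$ is $\mathcal O M$ with the warped metric $$\delta_\Gamma(x,y)=\inf\sum_{i=0}^{n-1}\big(d(\gamma_i x_i,x_{i+1})+|\gamma_i|\big),$$ the infimum being over all finite sequences $x=x_0,\dots,x_n=y$ in $\mathcal O M$ and $\gamma_0,\dots,\gamma_{n-1}$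 in $\Gamma$, where $\gamma$ acts on $\mathcal OM$ by $U_\gamma$. *Fibred coarse embedding.* A metric space $(X,d)$ admits a fibred coarse embedding into a Banach space $E$ if there exist a field of Banach spaces $(E_x)_{x\in X}$, a section $s(x)\in E_x$, and non-decreasing functions $\rho_1,\rho_2:[0,\infty)\to\mathbb R$ tending to $\infty$, such that for every $r>0$ there are a bounded set $K\subset X$ and, for every $C\subset X\setminus K$ of diameter less than $r$, affine isometries $t_C(x):E_x\to E$ $(x\in C)$ with: (i) $\rho_1(d(x,y))\le\|t_C(x)(s(x))-t_C(y)(s(y))\|\le\rho_2(d(x,y))$ for all $x,y\in C$; (ii) whenever $C_1,C_2\subset X\setminus K$ have diameter less than $r$ and $C_1\cap C_2\neq\emptyset$, there is an affine isometry $t_{C_1C_2}:E\to E$ with $t_{C_1}(x)\circ t_{C_2}(x)^{-1}=t_{C_1C_2}$ for all $x\in C_1\cap C_2$. *Proper actions.* $\Gamma$ admits a proper affine isometric action on $E$ if there is an action $\alpha$ of $\Gamma$ on $E$ by affine isometries with $\|\alpha_\gamma(0)\|\to\infty$ as $\gamma\to\infty$ in the discrete group $\Gamma$. $\Gamma$ has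 the Haagerup property if it admits a proper affine isometric action on a real Hilbert space. **Theorem.** Let $G$ be a compact metrizable group (in particular, $G$ may be any compact Lie group), let $\Gamma$ be a finitely generated dense subgroup of $G$ acting on $G$ by left translations, and let $\mathcal O_\Gamma(G)$ be the warped cone of $(\Gamma,G)$ with respect to any finite generating set of $\Gamma$ and any linearization of $(\Gamma,G)$ by unitary operators in a Hilbert space. Then: 1. for every $1\le p<\infty$, $\mathcal O_\Gamma(G)$ admits a fibred coarse embedding into an $L_p$-space if and only if $\Gamma$ admits a proper affine isometric action on an $L_p$-space; 2. $\mathcal O_\Gamma(G)$ admits a fibred coarse embedding into a uniformly convex Banach space if and only if $\Gamma$ admits a proper affine isometric action on a uniformly convex Banach space; 3. $\mathcal O_\Gamma(G)$ admits a fibred coarse embedding into a Banach space with nontrivial type if and only if $\Gamma$ admits a proper affine isometric action on a Banach space with nontrivial type; 4. $\mathcal O_\Gamma(G)$ admits a fibred coarse embedding into a Hilbert space if and only if $\Gamma$ has the Haagerup property. -/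

import Mathlib

open Filter Topology MeasureTheory
open scoped NNReal ENNReal Manifold

universe u v

/-! ### Word length and the warped metric -/

/-- The word length of `γ` with respect to `S`: the least length of a word in the letters
`S ∪ S⁻¹` that represents `γ` (for a generating set `S`). -/
noncomputable def wordLength {Γ : Type*} [Group Γ] (S : Set Γ) (γ : Γ) : ℕ :=
  sInf {n | ∃ l : List Γ, l.length = n ∧ (∀ g ∈ l, g ∈ S ∨ g⁻¹ ∈ S) ∧ l.prod = γ}

/-- `WarpedChain S x y c`: there are finite sequences `x = x₀, x₁, …, xₙ = y` in `X` and
`γ₀, …, γₙ₋₁` in `Γ` with `c = ∑ᵢ (d (γᵢ xᵢ) xᵢ₊₁ + |γᵢ|)`. -/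
inductive WarpedChain {Γ X : Type*} [Group Γ] [MulAction Γ X] [PseudoMetricSpace X]
    (S : Set Γ) (x : X) : X → ℝ → Prop
  | nil : WarpedChain S x x 0
  | snoc {y : X} {c : ℝ} (γ : Γ) (z : X) (h : WarpedChain S x y c) :
      WarpedChain S x z (c + (dist (γ • y) z + wordLength S γ))

/-- The warped distance: the infimum of all sums `∑ᵢ (d (γᵢ xᵢ) xᵢ₊₁ + |γᵢ|)` over finite
chains from `x` to `y`. -/
noncomputable def warpedDist {Γ X : Type*} [Group Γ] [MulAction Γ X] [PseudoMetricSpace X]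
    (S : Set Γ) (x y : X) : ℝ :=
  sInf {c | WarpedChain S x y c}

section WarpedMetric

variable {Γ X : Type*} [Group Γ]

theorem wordLength_one (S : Set Γ) : wordLength S 1 = 0 := by
  refine Nat.sInf_eq_zero.2 (Or.inl ⟨[], by simp⟩)

theorem wordLength_inv (S : Set Γ) (γ : Γ) : wordLength S γ⁻¹ = wordLength S γ := by
  have key : ∀ (δ : Γ) (n : ℕ),
      (∃ l : List Γ, l.length = n ∧ (∀ g ∈ l, g ∈ S ∨ g⁻¹ ∈ S) ∧ l.prod = δ) →
      ∃ l : List Γ, l.length = n ∧ (∀ g ∈ l, g ∈ S ∨ g⁻¹ ∈ S) ∧ l.prod = δ⁻¹ := by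
    rintro δ n ⟨l, hl, hS, rfl⟩
    refine ⟨(l.map (·⁻¹)).reverse, by simpa using hl, ?_, by rw [List.prod_inv_reverse]⟩
    intro g hg
    simp only [List.mem_reverse, List.mem_map] at hg
    obtain ⟨a, ha, rfl⟩ := hg
    rcases hS a ha with h | h
    · right; simpa using h
    · left; exact h
  unfold wordLength
  congr 1
  ext n
  exact ⟨fun h => by simpa using key _ n h, key _ n⟩

theorem exists_word {S : Set Γ} (hS : Subgroup.closure S = ⊤) (γ : Γ) :
    ∃ l : List Γ, (∀ g ∈ l, g ∈ S ∨ g⁻¹ ∈ S) ∧ l.prod = γ := by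
  have h : γ ∈ (Subgroup.closure S).toSubmonoid := hS ▸ Subgroup.mem_top γ
  rw [Subgroup.closure_toSubmonoid] at h
  exact Submonoid.exists_list_of_mem_closure h

theorem eq_one_of_wordLength_eq_zero {S : Set Γ} (hS : Subgroup.closure S = ⊤) {γ : Γ}
    (h : wordLength S γ = 0) : γ = 1 := by
  have hne : {n | ∃ l : List Γ, l.length = n ∧ (∀ g ∈ l, g ∈ S ∨ g⁻¹ ∈ S) ∧
      l.prod = γ}.Nonempty := by
    obtain ⟨l, h1, h2⟩ := exists_word hS γ
    exact ⟨_, l, rfl, h1, h2⟩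
  obtain ⟨l, hl, -, rfl⟩ := Nat.sInf_mem hne
  have : l = [] := List.length_eq_zero_iff.1 (hl.trans h)
  simp [this]

variable [MulAction Γ X] [MetricSpace X] {S : Set Γ}

theorem WarpedChain.nonneg {x y : X} {c : ℝ} (h : WarpedChain S x y c) : 0 ≤ c := by
  induction h with
  | nil => exact le_rfl
  | snoc γ z _ ih => positivity

theorem WarpedChain.trans {x y z : X} {c c' : ℝ} (h : WarpedChain S x y c)
    (h' : WarpedChain S y z c') : WarpedChain S x z (c + c') := by
  induction h' with
  | nil => simpa using h
  | snoc γ z _ ih => rw [← add_assoc]; exact ih.snoc γ z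

theorem WarpedChain.single (S : Set Γ) (γ : Γ) (x y : X) :
    WarpedChain S x y (dist (γ • x) y + wordLength S γ) := by
  simpa using (WarpedChain.nil (S := S) (x := x)).snoc γ y

theorem WarpedChain.symm {x y : X} {c : ℝ} (h : WarpedChain S x y c) : WarpedChain S y x c := by
  induction h with
  | nil => exact .nil
  | @snoc y c γ z _ ih =>
    have h1 := WarpedChain.single S 1 z (γ • y)
    have h2 := WarpedChain.single S γ⁻¹ (γ • y) y
    have h3 := (h1.trans h2).trans ih
    convert h3 using 1
    simp [wordLength_one, wordLength_inv, dist_comm]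
    ring

theorem WarpedChain.dist_le (hS : Subgroup.closure S = ⊤) {x y : X} {c : ℝ}
    (h : WarpedChain S x y c) (hc : c < 1) : dist x y ≤ c := by
  induction h with
  | nil => simp
  | @snoc y c γ z h ih =>
    have h0 := h.nonneg
    have h1 : (0 : ℝ) ≤ dist (γ • y) z := dist_nonneg
    have h2 : wordLength S γ = 0 := by
      have : (wordLength S γ : ℝ) < 1 := by linarith
      have : wordLength S γ < 1 := by exact_mod_cast this
      omega
    obtain rfl := eq_one_of_wordLength_eq_zero hS h2
    rw [h2, one_smul, Nat.cast_zero, add_zero] at hc ⊢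
    rw [one_smul] at h1
    have h3 := ih (by linarith)
    have h4 := dist_triangle x y z
    linarith

theorem bddBelow_warpedChain (S : Set Γ) (x y : X) : BddBelow {c | WarpedChain S x y c} :=
  ⟨0, fun _ h => WarpedChain.nonneg h⟩

theorem warpedDist_le {x y : X} {c : ℝ} (h : WarpedChain S x y c) : warpedDist S x y ≤ c :=
  csInf_le (bddBelow_warpedChain S x y) h

theorem exists_warpedChain_lt (x y : X) {a : ℝ} (h : warpedDist S x y < a) :
    ∃ c, WarpedChain S x y c ∧ c < a :=
  exists_lt_of_csInf_lt ⟨_, WarpedChain.single S 1 x y⟩ h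

end WarpedMetric

/-- The metric space `X` with its metric replaced by the warped metric `δ_Γ`. -/
def WarpedSpace {Γ : Type*} [Group Γ] (S : Set Γ) (_hS : Subgroup.closure S = ⊤)
    (X : Type*) : Type _ := X

noncomputable instance {Γ X : Type*} [Group Γ] [MulAction Γ X] [MetricSpace X] (S : Set Γ)
    (hS : Subgroup.closure S = ⊤) : MetricSpace (WarpedSpace S hS X) where
  dist x y := warpedDist (X := X) S x y
  dist_self x := le_antisymm (warpedDist_le .nil)
    (Real.sInf_nonneg fun _ h => WarpedChain.nonneg h)
  dist_comm x y := by
    unfold warpedDist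
    congr 1
    ext c
    exact ⟨WarpedChain.symm, WarpedChain.symm⟩
  dist_triangle x y z := by
    refine le_of_forall_pos_lt_add fun ε hε => ?_
    obtain ⟨c, hc, hc'⟩ := exists_warpedChain_lt (X := X) (S := S) x y
      (lt_add_of_pos_right _ (half_pos hε))
    obtain ⟨d, hd, hd'⟩ := exists_warpedChain_lt (X := X) (S := S) y z
      (lt_add_of_pos_right _ (half_pos hε))
    have := warpedDist_le (hc.trans hd)
    linarith
  eq_of_dist_eq_zero {x y} h := by
    have h : warpedDist (X := X) S x y = 0 := h
    refine (dist_le_zero (γ := X)).1 (le_of_forall_pos_lt_add fun ε hε => ?_)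
    obtain ⟨c, hc, hc'⟩ := exists_warpedChain_lt (X := X) (S := S) x y
      (a := min ε 1) (by rw [h]; positivity)
    have := hc.dist_le hS (hc'.trans_le (min_le_right _ _))
    have := min_le_left ε 1
    linarith

/-! ### Warped cones in linearizations by unitary operators -/

/-- A linearization of the transformation group `(Γ, M)` by unitary operators of the Hilbert
space `H`: a topological embedding of `M` into the unit sphere of `H` and a unitary
representation of `Γ` on `H` which restricts to the given action on `M`. -/
structure UnitaryLinearization (𝕜 Γ M H : Type*) [RCLike 𝕜] [Group Γ] [TopologicalSpace M]
    [MulAction Γ M] [NormedAddCommGroup H] [InnerProductSpace 𝕜 H] where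
  ι : M → H
  isEmbedding : IsEmbedding ι
  norm_eq_one : ∀ m, ‖ι m‖ = 1
  U : Γ →* (H ≃ₗᵢ[𝕜] H)
  map_smul : ∀ (γ : Γ) (m : M), ι (γ • m) = U γ (ι m)

namespace UnitaryLinearization

variable {𝕜 Γ M H : Type*} [RCLike 𝕜] [Group Γ] [TopologicalSpace M]
    [MulAction Γ M] [NormedAddCommGroup H] [InnerProductSpace 𝕜 H]

/-- The open cone of `M` in `H`: the union of all rays through the origin that meet the embedded
copy of `M`, with the metric induced from `H`. -/
def openCone (L : UnitaryLinearization 𝕜 Γ M H) : Set H :=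
  {x | ∃ (t : ℝ) (m : M), 0 ≤ t ∧ x = (t : 𝕜) • L.ι m}

/-- `Γ` acts on the open cone by restriction of the unitary operators. -/
instance (L : UnitaryLinearization 𝕜 Γ M H) : MulAction Γ L.openCone where
  smul γ x := ⟨L.U γ x, by
    obtain ⟨_, t, m, ht, rfl⟩ := x
    exact ⟨t, γ • m, ht, by rw [L.map_smul]; simp⟩⟩
  one_smul x := Subtype.ext (by change L.U 1 (x : H) = x; simp)
  mul_smul γ γ' x := Subtype.ext (by
    change L.U (γ * γ') (x : H) = L.U γ (L.U γ' x); simp)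

/-- The warped cone: the open cone with the metric obtained by warping along the action of `Γ`. -/
abbrev warpedCone (L : UnitaryLinearization 𝕜 Γ M H) (S : Set Γ)
    (hS : Subgroup.closure S = ⊤) : Type _ :=
  WarpedSpace S hS L.openCone

end UnitaryLinearization

/-! ### Fibred coarse embeddings -/

/-- A fibred coarse embedding of the metric space `X` into the Banach space `E`. -/
structure FibredCoarseEmbedding (𝕜 : Type*) [RCLike 𝕜] (X : Type*) [MetricSpace X]
    (E : Type v) [NormedAddCommGroup E] [NormedSpace 𝕜 E] where
  /-- the field of Banach spaces over `X` -/
  fiber : X → Type v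
  [normedAddCommGroup : ∀ x, NormedAddCommGroup (fiber x)]
  [normedSpace : ∀ x, NormedSpace 𝕜 (fiber x)]
  [completeSpace : ∀ x, CompleteSpace (fiber x)]
  /-- the section -/
  s : ∀ x, fiber x
  /-- the control functions -/
  ρ₁ : ℝ≥0 → ℝ
  ρ₂ : ℝ≥0 → ℝ
  monotone_ρ₁ : Monotone ρ₁
  monotone_ρ₂ : Monotone ρ₂
  tendsto_ρ₁ : Tendsto ρ₁ atTop atTop
  tendsto_ρ₂ : Tendsto ρ₂ atTop atTop
  /-- local trivializations `t C` over the sets `C ⊆ X \ K` of diameter less than `r` -/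
  exists_trivialization : ∀ r : ℝ, 0 < r → ∃ K : Set X, Bornology.IsBounded K ∧
    ∃ t : ∀ C : {C : Set X // C ⊆ Kᶜ ∧ Metric.ediam C < ENNReal.ofReal r},
      ∀ x : C.1, fiber x ≃ᵃⁱ[𝕜] E,
      (∀ C, ∀ x y : C.1,
        ρ₁ (nndist x y) ≤ ‖t C x (s x) - t C y (s y)‖ ∧
        ‖t C x (s x) - t C y (s y)‖ ≤ ρ₂ (nndist x y)) ∧
      ∀ C₁ C₂, (C₁.1 ∩ C₂.1).Nonempty → ∃ T : E ≃ᵃⁱ[𝕜] E,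
        ∀ (x : X) (h₁ : x ∈ C₁.1) (h₂ : x ∈ C₂.1),
          (t C₂ ⟨x, h₂⟩).symm.trans (t C₁ ⟨x, h₁⟩) = T

/-- `X` admits a fibred coarse embedding into `E`. -/
def AdmitsFibredCoarseEmbedding (𝕜 : Type*) [RCLike 𝕜] (X : Type*) [MetricSpace X]
    (E : Type v) [NormedAddCommGroup E] [NormedSpace 𝕜 E] : Prop :=
  Nonempty (FibredCoarseEmbedding 𝕜 X E)

/-! ### Proper affine isometric actions -/

/-- The discrete group `Γ` admits an affine isometric action `α` on `E` which is metrically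
proper: writing `α γ ξ = π γ ξ + b γ`, one has `‖b γ‖ = ‖α γ 0‖ → ∞` as `γ → ∞` in `Γ`. -/
def AdmitsProperAffineIsometricAction (𝕜 : Type*) [RCLike 𝕜] (Γ : Type*) [Group Γ]
    (E : Type*) [NormedAddCommGroup E] [NormedSpace 𝕜 E] : Prop :=
  ∃ α : Γ →* (E ≃ᵃⁱ[𝕜] E), Tendsto (fun γ => ‖α γ 0‖) cofinite atTop

/-- The Haagerup property (a-T-menability): `Γ` admits a proper affine isometric action on a
(real) Hilbert space. -/
def HaagerupProperty (Γ : Type u) [Group Γ] : Prop :=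
  ∃ (H : Type u) (_ : NormedAddCommGroup H) (_ : InnerProductSpace ℝ H) (_ : CompleteSpace H),
    AdmitsProperAffineIsometricAction ℝ Γ H

/-! ### Classes of Banach spaces and of groups -/

/-- `E` has Rademacher type `p` for some `p ∈ (1, 2]`: there is a constant `C` with
`(𝔼 ‖∑ εᵢ xᵢ‖ ^ p) ^ (1 / p) ≤ C (∑ ‖xᵢ‖ ^ p) ^ (1 / p)` for all finite families `x`, where the
average is over all choices of signs. -/
def HasNontrivialType (E : Type*) [NormedAddCommGroup E] : Prop :=
  ∃ p : ℝ, 1 < p ∧ p ≤ 2 ∧ ∃ C : ℝ, ∀ (n : ℕ) (x : Fin n → E),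
    ((∑ ε : Fin n → ℤˣ, ‖∑ i, ε i • x i‖ ^ p) / 2 ^ n) ^ (1 / p) ≤
      C * (∑ i, ‖x i‖ ^ p) ^ (1 / p)

/-- The topological group `G` is a (real, Hausdorff, finite-dimensional) Lie group. -/
def AdmitsLieGroupStructure (G : Type*) [Group G] [TopologicalSpace G] : Prop :=
  T2Space G ∧ ∃ (n : ℕ) (_ : ChartedSpace (EuclideanSpace ℝ (Fin n)) G), LieGroup (𝓡 n) (⊤ : ℕ∞) G

/-!
The four equivalences share one mechanism, and only the stability properties of the classes of
Banach spaces differ.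

**From fibred coarse embeddings to actions.** Let `F` be a fibred coarse embedding of the warped
cone into `E`. Choosing origins in the fibres turns the local trivializations into affine isometries
`A x y` of `E`, defined for `x`, `y` far from the origin of the cone, which form a cocycle at small
scales and move the origin by an amount controlled by the distance of `x` and `y`
(`FibredCoarseEmbedding.exists_transition`). On the slice of the cone at height `t`, the points
`t g` and `t γ⁻¹ g` are at warped distance about `|γ|` if `t` is large, because `Γ` acts freely on
the compact space `G` (`UnitaryLinearization.exists_forall_eq_of_dist_lt`). Hence the affine
isometries of `L_p (G; E)` which combine the translation by `γ` with the field
`g ↦ A (t g) (t γ⁻¹ g)` satisfy each relation of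
`Γ` once `t` is large, and an ultraproduct over `t → ∞` is a proper action of `Γ` on an ultrapower
of `L_p (G; E)` (`FibredCoarseEmbedding.admitsProperAffineIsometricAction`). To have no
measurability issue, the slices are discretized by simple functions.

**From actions to fibred coarse embeddings.** Let `α` be a proper affine isometric action on `E`,
and let `J : H → Z` be a map into a Banach space which multiplies distances by a constant. Then
`x ↦ (g ↦ J (g⁻¹ x))` is a distance scaling map of the cone into `L_p (G; Z)` which is equivariant
for the translations; here density of `Γ` is used. With the sum of `α` and the translation action on
`E ⊕ L_p (G; Z)`, every set of bounded diameter far from the origin is trivialized by translating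
its points with their coordinates in `Γ`, which are unique
(`UnitaryLinearization.admitsFibredCoarseEmbedding_of_properAction`). The map `J` is a Gaussian
embedding into an `L_p`-space (`HilbertBasis.exists_gaussian_embedding`) or the extension of scalars
of a real Hilbert space.

**Stability.** Uniform convexity, Rademacher type and the parallelogram law can be expressed by
inequalities `0 ≤ ∑ⱼ aⱼ ‖∑ᵢ cⱼᵢ xᵢ‖ ^ p`, which pass to Bochner spaces `L_p (G; E)`, to
`ℓ_p`-sums of two spaces and to ultrapowers (`SatisfiesNormInequality`). For `L_p`-spaces, the
equivalent of such a characterization is an `LpStructure`: a Boolean ring of projections with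
`‖x‖ ^ p = ‖T a x‖ ^ p + ‖x - T a x‖ ^ p` which is rich in the sense that every vector is
approximately a combination of projections of any other vector on the band where the latter
dominates. This also passes to Bochner spaces, sums and ultrapowers, and a Banach space with such a
structure is an `L_p`-space (`LpStructure.exists_equiv_Lp`): it is the `ℓ_p`-sum of cyclic bands,
each of which is the `L_p`-space of a spectral measure on the Stone space of the Boolean ring.
-/

/-! ### Proper affine isometric actions in terms of cocycles -/

section Cocycles

variable {𝕜 : Type*} [RCLike 𝕜] {Γ : Type*} [Group Γ] {E : Type*} [NormedAddCommGroup E]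
  [NormedSpace 𝕜 E] {F : Type*} [NormedAddCommGroup F] [NormedSpace 𝕜 F]

/-- An affine isometric action splits into its linear part and a cocycle. -/
theorem AdmitsProperAffineIsometricAction.exists_cocycle
    (h : AdmitsProperAffineIsometricAction 𝕜 Γ E) :
    ∃ (π : Γ → E ≃ₗᵢ[𝕜] E) (b : Γ → E), (∀ x, π 1 x = x) ∧
      (∀ γ γ' x, π (γ * γ') x = π γ (π γ' x)) ∧
      (∀ γ γ', b (γ * γ') = π γ (b γ') + b γ) ∧ Tendsto (fun γ => ‖b γ‖) cofinite atTop := by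
  obtain ⟨α, hα⟩ := h
  have key : ∀ γ x, α γ x = (α γ).linearIsometryEquiv x + α γ 0 := fun γ x => by
    simpa using (α γ).map_vadd 0 x
  refine ⟨fun γ => (α γ).linearIsometryEquiv, fun γ => α γ 0, fun x => ?_, fun γ γ' x => ?_,
    fun γ γ' => ?_, hα⟩
  · have := key 1 x
    simpa using this.symm
  · have h1 := key (γ * γ') x
    have h2 := key γ (α γ' x)
    have h3 := key γ' x
    have h4 := key γ (α γ' 0)
    rw [map_mul] at h1
    have h5 : (α γ * α γ') x = α γ (α γ' x) := rfl
    have h6 : (α γ * α γ') 0 = α γ (α γ' 0) := rfl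
    rw [h5, h6, h2, h3, h4, map_add] at h1
    change (α (γ * γ')).linearIsometryEquiv x = _
    rw [map_mul]
    rw [add_assoc] at h1
    exact (add_right_cancel h1).symm
  · change α (γ * γ') 0 = _
    rw [map_mul]
    exact key γ (α γ' 0)

/-- A linear isometric representation together with a cocycle defines an affine isometric
action. -/
theorem exists_monoidHom_of_cocycle (π : Γ → E →ₗᵢ[𝕜] E) (b : Γ → E)
    (h1 : ∀ x, π 1 x = x) (hmul : ∀ γ γ' x, π (γ * γ') x = π γ (π γ' x))
    (hb : ∀ γ γ', b (γ * γ') = π γ (b γ') + b γ) :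
    ∃ α : Γ →* (E ≃ᵃⁱ[𝕜] E), ∀ γ x, α γ x = b γ + π γ x := by
  have hb1 : b 1 = 0 := by simpa [h1] using hb 1 1
  let ρ : Γ → E ≃ₗᵢ[𝕜] E := fun γ => LinearIsometryEquiv.ofSurjective (π γ) fun x =>
    ⟨π γ⁻¹ x, by rw [← hmul, mul_inv_cancel, h1]⟩
  let α : Γ → E ≃ᵃⁱ[𝕜] E := fun γ =>
    (ρ γ).toAffineIsometryEquiv.trans (AffineIsometryEquiv.constVAdd 𝕜 E (b γ))
  have hα : ∀ γ x, α γ x = b γ + π γ x := fun γ x => rfl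
  refine ⟨⟨⟨α, ?_⟩, fun γ γ' => ?_⟩, hα⟩
  · ext x
    simp [hα, hb1, h1]
  · ext x
    change α (γ * γ') x = α γ (α γ' x)
    simp only [hα, hb, hmul, map_add]
    abel

theorem AdmitsProperAffineIsometricAction.of_cocycle (π : Γ → E →ₗᵢ[𝕜] E) (b : Γ → E)
    (h1 : ∀ x, π 1 x = x) (hmul : ∀ γ γ' x, π (γ * γ') x = π γ (π γ' x))
    (hb : ∀ γ γ', b (γ * γ') = π γ (b γ') + b γ)
    (hprop : Tendsto (fun γ => ‖b γ‖) cofinite atTop) :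
    AdmitsProperAffineIsometricAction 𝕜 Γ E := by
  obtain ⟨α, hα⟩ := exists_monoidHom_of_cocycle π b h1 hmul hb
  exact ⟨α, hprop.congr fun γ => by simp [hα]⟩

theorem AdmitsProperAffineIsometricAction.congr (e : E ≃ₗᵢ[𝕜] F)
    (h : AdmitsProperAffineIsometricAction 𝕜 Γ E) : AdmitsProperAffineIsometricAction 𝕜 Γ F := by
  obtain ⟨π, b, h1, h2, h3, h4⟩ := h.exists_cocycle
  refine .of_cocycle
    (fun γ => (((e.symm.trans (π γ)).trans e).toLinearIsometry)) (fun γ => e (b γ)) ?_ ?_ ?_ ?_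
  · intro x; simp [h1]
  · intro γ γ' x; simp [h2]
  · intro γ γ'; simp [h3]
  · simpa using h4

end Cocycles

/-! ### Ultrapowers of Banach spaces -/

section Ultrapower

open BoundedContinuousFunction

variable (𝕜 : Type*) [RCLike 𝕜] (V : Type*) [NormedAddCommGroup V] [NormedSpace 𝕜 V]

/-- The bounded sequences which tend to zero along the ultrafilter `hyperfilter ℕ`. -/
def ultraNull : Submodule 𝕜 (ℕ →ᵇ V) where
  carrier := {f | Tendsto (fun n => ‖f n‖) (hyperfilter ℕ) (𝓝 0)}
  zero_mem' := by simp
  add_mem' {f g} hf hg := by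
    refine squeeze_zero (fun _ => norm_nonneg _) (fun n => norm_add_le _ _) ?_
    simpa using Tendsto.add hf hg
  smul_mem' c f hf := by
    have : Tendsto (fun n => ‖c‖ * ‖f n‖) (hyperfilter ℕ) (𝓝 (‖c‖ * 0)) := Tendsto.const_mul _ hf
    simpa [norm_smul] using this

instance isClosed_ultraNull : IsClosed (ultraNull 𝕜 V : Set (ℕ →ᵇ V)) := by
  refine isClosed_of_closure_subset fun f hf => ?_
  change Tendsto (fun n => ‖f n‖) (hyperfilter ℕ) (𝓝 0)
  rw [Metric.tendsto_nhds]
  intro ε hε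
  obtain ⟨g, hg, hfg⟩ := Metric.mem_closure_iff.1 hf (ε / 2) (half_pos hε)
  have hg : Tendsto (fun n => ‖g n‖) (hyperfilter ℕ) (𝓝 0) := hg
  filter_upwards [Metric.tendsto_nhds.1 hg (ε / 2) (half_pos hε)] with n hn
  simp only [dist_zero_right, norm_norm] at hn ⊢
  have h1 : ‖f n - g n‖ ≤ dist f g := by
    rw [← dist_eq_norm]; exact dist_coe_le_dist n
  have h2 : ‖f n‖ ≤ ‖f n - g n‖ + ‖g n‖ := by simpa using norm_add_le (f n - g n) (g n)
  linarith

/-- The ultrapower of a Banach space: bounded sequences modulo those which tend to zero along a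
fixed non-principal ultrafilter on `ℕ`. -/
abbrev Ultrapower : Type _ := (ℕ →ᵇ V) ⧸ ultraNull 𝕜 V

variable {V}

/-- The element of the ultrapower given by a bounded sequence. -/
noncomputable def Ultrapower.mk (f : ℕ →ᵇ V) : Ultrapower 𝕜 V := Submodule.Quotient.mk f

variable {𝕜}

theorem Ultrapower.mk_surjective (x : Ultrapower 𝕜 V) : ∃ f, Ultrapower.mk 𝕜 f = x :=
  Submodule.Quotient.mk_surjective _ x

theorem Ultrapower.mk_eq_mk {f g : ℕ →ᵇ V} (h : ∀ᶠ n in hyperfilter ℕ, f n = g n) :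
    Ultrapower.mk 𝕜 f = Ultrapower.mk 𝕜 g := by
  refine (Submodule.Quotient.eq _).2 ?_
  change Tendsto (fun n => ‖(f - g) n‖) (hyperfilter ℕ) (𝓝 0)
  refine tendsto_const_nhds.congr' ?_
  filter_upwards [h] with n hn
  simp [hn]

/-- The norm of the ultrapower is the limit of the norms along the ultrafilter. -/
theorem Ultrapower.tendsto_norm (f : ℕ →ᵇ V) :
    Tendsto (fun n => ‖f n‖) (hyperfilter ℕ) (𝓝 ‖Ultrapower.mk 𝕜 f‖) := by
  obtain ⟨l, -, hl⟩ := (isCompact_Icc (a := (0 : ℝ)) (b := ‖f‖)).ultrafilter_le_nhds'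
    ((hyperfilter ℕ).map fun n => ‖f n‖)
    (Eventually.of_forall (p := fun n => ‖f n‖ ∈ Set.Icc 0 ‖f‖) fun n =>
      ⟨norm_nonneg _, f.norm_coe_le_norm n⟩)
  have hl : Tendsto (fun n => ‖f n‖) (hyperfilter ℕ) (𝓝 l) := hl
  have h0 : 0 ≤ l := ge_of_tendsto' hl fun _ => norm_nonneg _
  suffices ‖Ultrapower.mk 𝕜 f‖ = l by rwa [this]
  refine le_antisymm (le_of_forall_pos_le_add fun ε hε => ?_) ?_
  · classical
    -- truncating `f` outside a large set does not change its class
    let g : ℕ →ᵇ V := ofNormedAddCommGroupDiscrete (fun n => if ‖f n‖ ≤ l + ε then f n else 0)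
      (l + ε) fun n => by
        split_ifs with h
        · exact h
        · simp; positivity
    have hg : Ultrapower.mk 𝕜 f = Ultrapower.mk 𝕜 g := by
      refine Ultrapower.mk_eq_mk ?_
      filter_upwards [hl.eventually_le_const (lt_add_of_pos_right l hε)] with n hn
      simp [g, hn]
    rw [hg]
    refine (Submodule.Quotient.norm_mk_le _ g).trans ?_
    refine (norm_le (by positivity)).2 fun n => ?_
    simp only [g, coe_ofNormedAddCommGroupDiscrete]
    split_ifs with h
    · exact h
    · simp; positivity
  · refine le_of_forall_pos_le_add fun ε hε => ?_
    obtain ⟨h, hh, hlt⟩ := Submodule.Quotient.norm_mk_lt (S := ultraNull 𝕜 V)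
      (Ultrapower.mk 𝕜 f) hε
    have hd : f - h ∈ ultraNull 𝕜 V := (Submodule.Quotient.eq _).1 hh.symm
    have hd : Tendsto (fun n => ‖(f - h) n‖) (hyperfilter ℕ) (𝓝 0) := hd
    refine le_of_tendsto (by simpa using hl.sub hd) (Eventually.of_forall fun n => ?_)
    have h1 : ‖f n‖ ≤ ‖(f - h) n‖ + ‖h n‖ := by simpa using norm_add_le (f n - h n) (h n)
    have h2 := h.norm_coe_le_norm n
    simp only [BoundedContinuousFunction.sub_apply] at h1 ⊢
    linarith

theorem Ultrapower.mk_add (f g : ℕ →ᵇ V) :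
    Ultrapower.mk 𝕜 (f + g) = Ultrapower.mk 𝕜 f + Ultrapower.mk 𝕜 g := rfl

theorem Ultrapower.mk_sub (f g : ℕ →ᵇ V) :
    Ultrapower.mk 𝕜 (f - g) = Ultrapower.mk 𝕜 f - Ultrapower.mk 𝕜 g := rfl

theorem Ultrapower.mk_smul (c : 𝕜) (f : ℕ →ᵇ V) :
    Ultrapower.mk 𝕜 (c • f) = c • Ultrapower.mk 𝕜 f := rfl

theorem Ultrapower.mk_sum {ι : Type*} (s : Finset ι) (f : ι → ℕ →ᵇ V) :
    Ultrapower.mk 𝕜 (∑ i ∈ s, f i) = ∑ i ∈ s, Ultrapower.mk 𝕜 (f i) :=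
  map_sum (ultraNull 𝕜 V).mkQ f s

/-- A sequence of linear contractions acts on bounded sequences. -/
noncomputable def boundedSeqMap (T : ℕ → V →ₗ[𝕜] V) (hT : ∀ n v, ‖T n v‖ ≤ ‖v‖) :
    (ℕ →ᵇ V) →ₗ[𝕜] (ℕ →ᵇ V) where
  toFun f := ofNormedAddCommGroupDiscrete (fun n => T n (f n)) ‖f‖ fun n =>
    (hT n _).trans (f.norm_coe_le_norm n)
  map_add' f g := by ext n; simp
  map_smul' c f := by ext n; simp

@[simp]
theorem boundedSeqMap_apply (T : ℕ → V →ₗ[𝕜] V) (hT : ∀ n v, ‖T n v‖ ≤ ‖v‖) (f : ℕ →ᵇ V) (n : ℕ) :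
    boundedSeqMap T hT f n = T n (f n) := rfl

/-- The linear map on the ultrapower induced by a sequence of linear contractions. -/
noncomputable def Ultrapower.map (T : ℕ → V →ₗ[𝕜] V) (hT : ∀ n v, ‖T n v‖ ≤ ‖v‖) :
    Ultrapower 𝕜 V →ₗ[𝕜] Ultrapower 𝕜 V :=
  Submodule.mapQ _ _ (boundedSeqMap T hT) fun f hf => by
    have hf : Tendsto (fun n => ‖f n‖) (hyperfilter ℕ) (𝓝 0) := hf
    exact squeeze_zero (fun _ => norm_nonneg _) (fun n => hT n (f n)) hf

theorem Ultrapower.map_mk (T : ℕ → V →ₗ[𝕜] V) (hT : ∀ n v, ‖T n v‖ ≤ ‖v‖) (f : ℕ →ᵇ V) :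
    Ultrapower.map T hT (Ultrapower.mk 𝕜 f) = Ultrapower.mk 𝕜 (boundedSeqMap T hT f) := rfl

/-- The linear isometry of the ultrapower induced by a sequence of linear isometries. -/
noncomputable def Ultrapower.mapIsometry (T : ℕ → V →ₗᵢ[𝕜] V) :
    Ultrapower 𝕜 V →ₗᵢ[𝕜] Ultrapower 𝕜 V where
  toLinearMap := Ultrapower.map (fun n => (T n).toLinearMap) fun n v => by simp
  norm_map' x := by
    obtain ⟨f, rfl⟩ := Ultrapower.mk_surjective x
    rw [Ultrapower.map_mk]
    refine tendsto_nhds_unique (Ultrapower.tendsto_norm _) ?_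
    simpa using Ultrapower.tendsto_norm (𝕜 := 𝕜) f

theorem Ultrapower.mapIsometry_mk (T : ℕ → V →ₗᵢ[𝕜] V) (f : ℕ →ᵇ V) :
    Ultrapower.mapIsometry T (Ultrapower.mk 𝕜 f) =
      Ultrapower.mk 𝕜 (boundedSeqMap (fun n => (T n).toLinearMap) (fun n v => by simp) f) := rfl

end Ultrapower

/-- If linear isometries `π n γ` and vectors `b n γ` satisfy, for all `γ` and `γ'`, the relations
of a cocycle for all large `n`, then they induce a cocycle on the ultrapower. It is proper if
`‖b n γ‖ ≥ φ γ` for all large `n` and `φ` is proper. -/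
theorem AdmitsProperAffineIsometricAction.ultrapower {𝕜 : Type*} [RCLike 𝕜] {Γ : Type*} [Group Γ]
    {V : Type*} [NormedAddCommGroup V] [NormedSpace 𝕜 V] (π : ℕ → Γ → V →ₗᵢ[𝕜] V)
    (b : ℕ → Γ → V) (φ : Γ → ℝ) (hφ : Tendsto φ cofinite atTop)
    (hbdd : ∀ γ, ∃ C, ∀ n, ‖b n γ‖ ≤ C)
    (h1 : ∀ᶠ n in atTop, ∀ x, π n 1 x = x)
    (hmul : ∀ γ γ', ∀ᶠ n in atTop, ∀ x, π n (γ * γ') x = π n γ (π n γ' x))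
    (hb : ∀ γ γ', ∀ᶠ n in atTop, b n (γ * γ') = π n γ (b n γ') + b n γ)
    (hlow : ∀ γ, ∀ᶠ n in atTop, φ γ ≤ ‖b n γ‖) :
    AdmitsProperAffineIsometricAction 𝕜 Γ (Ultrapower 𝕜 V) := by
  choose C hC using hbdd
  let B : Γ → BoundedContinuousFunction ℕ V := fun γ =>
    BoundedContinuousFunction.ofNormedAddCommGroupDiscrete (fun n => b n γ) (C γ) (hC γ)
  have hB : ∀ γ n, B γ n = b n γ := fun _ _ => rfl
  have hle : (hyperfilter ℕ : Filter ℕ) ≤ atTop := by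
    rw [← Nat.cofinite_eq_atTop]; exact hyperfilter_le_cofinite
  refine .of_cocycle (fun γ => Ultrapower.mapIsometry fun n => π n γ)
    (fun γ => Ultrapower.mk 𝕜 (B γ)) ?_ ?_ ?_ ?_
  · intro x
    obtain ⟨f, rfl⟩ := Ultrapower.mk_surjective x
    refine Ultrapower.mk_eq_mk ?_
    filter_upwards [h1.filter_mono hle] with n hn
    exact hn _
  · intro γ γ' x
    obtain ⟨f, rfl⟩ := Ultrapower.mk_surjective x
    refine Ultrapower.mk_eq_mk ?_
    filter_upwards [(hmul γ γ').filter_mono hle] with n hn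
    exact hn _
  · intro γ γ'
    rw [Ultrapower.mapIsometry_mk, ← Ultrapower.mk_add]
    refine Ultrapower.mk_eq_mk ?_
    filter_upwards [(hb γ γ').filter_mono hle] with n hn
    exact hn
  · refine tendsto_atTop_mono (fun γ => ?_) hφ
    exact ge_of_tendsto (Ultrapower.tendsto_norm (B γ)) ((hlow γ).filter_mono hle)

/-! ### Homogeneous norm inequalities -/

section NormInequality

variable {𝕜 : Type*} [RCLike 𝕜] {ι κ : Type*} [Fintype ι] [Fintype κ]

/-- The space `E` satisfies the `p`-homogeneous inequality
`0 ≤ ∑ⱼ aⱼ ‖∑ᵢ cⱼᵢ xᵢ‖ ^ p` for all families of vectors `x`. -/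
def SatisfiesNormInequality (p : ℝ) (a : κ → ℝ) (c : κ → ι → 𝕜) (E : Type*)
    [NormedAddCommGroup E] [NormedSpace 𝕜 E] : Prop :=
  ∀ x : ι → E, 0 ≤ ∑ j, a j * ‖∑ i, c j i • x i‖ ^ p

variable {E F : Type*} [NormedAddCommGroup E] [NormedSpace 𝕜 E] [NormedAddCommGroup F]
  [NormedSpace 𝕜 F] {a : κ → ℝ} {c : κ → ι → 𝕜}

theorem SatisfiesNormInequality.ultrapower {p : ℝ} (hp : 0 ≤ p)
    (h : SatisfiesNormInequality p a c E) : SatisfiesNormInequality p a c (Ultrapower 𝕜 E) := by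
  intro x
  choose f hf using fun i => Ultrapower.mk_surjective (x i)
  have key : ∀ j, ∑ i, c j i • x i = Ultrapower.mk 𝕜 (∑ i, c j i • f i) := fun j => by
    rw [Ultrapower.mk_sum]
    simp [Ultrapower.mk_smul, hf]
  have hlim : Tendsto (fun n => ∑ j, a j * ‖∑ i, c j i • f i n‖ ^ p) (hyperfilter ℕ)
      (𝓝 (∑ j, a j * ‖∑ i, c j i • x i‖ ^ p)) := by
    refine tendsto_finsetSum _ fun j _ => Tendsto.const_mul _ ?_
    rw [key]
    simpa using (Ultrapower.tendsto_norm (𝕜 := 𝕜) (∑ i, c j i • f i)).rpow_const (Or.inr hp)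
  exact ge_of_tendsto' hlim fun n => h _

/-- The `p`-th power of the norm of an element of `Lp` is an integral. -/
theorem Lp_norm_rpow_eq_integral {α : Type*} [MeasurableSpace α] {μ : Measure α} {p : ℝ≥0∞}
    (hp0 : p ≠ 0) (hp : p ≠ ∞) (f : Lp E p μ) :
    ‖f‖ ^ p.toReal = ∫ x, ‖f x‖ ^ p.toReal ∂μ := by
  have hpos := ENNReal.toReal_pos hp0 hp
  have h0 : 0 ≤ ∫ x, ‖f x‖ ^ p.toReal ∂μ := integral_nonneg fun _ => by positivity
  rw [Lp.norm_def, (Lp.memLp f).eLpNorm_eq_integral_rpow_norm hp0 hp,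
    ENNReal.toReal_ofReal (by positivity), ← Real.rpow_mul h0, inv_mul_cancel₀ hpos.ne',
    Real.rpow_one]

theorem SatisfiesNormInequality.Lp {α : Type*} [MeasurableSpace α] (μ : Measure α) {p : ℝ≥0∞}
    [Fact (1 ≤ p)] (hp : p ≠ ∞) (h : SatisfiesNormInequality p.toReal a c E) :
    SatisfiesNormInequality p.toReal a c (Lp E p μ) := by
  intro x
  have hp0 : p ≠ 0 := (zero_lt_one.trans_le (Fact.out : 1 ≤ p)).ne'
  simp_rw [Lp_norm_rpow_eq_integral hp0 hp, ← integral_const_mul]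
  rw [← integral_finsetSum _ fun j _ =>
    ((Lp.memLp (∑ i, c j i • x i)).integrable_norm_rpow hp0 hp).const_mul (a j)]
  refine integral_nonneg_of_ae ?_
  have key : ∀ᵐ t ∂μ, ∀ j, (∑ i, c j i • x i : MeasureTheory.Lp E p μ) t =
      ∑ i, c j i • x i t := by
    refine ae_all_iff.2 fun j => ?_
    have h2 : ∀ᵐ t ∂μ, ∀ i, (c j i • x i : MeasureTheory.Lp E p μ) t = c j i • x i t :=
      ae_all_iff.2 fun i => Lp.coeFn_smul _ _
    filter_upwards [Lp.coeFn_fun_finsetSum Finset.univ fun i => c j i • x i, h2] with t h1 h2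
    rw [h1]
    simp [h2]
  filter_upwards [key] with t ht
  simp only [ht]
  exact h _

theorem SatisfiesNormInequality.prod {p : ℝ≥0∞} [Fact (1 ≤ p)] (hp : p ≠ ∞)
    (hE : SatisfiesNormInequality p.toReal a c E) (hF : SatisfiesNormInequality p.toReal a c F) :
    SatisfiesNormInequality p.toReal a c (WithLp p (E × F)) := by
  intro x
  have hpos : 0 < p.toReal :=
    ENNReal.toReal_pos (zero_lt_one.trans_le (Fact.out : 1 ≤ p)).ne' hp
  have key : ∀ y : WithLp p (E × F),
      ‖y‖ ^ p.toReal = ‖y.fst‖ ^ p.toReal + ‖y.snd‖ ^ p.toReal := fun y => by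
    rw [WithLp.prod_norm_eq_add hpos, ← Real.rpow_mul (by positivity), one_div_mul_cancel hpos.ne',
      Real.rpow_one]
  simp_rw [key, mul_add, Finset.sum_add_distrib]
  have h1 : ∀ s : ι → WithLp p (E × F), (∑ i, s i).fst = ∑ i, (s i).fst := fun s =>
    map_sum (WithLp.fstL p 𝕜 E F) _ _
  have h2 : ∀ s : ι → WithLp p (E × F), (∑ i, s i).snd = ∑ i, (s i).snd := fun s =>
    map_sum (WithLp.sndL p 𝕜 E F) _ _
  simp_rw [h1, h2, WithLp.smul_fst, WithLp.smul_snd]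
  exact add_nonneg (hE _) (hF _)

end NormInequality

/-! ### Simple operator fields on Bochner spaces -/

section OperatorFields

variable {𝕜 : Type*} [RCLike 𝕜] {α : Type*} [MeasurableSpace α] {μ : Measure α} {p : ℝ≥0∞}
  {E : Type*} [NormedAddCommGroup E] [NormedSpace 𝕜 E]

/-- A family of linear maps which depends on a point in the manner of a simple function sends
strongly measurable functions to strongly measurable functions. -/
theorem aestronglyMeasurable_simpleFunc_apply {β : Type*} (A : SimpleFunc α β)
    (op : β → E →L[𝕜] E) {f : α → E} (hf : AEStronglyMeasurable f μ) :
    AEStronglyMeasurable (fun x => op (A x) (f x)) μ := by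
  have h1 : AEStronglyMeasurable (fun x => ((A.map op) x, f x)) μ :=
    (A.map op).aestronglyMeasurable.prodMk hf
  exact (isBoundedBilinearMap_apply (𝕜 := 𝕜) (E := E) (F := E)).continuous.comp_aestronglyMeasurable
    h1

theorem memLp_simpleFunc_apply {β : Type*} (A : SimpleFunc α β) (op : β → E →ₗ[𝕜] E)
    (hop : ∀ b v, ‖op b v‖ ≤ ‖v‖) {f : α → E} (hf : MemLp f p μ) :
    MemLp (fun x => op (A x) (f x)) p μ := by
  refine hf.of_le (aestronglyMeasurable_simpleFunc_apply (𝕜 := 𝕜) A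
    (fun b => (op b).mkContinuous 1 fun v => by simpa using hop b v) hf.1) ?_
  exact Eventually.of_forall fun x => hop _ _

/-- The operator on `Lp` which applies to `f x` the contraction `op (A x)`, where `A` is a simple
function. -/
noncomputable def Lp_simpleFuncMap {β : Type*} (A : SimpleFunc α β) (op : β → E →ₗ[𝕜] E)
    (hop : ∀ b v, ‖op b v‖ ≤ ‖v‖) : Lp E p μ →ₗ[𝕜] Lp E p μ where
  toFun f := (memLp_simpleFunc_apply A op hop (Lp.memLp f)).toLp _
  map_add' f g := by
    refine Lp.ext ?_
    filter_upwards [(memLp_simpleFunc_apply A op hop (Lp.memLp (f + g))).coeFn_toLp,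
      (memLp_simpleFunc_apply A op hop (Lp.memLp f)).coeFn_toLp,
      (memLp_simpleFunc_apply A op hop (Lp.memLp g)).coeFn_toLp, Lp.coeFn_add f g,
      Lp.coeFn_add ((memLp_simpleFunc_apply A op hop (Lp.memLp f)).toLp _)
        ((memLp_simpleFunc_apply A op hop (Lp.memLp g)).toLp _)] with x h1 h2 h3 h4 h5
    rw [h1, h5, Pi.add_apply, h2, h3, h4, Pi.add_apply, map_add]
  map_smul' c f := by
    refine Lp.ext ?_
    filter_upwards [(memLp_simpleFunc_apply A op hop (Lp.memLp (c • f))).coeFn_toLp,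
      (memLp_simpleFunc_apply A op hop (Lp.memLp f)).coeFn_toLp, Lp.coeFn_smul c f,
      Lp.coeFn_smul c ((memLp_simpleFunc_apply A op hop (Lp.memLp f)).toLp _)] with x h1 h2 h4 h5
    rw [h1, RingHom.id_apply, h5, Pi.smul_apply, h2, h4, Pi.smul_apply, map_smul]

theorem coeFn_Lp_simpleFuncMap {β : Type*} (A : SimpleFunc α β) (op : β → E →ₗ[𝕜] E)
    (hop : ∀ b v, ‖op b v‖ ≤ ‖v‖) (f : Lp E p μ) :
    Lp_simpleFuncMap A op hop f =ᵐ[μ] fun x => op (A x) (f x) :=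
  (memLp_simpleFunc_apply A op hop (Lp.memLp f)).coeFn_toLp

variable [Fact (1 ≤ p)]

/-- The isometry of `Lp` given by a measure preserving map followed by a simple field of linear
isometries. -/
noncomputable def Lp_weightedComp {β : Type*} (A : SimpleFunc α β) (op : β → E →ₗᵢ[𝕜] E)
    {θ : α → α} (hθ : MeasurePreserving θ μ μ) : Lp E p μ →ₗᵢ[𝕜] Lp E p μ where
  toLinearMap := (Lp_simpleFuncMap A (fun b => (op b).toLinearMap) fun b v => by simp).comp
    (Lp.compMeasurePreservingₗ 𝕜 θ hθ)
  norm_map' f := by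
    have h1 : ‖Lp.compMeasurePreserving θ hθ f‖ = ‖f‖ := Lp.norm_compMeasurePreserving f hθ
    rw [← h1]
    rw [Lp.norm_def, Lp.norm_def]
    refine congrArg _ (eLpNorm_congr_norm_ae ?_)
    filter_upwards [coeFn_Lp_simpleFuncMap A (fun b => (op b).toLinearMap) (fun b v => by simp)
      (Lp.compMeasurePreserving θ hθ f)] with x hx
    refine (congrArg norm hx).trans ?_
    simp

theorem coeFn_Lp_weightedComp {β : Type*} (A : SimpleFunc α β) (op : β → E →ₗᵢ[𝕜] E)
    {θ : α → α} (hθ : MeasurePreserving θ μ μ) (f : Lp E p μ) :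
    Lp_weightedComp A op hθ f =ᵐ[μ] fun x => op (A x) (f (θ x)) := by
  filter_upwards [coeFn_Lp_simpleFuncMap A (fun b => (op b).toLinearMap) (fun b v => by simp)
    (Lp.compMeasurePreserving θ hθ f), Lp.coeFn_compMeasurePreserving f hθ] with x h1 h2
  refine h1.trans ?_
  rw [h2]
  rfl

end OperatorFields

/-! ### Boolean rings of `L_p`-projections -/

/-- A Boolean ring of `L_p`-projections on a Banach space `X`, rich enough to make `X` an
abstract `L_p`-space. The elements `a` of the Boolean ring `R` play the role of measurable sets and
`T a` that of the multiplication by the indicator of `a`. The field `approx` expresses that any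
`f` is, outside of a set on which `h` is small, uniformly approximable by step multiples of `h`;
the number of steps and their values depend on the precision only, which makes the notion stable
under ultrapowers. -/
structure LpStructure (𝕜 : Type*) [RCLike 𝕜] (p : ℝ) (X : Type*) [NormedAddCommGroup X]
    [NormedSpace 𝕜 X] (R : Type*) [CommRing R] where
  /-- the projection attached to an element of the Boolean ring -/
  T : R → X →ₗ[𝕜] X
  mul_self : ∀ a : R, a * a = a
  T_mul : ∀ a b x, T (a * b) x = T a (T b x)
  T_one_sub : ∀ a x, T (1 - a) x = x - T a x
  norm_rpow : ∀ a x, ‖T a x‖ ^ p + ‖x - T a x‖ ^ p = ‖x‖ ^ p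
  approx : ∀ ε : ℝ, 0 < ε → ∃ (N : ℕ) (c : Fin N → 𝕜), ∀ (f h : X) (η : ℝ), 0 < η →
    ∃ (b : R) (a : Fin N → R),
      ‖T b f - ∑ j, c j • T (a j) h‖ ≤ ε * ‖h‖ + η ∧ ‖h - T b h‖ ≤ ε * ‖f‖ + η

namespace LpStructure

section Basic

variable {𝕜 : Type*} [RCLike 𝕜] {p : ℝ} {X : Type*} [NormedAddCommGroup X]
    [NormedSpace 𝕜 X] {R : Type*} [CommRing R] (S : LpStructure 𝕜 p X R)

include S

theorem norm_T_le (hp : 0 < p) (a : R) (x : X) : ‖S.T a x‖ ≤ ‖x‖ := by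
  refine (Real.rpow_le_rpow_iff (norm_nonneg _) (norm_nonneg _) hp).1 ?_
  rw [← S.norm_rpow a x]
  exact le_add_of_nonneg_right (by positivity)

theorem norm_sub_T_le (hp : 0 < p) (a : R) (x : X) : ‖x - S.T a x‖ ≤ ‖x‖ := by
  refine (Real.rpow_le_rpow_iff (norm_nonneg _) (norm_nonneg _) hp).1 ?_
  rw [← S.norm_rpow a x]
  exact le_add_of_nonneg_left (by positivity)

theorem T_T_self (a : R) (x : X) : S.T a (S.T a x) = S.T a x := by
  rw [← S.T_mul, S.mul_self]

theorem T_comm (a b : R) (x : X) : S.T a (S.T b x) = S.T b (S.T a x) := by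
  rw [← S.T_mul, mul_comm, S.T_mul]

theorem T_zero (x : X) : S.T 0 x = 0 := by
  have h : S.T (0 * (1 - 0)) x = 0 := by
    rw [S.T_mul, S.T_one_sub, map_sub, S.T_T_self, sub_self]
  simpa using h

theorem T_one (x : X) : S.T 1 x = x := by
  simpa [S.T_zero] using S.T_one_sub 0 x

theorem T_add {a b : R} (hab : a * b = 0) (x : X) : S.T (a + b) x = S.T a x + S.T b x := by
  have h : S.T (1 - (1 - a) * (1 - b)) x = S.T a x + S.T b x := by
    rw [S.T_one_sub, S.T_mul, S.T_one_sub, S.T_one_sub, map_sub, ← S.T_mul, hab, S.T_zero]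
    abel
  rw [← h]
  congr 2
  linear_combination hab

end Basic

end LpStructure

/-- Near each point of a compact set contained in the closure of a sequence there is one of the
first terms of the sequence, and the number of terms can be chosen uniformly. -/
theorem exists_edist_nearestPt_lt {α : Type*} [PseudoEMetricSpace α] [MeasurableSpace α]
    [OpensMeasurableSpace α] {K : Set α} (hK : IsCompact K) (e : ℕ → α)
    (he : K ⊆ closure (Set.range e)) {ε : ℝ≥0∞} (hε : 0 < ε) :
    ∃ N, ∀ x ∈ K, edist (SimpleFunc.nearestPt e N x) x < ε := by
  obtain ⟨N, hN⟩ := hK.elim_directed_cover (fun N => ⋃ k ≤ N, Metric.eball (e k) ε)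
    (fun N => isOpen_biUnion fun _ _ => Metric.isOpen_eball) (fun x hx => by
      obtain ⟨_, ⟨k, rfl⟩, hk⟩ := EMetric.mem_closure_iff.1 (he hx) ε hε
      simp only [Set.mem_iUnion]
      exact ⟨k, k, le_rfl, hk⟩)
    (Monotone.directed_le fun m n hmn =>
      Set.biUnion_subset_biUnion_left fun k (hk : k ≤ m) => le_trans hk hmn)
  refine ⟨N, fun x hx => ?_⟩
  obtain ⟨k, hk, hx⟩ : ∃ k ≤ N, x ∈ Metric.eball (e k) ε := by simpa using hN hx
  exact (SimpleFunc.edist_nearestPt_le e x hk).trans_lt (by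
    rw [edist_comm]; exact hx)

/-- The projection of a module attached to an element of the field with two elements. -/
def zmodTwoProj (𝕜 : Type*) [RCLike 𝕜] (z : ZMod 2) : 𝕜 →ₗ[𝕜] 𝕜 :=
  if z = 0 then 0 else LinearMap.id

theorem zmodTwoProj_apply (𝕜 : Type*) [RCLike 𝕜] (z : ZMod 2) (x : 𝕜) :
    zmodTwoProj 𝕜 z x = if z = 0 then 0 else x := by
  unfold zmodTwoProj
  split_ifs <;> rfl

theorem norm_zmodTwoProj_le (𝕜 : Type*) [RCLike 𝕜] (z : ZMod 2) (x : 𝕜) :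
    ‖zmodTwoProj 𝕜 z x‖ ≤ ‖x‖ := by
  rw [zmodTwoProj_apply]
  split_ifs <;> simp

theorem zmodTwo_eq (z : ZMod 2) : z = 0 ∨ z = 1 := by revert z; decide

section Lp

variable (𝕜 : Type*) [RCLike 𝕜] {Ω : Type*} [MeasurableSpace Ω] (μ : Measure Ω) (p : ℝ≥0∞)

theorem approx_Lp {ε : ℝ} (hε : 0 < ε) : ∃ (N : ℕ) (c : Fin N → 𝕜), ∀ f h : Lp 𝕜 p μ,
    ∃ (b : SimpleFunc Ω (ZMod 2)) (a : Fin N → SimpleFunc Ω (ZMod 2)),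
      ‖Lp_simpleFuncMap b (zmodTwoProj 𝕜) (norm_zmodTwoProj_le 𝕜) f -
        ∑ j, c j • Lp_simpleFuncMap (a j) (zmodTwoProj 𝕜) (norm_zmodTwoProj_le 𝕜) h‖ ≤ ε * ‖h‖ ∧
      ‖h - Lp_simpleFuncMap b (zmodTwoProj 𝕜) (norm_zmodTwoProj_le 𝕜) h‖ ≤ ε * ‖f‖ := by
  classical
  let e : ℕ → 𝕜 := TopologicalSpace.denseSeq 𝕜
  obtain ⟨N, hN⟩ := exists_edist_nearestPt_lt (isCompact_closedBall (0 : 𝕜) ε⁻¹) e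
    (by rw [(TopologicalSpace.denseRange_denseSeq 𝕜).closure_range]; exact Set.subset_univ _)
    (ENNReal.ofReal_pos.2 hε)
  refine ⟨N + 1, fun j => e j, fun f h => ?_⟩
  have hf : Measurable f := (Lp.stronglyMeasurable f).measurable
  have hh : Measurable h := (Lp.stronglyMeasurable h).measurable
  -- on `B` the quotient `f / h` takes its values in a compact ball
  let B : Set Ω := {x | ‖f x‖ ≤ ε⁻¹ * ‖h x‖}
  have hB : MeasurableSet B := measurableSet_le hf.norm (hh.norm.const_mul _)
  let ind : Ω → ℕ := fun x => SimpleFunc.nearestPtInd e N (f x / h x)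
  have hind : ∀ j, MeasurableSet (B ∩ {x | ind x = j}) := fun j =>
    hB.inter ((SimpleFunc.nearestPtInd e N).measurableSet_fiber j |>.preimage (hf.div hh))
  have hindN : ∀ x, ind x < N + 1 := fun x =>
    Nat.lt_succ_of_le (SimpleFunc.nearestPtInd_le e N _)
  let b : SimpleFunc Ω (ZMod 2) := SimpleFunc.piecewise B hB 1 0
  let a : Fin (N + 1) → SimpleFunc Ω (ZMod 2) := fun j =>
    SimpleFunc.piecewise (B ∩ {x | ind x = j}) (hind j) 1 0
  have hb : ∀ x y, zmodTwoProj 𝕜 (b x) y = if x ∈ B then y else 0 := fun x y => by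
    rw [zmodTwoProj_apply]
    by_cases hx : x ∈ B <;> simp [b, SimpleFunc.piecewise_apply, hx]
  have ha : ∀ j x y, zmodTwoProj 𝕜 (a j x) y =
      if x ∈ B ∧ ind x = j then y else 0 := fun j x y => by
    rw [zmodTwoProj_apply]
    by_cases hx : x ∈ B ∧ ind x = j <;> simp [a, SimpleFunc.piecewise_apply, hx]
  refine ⟨b, a, ?_, ?_⟩
  · refine Lp.norm_le_mul_norm_of_ae_le_mul ?_
    have h3 : ∀ᵐ x ∂μ, ∀ j : Fin (N + 1), (e j • Lp_simpleFuncMap (a j) (zmodTwoProj 𝕜)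
        (norm_zmodTwoProj_le 𝕜) h : Lp 𝕜 p μ) x = e j • zmodTwoProj 𝕜 (a j x) (h x) := by
      refine ae_all_iff.2 fun j => ?_
      filter_upwards [Lp.coeFn_smul (e j) (Lp_simpleFuncMap (a j) (zmodTwoProj 𝕜)
        (norm_zmodTwoProj_le 𝕜) h), coeFn_Lp_simpleFuncMap (a j) (zmodTwoProj 𝕜)
        (norm_zmodTwoProj_le 𝕜) h] with x h1 h2
      rw [h1, Pi.smul_apply, h2]
    filter_upwards [coeFn_Lp_simpleFuncMap b (zmodTwoProj 𝕜) (norm_zmodTwoProj_le 𝕜) f,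
      Lp.coeFn_sub (Lp_simpleFuncMap b (zmodTwoProj 𝕜) (norm_zmodTwoProj_le 𝕜) f)
        (∑ j : Fin (N + 1), e j • Lp_simpleFuncMap (a j) (zmodTwoProj 𝕜)
          (norm_zmodTwoProj_le 𝕜) h),
      Lp.coeFn_fun_finsetSum Finset.univ fun j : Fin (N + 1) =>
        e j • Lp_simpleFuncMap (a j) (zmodTwoProj 𝕜) (norm_zmodTwoProj_le 𝕜) h, h3]
      with x h1 h2 h4 h3
    rw [h2, Pi.sub_apply, h1, h4, hb]
    simp only [h3, ha]
    by_cases hx : x ∈ B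
    · rw [Finset.sum_eq_single_of_mem (⟨ind x, hindN x⟩ : Fin (N + 1)) (Finset.mem_univ _)]
      · simp only [hx, and_self, if_true]
        by_cases h0 : h x = 0
        · have : ‖f x‖ ≤ ε⁻¹ * ‖h x‖ := hx
          rw [h0, norm_zero, mul_zero] at this
          simp [h0, norm_le_zero_iff.1 this]
        · have hq : f x / h x ∈ Metric.closedBall (0 : 𝕜) ε⁻¹ := by
            rw [mem_closedBall_zero_iff, norm_div, div_le_iff₀ (norm_pos_iff.2 h0)]
            exact hx
          have h5 := hN _ hq
          rw [edist_lt_ofReal, dist_comm, dist_eq_norm] at h5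
          have h6 : f x - e (ind x) • h x = (f x / h x - SimpleFunc.nearestPt e N (f x / h x)) *
              h x := by
            rw [sub_mul, div_mul_cancel₀ _ h0]
            rfl
          rw [h6, norm_mul]
          gcongr
      · intro j _ hj
        have : ¬ ind x = j := fun h => hj (Fin.ext h.symm)
        simp [this]
    · simp only [hx, false_and, if_false, smul_zero, Finset.sum_const_zero, sub_zero, norm_zero]
      positivity
  · refine Lp.norm_le_mul_norm_of_ae_le_mul ?_
    filter_upwards [coeFn_Lp_simpleFuncMap b (zmodTwoProj 𝕜) (norm_zmodTwoProj_le 𝕜) h,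
      Lp.coeFn_sub h (Lp_simpleFuncMap b (zmodTwoProj 𝕜) (norm_zmodTwoProj_le 𝕜) h)]
      with x h1 h2
    rw [h2, Pi.sub_apply, h1, hb]
    by_cases hx : x ∈ B
    · simp only [hx, if_true, sub_self, norm_zero]
      positivity
    · have : ε⁻¹ * ‖h x‖ < ‖f x‖ := not_le.1 hx
      rw [inv_mul_lt_iff₀ hε] at this
      simpa [hx] using this.le

/-- The projections of `L_p (Ω, μ)` given by the measurable subsets of `Ω`, which are encoded as
simple functions with values in the field with two elements. -/
noncomputable def LpStructure.ofLp [Fact (1 ≤ p)] (hp : p ≠ ∞) :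
    LpStructure 𝕜 p.toReal (Lp 𝕜 p μ) (SimpleFunc Ω (ZMod 2)) where
  T a := Lp_simpleFuncMap a (zmodTwoProj 𝕜) (norm_zmodTwoProj_le 𝕜)
  mul_self a := by
    ext x
    rcases zmodTwo_eq (a x) with h | h <;> simp [h]
  T_mul a b f := by
    refine Lp.ext ?_
    filter_upwards [coeFn_Lp_simpleFuncMap (a * b) (zmodTwoProj 𝕜) (norm_zmodTwoProj_le 𝕜) f,
      coeFn_Lp_simpleFuncMap b (zmodTwoProj 𝕜) (norm_zmodTwoProj_le 𝕜) f,
      coeFn_Lp_simpleFuncMap a (zmodTwoProj 𝕜) (norm_zmodTwoProj_le 𝕜)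
        (Lp_simpleFuncMap b (zmodTwoProj 𝕜) (norm_zmodTwoProj_le 𝕜) f)] with x h1 h2 h3
    rw [h1, h3, h2]
    simp only [zmodTwoProj_apply, SimpleFunc.mul_apply]
    rcases zmodTwo_eq (a x) with h | h <;> simp [h]
  T_one_sub a f := by
    refine Lp.ext ?_
    filter_upwards [coeFn_Lp_simpleFuncMap (1 - a) (zmodTwoProj 𝕜) (norm_zmodTwoProj_le 𝕜) f,
      coeFn_Lp_simpleFuncMap a (zmodTwoProj 𝕜) (norm_zmodTwoProj_le 𝕜) f,
      Lp.coeFn_sub f (Lp_simpleFuncMap a (zmodTwoProj 𝕜) (norm_zmodTwoProj_le 𝕜) f)]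
      with x h1 h2 h3
    rw [h1, h3, Pi.sub_apply, h2]
    simp only [zmodTwoProj_apply, SimpleFunc.sub_apply]
    rcases zmodTwo_eq (a x) with h | h <;> simp [h]
  norm_rpow a f := by
    have hp0 : p ≠ 0 := (zero_lt_one.trans_le (Fact.out : 1 ≤ p)).ne'
    have hpos := ENNReal.toReal_pos hp0 hp
    simp only [Lp_norm_rpow_eq_integral hp0 hp]
    rw [← integral_add ((Lp.memLp _).integrable_norm_rpow hp0 hp)
      ((Lp.memLp _).integrable_norm_rpow hp0 hp)]
    refine integral_congr_ae ?_
    filter_upwards [coeFn_Lp_simpleFuncMap a (zmodTwoProj 𝕜) (norm_zmodTwoProj_le 𝕜) f,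
      Lp.coeFn_sub f (Lp_simpleFuncMap a (zmodTwoProj 𝕜) (norm_zmodTwoProj_le 𝕜) f)]
      with x h2 h3
    rw [h3, Pi.sub_apply, h2]
    simp only [zmodTwoProj_apply]
    rcases zmodTwo_eq (a x) with h | h <;> simp [h, hpos.ne']
  approx ε hε := by
    obtain ⟨N, c, h⟩ := approx_Lp 𝕜 μ p hε
    refine ⟨N, c, fun f g η hη => ?_⟩
    obtain ⟨b, a, h1, h2⟩ := h f g
    exact ⟨b, a, by linarith, by linarith⟩

end Lp

section Ultrapower

variable {𝕜 : Type*} [RCLike 𝕜] {p : ℝ} {X : Type*} [NormedAddCommGroup X]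
    [NormedSpace 𝕜 X] {R : Type*} [CommRing R]

/-- `L_p`-projections on an ultrapower are given by sequences of `L_p`-projections. -/
noncomputable def LpStructure.ultrapower (hp : 0 < p) (S : LpStructure 𝕜 p X R) :
    LpStructure 𝕜 p (Ultrapower 𝕜 X) (ℕ → R) where
  T a := Ultrapower.map (fun n => S.T (a n)) fun n v => S.norm_T_le hp _ _
  mul_self a := funext fun n => S.mul_self _
  T_mul a b x := by
    obtain ⟨f, rfl⟩ := Ultrapower.mk_surjective x
    simp only [Ultrapower.map_mk]
    refine Ultrapower.mk_eq_mk (Eventually.of_forall fun n => ?_)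
    simp [S.T_mul]
  T_one_sub a x := by
    obtain ⟨f, rfl⟩ := Ultrapower.mk_surjective x
    simp only [Ultrapower.map_mk, ← Ultrapower.mk_sub]
    refine Ultrapower.mk_eq_mk (Eventually.of_forall fun n => ?_)
    simp [S.T_one_sub]
  norm_rpow a x := by
    obtain ⟨f, rfl⟩ := Ultrapower.mk_surjective x
    simp only [Ultrapower.map_mk, ← Ultrapower.mk_sub]
    refine tendsto_nhds_unique (((Ultrapower.tendsto_norm _).rpow_const (Or.inr hp.le)).add
      ((Ultrapower.tendsto_norm _).rpow_const (Or.inr hp.le))) ?_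
    simpa [S.norm_rpow] using (Ultrapower.tendsto_norm (𝕜 := 𝕜) f).rpow_const (Or.inr hp.le)
  approx ε hε := by
    obtain ⟨N, c, hN⟩ := S.approx ε hε
    refine ⟨N, c, fun x y η hη => ?_⟩
    obtain ⟨f, rfl⟩ := Ultrapower.mk_surjective x
    obtain ⟨h, rfl⟩ := Ultrapower.mk_surjective y
    choose b a h1 h2 using fun n => hN (f n) (h n) η hη
    refine ⟨b, fun j n => a n j, ?_, ?_⟩
    · simp only [Ultrapower.map_mk, ← Ultrapower.mk_smul, ← Ultrapower.mk_sum,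
        ← Ultrapower.mk_sub]
      refine le_of_tendsto_of_tendsto' (Ultrapower.tendsto_norm _)
        (((Ultrapower.tendsto_norm h).const_mul ε).add_const η) fun n => ?_
      simpa using h1 n
    · simp only [Ultrapower.map_mk, ← Ultrapower.mk_sub]
      refine le_of_tendsto_of_tendsto' (Ultrapower.tendsto_norm _)
        (((Ultrapower.tendsto_norm f).const_mul ε).add_const η) fun n => ?_
      simpa using h2 n

end Ultrapower

section Prod

variable {𝕜 : Type*} [RCLike 𝕜] {p : ℝ≥0∞} [Fact (1 ≤ p)] {X Y : Type*} [NormedAddCommGroup X]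
  [NormedSpace 𝕜 X] [NormedAddCommGroup Y] [NormedSpace 𝕜 Y] {R R' : Type*} [CommRing R]
  [CommRing R']

theorem WithLp.prod_norm_rpow (hp : p ≠ ∞) (y : WithLp p (X × Y)) :
    ‖y‖ ^ p.toReal = ‖y.fst‖ ^ p.toReal + ‖y.snd‖ ^ p.toReal := by
  have hpos : 0 < p.toReal :=
    ENNReal.toReal_pos (zero_lt_one.trans_le (Fact.out : 1 ≤ p)).ne' hp
  rw [WithLp.prod_norm_eq_add hpos, ← Real.rpow_mul (by positivity), one_div_mul_cancel hpos.ne',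
    Real.rpow_one]

theorem WithLp.prod_norm_le_of_le (hp : p ≠ ∞) {X' Y' : Type*} [NormedAddCommGroup X']
    [NormedAddCommGroup Y'] {y : WithLp p (X × Y)} {z : WithLp p (X' × Y')} {ε η : ℝ}
    (hε : 0 ≤ ε) (hη : 0 ≤ η) (h1 : ‖y.fst‖ ≤ ε * ‖z.fst‖ + η) (h2 : ‖y.snd‖ ≤ ε * ‖z.snd‖ + η) :
    ‖y‖ ≤ ε * ‖z‖ + η * 2 := by
  have hpos : 0 < p.toReal :=
    ENNReal.toReal_pos (zero_lt_one.trans_le (Fact.out : 1 ≤ p)).ne' hp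
  have hp1 : 1 ≤ p.toReal := by
    rw [← ENNReal.toReal_one]
    exact ENNReal.toReal_mono hp Fact.out
  -- comparison with the plane `ℝ × ℝ`
  let w : WithLp p (ℝ × ℝ) := WithLp.toLp p (‖z.fst‖, ‖z.snd‖)
  let o : WithLp p (ℝ × ℝ) := WithLp.toLp p (1, 1)
  have hw : ‖w‖ = ‖z‖ := by
    refine (Real.rpow_left_inj (norm_nonneg _) (norm_nonneg _) hpos.ne').1 ?_
    rw [WithLp.prod_norm_rpow hp, WithLp.prod_norm_rpow hp]
    simp [w]
  have ho : ‖o‖ ≤ 2 := by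
    refine (Real.rpow_le_rpow_iff (norm_nonneg _) (by norm_num) hpos).1 ?_
    rw [WithLp.prod_norm_rpow hp]
    have := Real.rpow_le_rpow_of_exponent_le (x := 2) (by norm_num) hp1
    simp only [o, WithLp.toLp_fst, WithLp.toLp_snd, norm_one, Real.one_rpow]
    rw [Real.rpow_one] at this
    linarith
  have hy : ‖y‖ ≤ ‖ε • w + η • o‖ := by
    refine (Real.rpow_le_rpow_iff (norm_nonneg _) (norm_nonneg _) hpos).1 ?_
    rw [WithLp.prod_norm_rpow hp, WithLp.prod_norm_rpow hp]
    have e1 : ‖(ε • w + η • o).fst‖ = ε * ‖z.fst‖ + η := by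
      simp only [w, o, WithLp.add_fst, WithLp.smul_fst, WithLp.toLp_fst, smul_eq_mul, mul_one]
      rw [Real.norm_of_nonneg (by positivity)]
    have e2 : ‖(ε • w + η • o).snd‖ = ε * ‖z.snd‖ + η := by
      simp only [w, o, WithLp.add_snd, WithLp.smul_snd, WithLp.toLp_snd, smul_eq_mul, mul_one]
      rw [Real.norm_of_nonneg (by positivity)]
    rw [e1, e2]
    gcongr
  refine hy.trans ((norm_add_le _ _).trans ?_)
  rw [norm_smul, norm_smul, Real.norm_of_nonneg hε, Real.norm_of_nonneg hη, hw]
  gcongr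

/-- `L_p`-projections act diagonally on an `ℓ_p`-sum. -/
noncomputable def LpStructure.prod (hp : p ≠ ∞) (S : LpStructure 𝕜 p.toReal X R)
    (S' : LpStructure 𝕜 p.toReal Y R') :
    LpStructure 𝕜 p.toReal (WithLp p (X × Y)) (R × R') where
  T a := (WithLp.linearEquiv p 𝕜 (X × Y)).symm.toLinearMap ∘ₗ
    ((S.T a.1).prodMap (S'.T a.2)) ∘ₗ (WithLp.linearEquiv p 𝕜 (X × Y)).toLinearMap
  mul_self a := Prod.ext (S.mul_self _) (S'.mul_self _)
  T_mul a b x := by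
    refine (WithLp.ofLp_injective p) (Prod.ext ?_ ?_) <;> simp [S.T_mul, S'.T_mul]
  T_one_sub a x := by
    refine (WithLp.ofLp_injective p) (Prod.ext ?_ ?_) <;> simp [S.T_one_sub, S'.T_one_sub]
  norm_rpow a x := by
    simp only [WithLp.prod_norm_rpow hp]
    rw [← S.norm_rpow a.1 x.fst, ← S'.norm_rpow a.2 x.snd]
    simp
    ring
  approx ε hε := by
    obtain ⟨N, c, hN⟩ := S.approx ε hε
    obtain ⟨N', c', hN'⟩ := S'.approx ε hε
    refine ⟨N + N', Fin.append c c', fun f h η hη => ?_⟩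
    obtain ⟨b, a, h1, h2⟩ := hN f.fst h.fst (η / 2) (half_pos hη)
    obtain ⟨b', a', h1', h2'⟩ := hN' f.snd h.snd (η / 2) (half_pos hη)
    have hs1 : ∀ (n : ℕ) (s : Fin n → WithLp p (X × Y)), (∑ i, s i).fst = ∑ i, (s i).fst :=
      fun n s => map_sum (WithLp.fstL p 𝕜 X Y) _ _
    have hs2 : ∀ (n : ℕ) (s : Fin n → WithLp p (X × Y)), (∑ i, s i).snd = ∑ i, (s i).snd :=
      fun n s => map_sum (WithLp.sndL p 𝕜 X Y) _ _
    refine ⟨(b, b'), Fin.append (fun j => (a j, 0)) (fun j => (0, a' j)), ?_, ?_⟩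
    · refine (WithLp.prod_norm_le_of_le (z := h) hp hε.le (half_pos hη).le ?_ ?_).trans
        (by linarith)
      · rw [WithLp.sub_fst, hs1]
        simpa [Fin.sum_univ_add, S.T_zero] using h1
      · rw [WithLp.sub_snd, hs2]
        simpa [Fin.sum_univ_add, S'.T_zero] using h1'
    · refine (WithLp.prod_norm_le_of_le (z := f) hp hε.le (half_pos hη).le ?_ ?_).trans
        (by linarith)
      · simpa using h2
      · simpa using h2'

end Prod

section Bochner

variable {α : Type*} [MeasurableSpace α] {μ : Measure α}
  {p : ℝ≥0∞} {E F : Type*} [NormedAddCommGroup E] [NormedAddCommGroup F]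

theorem Lp_norm_le_of_ae_le_add [Fact (1 ≤ p)] [IsProbabilityMeasure μ] {f : Lp E p μ} {g : Lp F p μ} {ε η : ℝ}
    (hε : 0 ≤ ε) (hη : 0 ≤ η) (h : ∀ᵐ x ∂μ, ‖f x‖ ≤ ε * ‖g x‖ + η) :
    ‖f‖ ≤ ε * ‖g‖ + η := by
  have hp0 : p ≠ 0 := (zero_lt_one.trans_le (Fact.out : 1 ≤ p)).ne'
  have hμ : μ ≠ 0 := IsProbabilityMeasure.ne_zero μ
  have h1 : eLpNorm f p μ ≤ ENNReal.ofReal ε * eLpNorm g p μ + ENNReal.ofReal η := by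
    calc eLpNorm f p μ ≤ eLpNorm ((fun x => ε * ‖g x‖) + fun _ => η) p μ :=
          eLpNorm_mono_ae_real h
      _ ≤ eLpNorm (fun x => ε * ‖g x‖) p μ + eLpNorm (fun _ : α => η) p μ :=
          eLpNorm_add_le ((Lp.aestronglyMeasurable g).norm.const_mul ε)
            aestronglyMeasurable_const Fact.out
      _ = _ := by
          congr 1
          · have : (fun x => ε * ‖g x‖) = ε • fun x => ‖g x‖ := rfl
            rw [this, eLpNorm_const_smul, eLpNorm_norm, Real.enorm_of_nonneg hε]
          · rw [eLpNorm_const _ hp0 hμ, Real.enorm_of_nonneg hη]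
            simp
  have h2 := ENNReal.toReal_mono (by
    exact ENNReal.add_ne_top.2 ⟨ENNReal.mul_ne_top ENNReal.ofReal_ne_top (Lp.eLpNorm_ne_top g),
      ENNReal.ofReal_ne_top⟩) h1
  rwa [ENNReal.toReal_add (ENNReal.mul_ne_top ENNReal.ofReal_ne_top (Lp.eLpNorm_ne_top g))
    ENNReal.ofReal_ne_top, ENNReal.toReal_mul, ENNReal.toReal_ofReal hε,
    ENNReal.toReal_ofReal hη] at h2

theorem exists_simpleFunc_norm_sub_lt (hp : p ≠ ∞) (f : Lp E p μ) {ε : ℝ} (hε : 0 < ε) :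
    ∃ (g : SimpleFunc α E) (hg : MemLp g p μ), ‖f - hg.toLp g‖ < ε := by
  obtain ⟨g, h1, h2⟩ := (Lp.memLp f).exists_simpleFunc_eLpNorm_sub_lt hp
    (ε := ENNReal.ofReal ε) (ENNReal.ofReal_pos.2 hε).ne'
  refine ⟨g, h2, ?_⟩
  rw [Lp.norm_def, ← ENNReal.lt_ofReal_iff_toReal_lt (Lp.eLpNorm_ne_top _)]
  refine lt_of_eq_of_lt (eLpNorm_congr_ae ?_) h1
  filter_upwards [Lp.coeFn_sub f (h2.toLp g), h2.coeFn_toLp] with x h3 h4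
  rw [h3, Pi.sub_apply, h4, Pi.sub_apply]

variable {𝕜 : Type*} [RCLike 𝕜] [NormedSpace 𝕜 E] {R : Type*} [CommRing R]

/-- `L_p`-projections of `E` induce `L_p`-projections of `L_p (α; E)`, indexed by simple
functions. -/
noncomputable def LpStructure.bochner [Fact (1 ≤ p)] [IsProbabilityMeasure μ] (hp : p ≠ ∞)
    (S : LpStructure 𝕜 p.toReal E R) :
    LpStructure 𝕜 p.toReal (Lp E p μ) (SimpleFunc α R) :=
  have hp0 : p ≠ 0 := (zero_lt_one.trans_le (Fact.out : 1 ≤ p)).ne'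
  have hpos : 0 < p.toReal := ENNReal.toReal_pos hp0 hp
  have hT := S.norm_T_le hpos
  have hone : ∀ (a : SimpleFunc α R) (f : Lp E p μ), Lp_simpleFuncMap (1 - a) S.T hT f =
      f - Lp_simpleFuncMap a S.T hT f := fun a f => by
    refine Lp.ext ?_
    filter_upwards [coeFn_Lp_simpleFuncMap (1 - a) S.T hT f, coeFn_Lp_simpleFuncMap a S.T hT f,
      Lp.coeFn_sub f (Lp_simpleFuncMap a S.T hT f)] with x h1 h2 h3
    rw [h1, h3, Pi.sub_apply, h2]
    exact S.T_one_sub _ _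
  have hle : ∀ (a : SimpleFunc α R) (f : Lp E p μ), ‖Lp_simpleFuncMap a S.T hT f‖ ≤ ‖f‖ :=
      fun a f => by
    refine Lp.norm_le_norm_of_ae_le ?_
    filter_upwards [coeFn_Lp_simpleFuncMap a S.T hT f] with x h1
    rw [h1]
    exact hT _ _
  { T := fun a => Lp_simpleFuncMap a S.T hT
    mul_self := fun a => SimpleFunc.ext fun x => S.mul_self _
    T_mul := fun a b f => by
      refine Lp.ext ?_
      filter_upwards [coeFn_Lp_simpleFuncMap (a * b) S.T hT f, coeFn_Lp_simpleFuncMap b S.T hT f,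
        coeFn_Lp_simpleFuncMap a S.T hT (Lp_simpleFuncMap b S.T hT f)] with x h1 h2 h3
      rw [h1, h3, h2]
      exact S.T_mul _ _ _
    T_one_sub := hone
    norm_rpow := fun a f => by
      simp only [Lp_norm_rpow_eq_integral hp0 hp]
      rw [← integral_add ((Lp.memLp _).integrable_norm_rpow hp0 hp)
        ((Lp.memLp _).integrable_norm_rpow hp0 hp)]
      refine integral_congr_ae ?_
      filter_upwards [coeFn_Lp_simpleFuncMap a S.T hT f,
        Lp.coeFn_sub f (Lp_simpleFuncMap a S.T hT f)] with x h2 h3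
      rw [h3, Pi.sub_apply, h2]
      exact S.norm_rpow _ _
    approx := fun ε hε => by
      obtain ⟨N, c, hN⟩ := S.approx ε hε
      refine ⟨N, c, fun f h η hη => ?_⟩
      have hC : 0 ≤ ∑ j, ‖c j‖ := Finset.sum_nonneg fun _ _ => norm_nonneg _
      -- approximate `f` and `h` by simple functions and choose projections value by value
      obtain ⟨f₀, hf₀, hff₀⟩ := exists_simpleFunc_norm_sub_lt hp f
        (ε := η / (2 * (1 + ε + ∑ j, ‖c j‖))) (by positivity)
      obtain ⟨h₀, hh₀, hhh₀⟩ := exists_simpleFunc_norm_sub_lt hp h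
        (ε := η / (2 * (1 + ε + ∑ j, ‖c j‖))) (by positivity)
      have hδ : η / (2 * (1 + ε + ∑ j, ‖c j‖)) * (1 + ε + ∑ j, ‖c j‖) = η / 2 := by
        field_simp
      generalize η / (2 * (1 + ε + ∑ j, ‖c j‖)) = δ at hff₀ hhh₀ hδ
      have hδ0 : 0 < δ := (norm_nonneg _).trans_lt hff₀
      choose b a h1 h2 using fun u v => hN u v (η / 2) (half_pos hη)
      let b' : SimpleFunc α R := (f₀.pair h₀).map fun q => b q.1 q.2
      let a' : Fin N → SimpleFunc α R := fun j => (f₀.pair h₀).map fun q => a q.1 q.2 j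
      set f₁ : Lp E p μ := hf₀.toLp f₀ with hf₁
      set h₁ : Lp E p μ := hh₀.toLp h₀ with hh₁
      have hf₁n : ‖f₁‖ ≤ ‖f‖ + δ := by
        have := norm_sub_norm_le f₁ f
        rw [norm_sub_rev] at this
        linarith
      have hh₁n : ‖h₁‖ ≤ ‖h‖ + δ := by
        have := norm_sub_norm_le h₁ h
        rw [norm_sub_rev] at this
        linarith
      refine ⟨b', a', ?_, ?_⟩
      · have e1 : ‖Lp_simpleFuncMap b' S.T hT f₁ - ∑ j, c j • Lp_simpleFuncMap (a' j) S.T hT h₁‖ ≤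
            ε * ‖h₁‖ + η / 2 := by
          refine Lp_norm_le_of_ae_le_add hε.le (half_pos hη).le ?_
          have h3 : ∀ᵐ x ∂μ, ∀ j, (c j • Lp_simpleFuncMap (a' j) S.T hT h₁ : Lp E p μ) x =
              c j • S.T (a' j x) (h₁ x) := by
            refine ae_all_iff.2 fun j => ?_
            filter_upwards [Lp.coeFn_smul (c j) (Lp_simpleFuncMap (a' j) S.T hT h₁),
              coeFn_Lp_simpleFuncMap (a' j) S.T hT h₁] with x h1 h2
            rw [h1, Pi.smul_apply, h2]
          filter_upwards [h3, coeFn_Lp_simpleFuncMap b' S.T hT f₁,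
            Lp.coeFn_sub (Lp_simpleFuncMap b' S.T hT f₁)
              (∑ j, c j • Lp_simpleFuncMap (a' j) S.T hT h₁),
            Lp.coeFn_fun_finsetSum Finset.univ fun j =>
              c j • Lp_simpleFuncMap (a' j) S.T hT h₁, hf₀.coeFn_toLp, hh₀.coeFn_toLp]
            with x h3 h4 h5 h6 h7 h8
          rw [h5, Pi.sub_apply, h4, h6]
          simp only [h3]
          rw [h7, h8]
          exact h1 _ _
        have e2 : Lp_simpleFuncMap b' S.T hT f - ∑ j, c j • Lp_simpleFuncMap (a' j) S.T hT h =
            Lp_simpleFuncMap b' S.T hT (f - f₁) +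
            (Lp_simpleFuncMap b' S.T hT f₁ - ∑ j, c j • Lp_simpleFuncMap (a' j) S.T hT h₁) -
            ∑ j, c j • Lp_simpleFuncMap (a' j) S.T hT (h - h₁) := by
          simp only [map_sub, smul_sub, Finset.sum_sub_distrib]
          abel
        have e3 : ‖∑ j, c j • Lp_simpleFuncMap (a' j) S.T hT (h - h₁)‖ ≤ (∑ j, ‖c j‖) * δ := by
          refine (norm_sum_le _ _).trans ?_
          rw [Finset.sum_mul]
          refine Finset.sum_le_sum fun j _ => ?_
          rw [norm_smul]
          exact mul_le_mul_of_nonneg_left ((hle _ _).trans hhh₀.le) (norm_nonneg _)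
        rw [e2]
        refine (norm_sub_le _ _).trans ?_
        have e4 := norm_add_le (Lp_simpleFuncMap b' S.T hT (f - f₁))
          (Lp_simpleFuncMap b' S.T hT f₁ - ∑ j, c j • Lp_simpleFuncMap (a' j) S.T hT h₁)
        have e5 := (hle b' (f - f₁)).trans hff₀.le
        have e6 := mul_le_mul_of_nonneg_left hh₁n hε.le
        linarith
      · have e1 : ‖h₁ - Lp_simpleFuncMap b' S.T hT h₁‖ ≤ ε * ‖f₁‖ + η / 2 := by
          refine Lp_norm_le_of_ae_le_add hε.le (half_pos hη).le ?_
          filter_upwards [coeFn_Lp_simpleFuncMap b' S.T hT h₁,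
            Lp.coeFn_sub h₁ (Lp_simpleFuncMap b' S.T hT h₁), hf₀.coeFn_toLp, hh₀.coeFn_toLp]
            with x h4 h5 h7 h8
          rw [h5, Pi.sub_apply, h4, h7, h8]
          exact h2 _ _
        have e2 : h - Lp_simpleFuncMap b' S.T hT h =
            Lp_simpleFuncMap (1 - b') S.T hT (h - h₁) + (h₁ - Lp_simpleFuncMap b' S.T hT h₁) := by
          rw [hone, map_sub]
          abel
        rw [e2]
        refine (norm_add_le _ _).trans ?_
        have e5 := (hle (1 - b') (h - h₁)).trans hhh₀.le
        have e6 := mul_le_mul_of_nonneg_left hf₁n hε.le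
        have e7 := mul_nonneg hC hδ0.le
        linarith }

end Bochner

/-! ### Bands and disjointness in abstract `L_p`-spaces -/

namespace LpStructure

variable {𝕜 : Type*} [RCLike 𝕜] {p : ℝ} {X : Type*} [NormedAddCommGroup X]
    [NormedSpace 𝕜 X] {R : Type*} [CommRing R] (S : LpStructure 𝕜 p X R)

/-- The band generated by `h`: the closed span of all projections of `h`. -/
def band (h : X) : Submodule 𝕜 X :=
  (Submodule.span 𝕜 (Set.range fun a => S.T a h)).topologicalClosure

/-- Two vectors are disjoint if some projections almost annihilate the first one and almost fix
the second one. -/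
def Disj (x h : X) : Prop := ∀ ε : ℝ, 0 < ε → ∃ a, ‖S.T a x‖ ≤ ε ∧ ‖h - S.T a h‖ ≤ ε

variable {S}

theorem Disj.symm {x h : X} (H : S.Disj x h) : S.Disj h x := fun ε hε => by
  obtain ⟨a, h1, h2⟩ := H ε hε
  exact ⟨1 - a, by rwa [S.T_one_sub], by rwa [S.T_one_sub, sub_sub_cancel]⟩

theorem eq_zero_of_disj_self {x : X} (H : S.Disj x x) : x = 0 := by
  refine norm_le_zero_iff.1 (le_of_forall_pos_le_add fun ε hε => ?_)
  obtain ⟨a, h1, h2⟩ := H (ε / 2) (half_pos hε)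
  have := norm_add_le (S.T a x) (x - S.T a x)
  rw [add_sub_cancel] at this
  linarith

theorem Disj.T {x h : X} (hp : 0 < p) (H : S.Disj x h) (b : R) : S.Disj (S.T b x) h :=
  fun ε hε => by
    obtain ⟨a, h1, h2⟩ := H ε hε
    exact ⟨a, by rw [S.T_comm]; exact (S.norm_T_le hp _ _).trans h1, h2⟩

variable (S) in
/-- The vectors disjoint from `h` form a subspace. -/
def disjSubmodule (hp : 0 < p) (h : X) : Submodule 𝕜 X where
  carrier := {x | S.Disj x h}
  zero_mem' := fun ε hε => ⟨1, by simpa using hε.le, by rw [S.T_one]; simpa using hε.le⟩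
  add_mem' {x y} hx hy := fun ε hε => by
    obtain ⟨a, h1, h2⟩ := hx (ε / 2) (half_pos hε)
    obtain ⟨b, h3, h4⟩ := hy (ε / 2) (half_pos hε)
    refine ⟨a * b, ?_, ?_⟩
    · rw [map_add]
      have e1 : ‖S.T (a * b) x‖ ≤ ε / 2 := by
        rw [mul_comm, S.T_mul]; exact (S.norm_T_le hp _ _).trans h1
      have e2 : ‖S.T (a * b) y‖ ≤ ε / 2 := by
        rw [S.T_mul]; exact (S.norm_T_le hp _ _).trans h3
      linarith [norm_add_le (S.T (a * b) x) (S.T (a * b) y)]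
    · have e : h - S.T (a * b) h = (h - S.T a h) + S.T a (h - S.T b h) := by
        rw [map_sub, S.T_mul]; abel
      rw [e]
      have := (S.norm_T_le hp a _).trans h4
      linarith [norm_add_le (h - S.T a h) (S.T a (h - S.T b h))]
  smul_mem' c x hx := fun ε hε => by
    obtain ⟨a, h1, h2⟩ := hx (ε / (‖c‖ + 1)) (by positivity)
    have hc : ε / (‖c‖ + 1) * (‖c‖ + 1) = ε := by field_simp
    have h0 : 0 < ε / (‖c‖ + 1) := by positivity
    refine ⟨a, ?_, h2.trans ?_⟩
    · rw [map_smul, norm_smul]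
      nlinarith [norm_nonneg c]
    · nlinarith [norm_nonneg c]

theorem isClosed_disjSubmodule (hp : 0 < p) (h : X) :
    IsClosed (S.disjSubmodule hp h : Set X) := by
  refine isClosed_of_closure_subset fun x hx ε hε => ?_
  obtain ⟨y, hy, hxy⟩ := Metric.mem_closure_iff.1 hx (ε / 2) (half_pos hε)
  obtain ⟨a, h1, h2⟩ := hy (ε / 2) (half_pos hε)
  refine ⟨a, ?_, by linarith⟩
  have e : S.T a x = S.T a (x - y) + S.T a y := by rw [← map_add, sub_add_cancel]
  rw [e]
  have := S.norm_T_le hp a (x - y)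
  rw [dist_eq_norm] at hxy
  linarith [norm_add_le (S.T a (x - y)) (S.T a y)]

theorem Disj.of_mem_band (hp : 0 < p) {k h x : X} (H : S.Disj k h) (hx : x ∈ S.band k) :
    S.Disj x h := by
  have : S.band k ≤ S.disjSubmodule hp h := by
    refine Submodule.topologicalClosure_minimal _ (Submodule.span_le.2 ?_)
      (isClosed_disjSubmodule hp h)
    rintro _ ⟨a, rfl⟩
    exact H.T hp a
  exact this hx

theorem Disj.norm_add_rpow (hp : 0 < p) {x h : X} (H : S.Disj x h) :
    ‖x + h‖ ^ p = ‖x‖ ^ p + ‖h‖ ^ p := by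
  have hε : ∀ n : ℕ, (0 : ℝ) < 1 / (n + 1) := fun n => Nat.one_div_pos_of_nat
  choose a h1 h2 using fun n : ℕ => H (1 / (n + 1)) (hε n)
  have t1 : Tendsto (fun n => S.T (a n) x) atTop (𝓝 0) :=
    squeeze_zero_norm h1 tendsto_one_div_add_atTop_nhds_zero_nat
  have t2 : Tendsto (fun n => h - S.T (a n) h) atTop (𝓝 0) :=
    squeeze_zero_norm h2 tendsto_one_div_add_atTop_nhds_zero_nat
  have t3 : Tendsto (fun n => S.T (a n) (x + h)) atTop (𝓝 h) := by
    have := (t1.sub t2).add_const h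
    rw [sub_zero, zero_add] at this
    refine this.congr fun n => ?_
    rw [map_add]
    abel
  have t4 : Tendsto (fun n => x + h - S.T (a n) (x + h)) atTop (𝓝 x) := by
    simpa using t3.const_sub (x + h)
  refine tendsto_nhds_unique (tendsto_const_nhds (f := (atTop : Filter ℕ))) ?_
  have t5 := (t4.norm.rpow_const (Or.inr hp.le)).add (t3.norm.rpow_const (Or.inr hp.le))
  refine t5.congr fun n => ?_
  rw [add_comm, S.norm_rpow]

theorem T_mem_band (h : X) (a : R) : S.T a h ∈ S.band h :=
  Submodule.le_topologicalClosure _ (Submodule.subset_span ⟨a, rfl⟩)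

/-- If the projections `T (b k)` tend to the identity at `h`, they do so on the band of `h`. -/
theorem tendsto_sub_T_of_mem_band (hp : 0 < p) {h : X} {b : ℕ → R} {l : Filter ℕ}
    (hb : Tendsto (fun k => ‖h - S.T (b k) h‖) l (𝓝 0)) {y : X} (hy : y ∈ S.band h) :
    Tendsto (fun k => ‖y - S.T (b k) y‖) l (𝓝 0) := by
  rw [Metric.tendsto_nhds]
  intro ε hε
  obtain ⟨z, hz, hyz⟩ := Metric.mem_closure_iff.1 hy (ε / 2) (half_pos hε)
  have key : Tendsto (fun k => ‖z - S.T (b k) z‖) l (𝓝 0) := by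
    refine Submodule.span_induction (p := fun z _ => Tendsto (fun k => ‖z - S.T (b k) z‖) l (𝓝 0))
      ?_ ?_ ?_ ?_ hz
    · rintro _ ⟨a, rfl⟩
      refine squeeze_zero (fun _ => norm_nonneg _) (fun k => ?_) hb
      rw [S.T_comm, ← map_sub]
      exact S.norm_T_le hp _ _
    · simpa using tendsto_const_nhds
    · intro x y _ _ hx hy
      refine squeeze_zero (fun _ => norm_nonneg _) (fun k => ?_) (by simpa using hx.add hy)
      rw [map_add, add_sub_add_comm]
      exact norm_add_le _ _
    · intro c x _ hx
      have := hx.const_mul ‖c‖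
      simpa [← smul_sub, norm_smul] using this
  filter_upwards [Metric.tendsto_nhds.1 key (ε / 2) (half_pos hε)] with k hk
  rw [dist_zero_right, norm_norm] at hk ⊢
  have e : y - S.T (b k) y = ((y - z) - S.T (b k) (y - z)) + (z - S.T (b k) z) := by
    rw [map_sub]; abel
  rw [e]
  have h1 := S.norm_sub_T_le hp (b k) (y - z)
  rw [dist_eq_norm] at hyz
  linarith [norm_add_le ((y - z) - S.T (b k) (y - z)) (z - S.T (b k) z)]

variable (S) in
/-- Every vector is the sum of a vector in the band of `h` and of a vector disjoint from `h`. -/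
theorem exists_band_decomposition [CompleteSpace X] (hp : 0 < p) (f h : X) :
    ∃ g ∈ S.band h, S.Disj (f - g) h := by
  have hε : ∀ n : ℕ, (0 : ℝ) < 1 / (n + 1) := fun n => Nat.one_div_pos_of_nat
  have h0 : Tendsto (fun n : ℕ => 1 / ((n : ℝ) + 1)) atTop (𝓝 0) :=
    tendsto_one_div_add_atTop_nhds_zero_nat
  choose N c hN using fun n : ℕ => S.approx (1 / (n + 1)) (hε n)
  choose b a h1 h2 using fun n : ℕ => hN n f h (1 / (n + 1)) (hε n)
  -- `u n` is the part of `f` in a region where `h` is not small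
  let u : ℕ → X := fun n => S.T (b n) f
  let y : ℕ → X := fun n => ∑ j, c n j • S.T (a n j) h
  have hy : ∀ n, y n ∈ S.band h := fun n =>
    Submodule.sum_mem _ fun j _ => Submodule.smul_mem _ _ (T_mem_band h _)
  have huy : Tendsto (fun n => ‖u n - y n‖) atTop (𝓝 0) := by
    refine squeeze_zero (fun _ => norm_nonneg _) h1 ?_
    simpa using (h0.mul_const ‖h‖).add h0
  have hbh : Tendsto (fun n => ‖h - S.T (b n) h‖) atTop (𝓝 0) := by
    refine squeeze_zero (fun _ => norm_nonneg _) h2 ?_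
    simpa using (h0.mul_const ‖f‖).add h0
  -- pass to a subsequence along which the norms of the `u n` converge
  obtain ⟨M, -, σ, hσ, hM⟩ := tendsto_subseq_of_bounded (x := fun n => ‖u n‖ ^ p)
    (Metric.isBounded_Icc 0 (‖f‖ ^ p)) (fun n => ⟨by positivity, by
      have := S.norm_T_le hp (b n) f
      simp only [u]
      gcongr⟩)
  have hσt := hσ.tendsto_atTop
  have hbσ : Tendsto (fun n => ‖h - S.T (b (σ n)) h‖) atTop (𝓝 0) := hbh.comp hσt
  have huyσ : Tendsto (fun n => ‖u (σ n) - y (σ n)‖) atTop (𝓝 0) := huy.comp hσt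
  have hfirst : ∀ k l, ‖S.T (b l) (f - S.T (b k) f)‖ ^ p =
      ‖u l‖ ^ p - ‖u k‖ ^ p + ‖u k - S.T (b l) (u k)‖ ^ p := fun k l => by
    have e1 := S.norm_rpow (b k) (u l)
    have e2 := S.norm_rpow (b l) (u k)
    have e3 : u l - S.T (b k) (u l) = S.T (b l) (f - S.T (b k) f) := by
      simp only [u, map_sub, S.T_comm (b k)]
    have e4 : S.T (b k) (u l) = S.T (b l) (u k) := S.T_comm _ _ _
    rw [e3, e4] at e1
    linarith
  have hcauchy : CauchySeq fun n => u (σ n) := by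
    rw [Metric.cauchySeq_iff']
    -- it suffices to compare with one fixed term
    suffices H : ∀ ε > 0, ∃ k, ∀ᶠ l in atTop, ‖u (σ l) - u (σ k)‖ ≤ ε by
      intro ε hε
      obtain ⟨k, hk⟩ := H (ε / 3) (by positivity)
      obtain ⟨K, hK⟩ := eventually_atTop.1 hk
      refine ⟨K, fun n hn => ?_⟩
      have e1 := hK n hn
      have e2 := hK K le_rfl
      have e3 := dist_triangle_right (u (σ n)) (u (σ K)) (u (σ k))
      rw [dist_eq_norm (u (σ n)) (u (σ k)), dist_eq_norm (u (σ K)) (u (σ k))] at e3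
      linarith
    intro ε hε
    have hδ : 0 < (ε / 2) ^ p / 4 := by positivity
    obtain ⟨k, hk1, hk2, hk3⟩ : ∃ k, |‖u (σ k)‖ ^ p - M| < (ε / 2) ^ p / 4 ∧
        ‖u (σ k) - y (σ k)‖ < ε / 4 ∧ ‖u (σ k) - y (σ k)‖ ^ p < (ε / 2) ^ p / 4 := by
      have a1 := Metric.tendsto_nhds.1 hM _ hδ
      have a2 := huyσ.eventually_lt_const (show 0 < ε / 4 by positivity)
      have a3 : ∀ᶠ k in atTop, ‖u (σ k) - y (σ k)‖ ^ p < (ε / 2) ^ p / 4 := by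
        have := huyσ.rpow_const (p := p) (Or.inr hp.le)
        rw [Real.zero_rpow hp.ne'] at this
        exact this.eventually_lt_const hδ
      obtain ⟨k, b1, b2, b3⟩ := (a1.and (a2.and a3)).exists
      exact ⟨k, b1, b2, b3⟩
    refine ⟨k, ?_⟩
    have hyk := tendsto_sub_T_of_mem_band hp hbσ (hy (σ k))
    have hyk' := hyk.rpow_const (p := p) (Or.inr hp.le)
    rw [Real.zero_rpow hp.ne'] at hyk'
    -- the distance from `u k` to its projection is controlled by that from `u k` to `y k`
    have hlim : ∀ᶠ l in atTop, ‖u (σ k) - S.T (b (σ l)) (u (σ k))‖ ≤ ε / 2 ∧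
        ‖u (σ k) - S.T (b (σ l)) (u (σ k))‖ ^ p ≤ (ε / 2) ^ p / 2 := by
      have hle : ∀ l, ‖u (σ k) - S.T (b (σ l)) (u (σ k))‖ ≤
          ‖u (σ k) - y (σ k)‖ + ‖y (σ k) - S.T (b (σ l)) (y (σ k))‖ := fun l => by
        have e : u (σ k) - S.T (b (σ l)) (u (σ k)) =
            ((u (σ k) - y (σ k)) - S.T (b (σ l)) (u (σ k) - y (σ k))) +
              (y (σ k) - S.T (b (σ l)) (y (σ k))) := by
          rw [map_sub]; abel
        rw [e]
        exact (norm_add_le _ _).trans (add_le_add_left (S.norm_sub_T_le hp _ _) _)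
      have hup := (hyk.const_add ‖u (σ k) - y (σ k)‖)
      rw [add_zero] at hup
      have hup' := hup.rpow_const (p := p) (Or.inr hp.le)
      filter_upwards [hup.eventually_lt_const (show _ < ε / 2 by linarith),
        hup'.eventually_lt_const (show _ < (ε / 2) ^ p / 2 by linarith)] with l h3 h4
      refine ⟨(hle l).trans h3.le, le_trans ?_ h4.le⟩
      have := hle l
      gcongr
    filter_upwards [hlim, Metric.tendsto_nhds.1 hM _ hδ] with l hl1 hl2
    have e1 := hfirst (σ k) (σ l)
    have e2 : ‖S.T (b (σ l)) (f - S.T (b (σ k)) f)‖ ≤ ε / 2 := by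
      refine (Real.rpow_le_rpow_iff (norm_nonneg _) (by positivity) hp).1 ?_
      rw [e1]
      have e3 : |‖u (σ l)‖ ^ p - M| < (ε / 2) ^ p / 4 := hl2
      have := abs_lt.1 e3
      have := abs_lt.1 hk1
      linarith [hl1.2]
    have e3 : u (σ l) - u (σ k) = S.T (b (σ l)) (f - S.T (b (σ k)) f) -
        (u (σ k) - S.T (b (σ l)) (u (σ k))) := by
      simp only [u, map_sub]; abel
    rw [e3]
    linarith [norm_sub_le (S.T (b (σ l)) (f - S.T (b (σ k)) f))
      (u (σ k) - S.T (b (σ l)) (u (σ k))), hl1.1]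
  obtain ⟨g, hg⟩ := cauchySeq_tendsto_of_complete hcauchy
  have hgb : g ∈ S.band h := by
    have : Tendsto (fun n => y (σ n)) atTop (𝓝 g) := by
      have h3 := tendsto_zero_iff_norm_tendsto_zero.2 huyσ
      simpa using hg.sub h3
    exact (Submodule.isClosed_topologicalClosure _).mem_of_tendsto this
      (Eventually.of_forall fun n => hy _)
  refine ⟨g, hgb, fun ε hε => ?_⟩
  have t1 := tendsto_sub_T_of_mem_band hp hbσ hgb
  have t2 : Tendsto (fun n => ‖u (σ n) - g‖ + ‖g - S.T (b (σ n)) g‖) atTop (𝓝 0) := by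
    have := (tendsto_iff_norm_sub_tendsto_zero.1 hg).add t1
    simpa using this
  obtain ⟨n, hn1, hn2⟩ := ((t2.eventually_lt_const hε).and (hbσ.eventually_lt_const hε)).exists
  refine ⟨b (σ n), ?_, hn2.le⟩
  have e : S.T (b (σ n)) (f - g) = (u (σ n) - g) + (g - S.T (b (σ n)) g) := by
    simp only [u, map_sub]; abel
  rw [e]
  exact (norm_add_le _ _).trans hn1.le

/-- For a sum of pairwise disjoint vectors the `p`-th powers of the norms add up. -/
theorem norm_sum_rpow (hp : 0 < p) {ι : Type*} (s : Finset ι) (g : ι → X)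
    (H : ∀ i ∈ s, ∀ j ∈ s, i ≠ j → S.Disj (g i) (g j)) :
    ‖∑ i ∈ s, g i‖ ^ p = ∑ i ∈ s, ‖g i‖ ^ p := by
  classical
  induction s using Finset.induction_on with
  | empty => simp [Real.zero_rpow hp.ne']
  | insert i s hi ih =>
    rw [Finset.sum_insert hi, Finset.sum_insert hi, Disj.norm_add_rpow (S := S) hp, ih]
    · exact fun j hj k hk => H j (Finset.mem_insert_of_mem hj) k (Finset.mem_insert_of_mem hk)
    · have : ∑ j ∈ s, g j ∈ S.disjSubmodule hp (g i) :=
        Submodule.sum_mem _ fun j hj => H j (Finset.mem_insert_of_mem hj) i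
          (Finset.mem_insert_self _ _) (fun h => hi (h ▸ hj))
      exact Disj.symm this

variable (S) in
/-- By Zorn's lemma there is a family of pairwise disjoint vectors whose bands span a dense
subspace. -/
theorem exists_disjoint_family [CompleteSpace X] (hp : 0 < p) :
    ∃ D : Set X, (∀ x ∈ D, ∀ y ∈ D, x ≠ y → S.Disj x y) ∧
      (Submodule.span 𝕜 {z | ∃ h ∈ D, ∃ a, z = S.T a h}).topologicalClosure = ⊤ := by
  classical
  obtain ⟨D, hD⟩ := zorn_subset {D : Set X | (∀ x ∈ D, x ≠ 0) ∧
      ∀ x ∈ D, ∀ y ∈ D, x ≠ y → S.Disj x y} (by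
    intro c hc hchain
    refine ⟨⋃₀ c, ⟨?_, ?_⟩, fun s hs => Set.subset_sUnion_of_mem hs⟩
    · rintro x ⟨s, hs, hx⟩
      exact (hc hs).1 x hx
    · rintro x ⟨s, hs, hx⟩ y ⟨t, ht, hy⟩ hxy
      rcases hchain.total hs ht with hst | hts
      · exact (hc ht).2 x (hst hx) y hy hxy
      · exact (hc hs).2 x hx y (hts hy) hxy)
  refine ⟨D, hD.prop.2, ?_⟩
  rw [eq_top_iff]
  rintro f -
  set Y := (Submodule.span 𝕜 {z | ∃ h ∈ D, ∃ a, z = S.T a h}).topologicalClosure with hY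
  have hbandY : ∀ h ∈ D, S.band h ≤ Y := fun h hh => by
    refine Submodule.topologicalClosure_mono (Submodule.span_mono ?_)
    rintro _ ⟨a, rfl⟩
    exact ⟨h, hh, a, rfl⟩
  choose g hgb hgd using fun h : X => S.exists_band_decomposition hp f h
  have hdisj : ∀ h ∈ D, ∀ k ∈ D, h ≠ k → S.Disj (g h) k := fun h hh k hk hhk =>
    (hD.prop.2 h hh k hk hhk).of_mem_band hp (hgb h)
  have hdisj' : ∀ h ∈ D, ∀ k ∈ D, h ≠ k → S.Disj (g h) (g k) := fun h hh k hk hhk =>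
    ((hdisj h hh k hk hhk).symm.of_mem_band hp (hgb k)).symm
  have hrem : ∀ (J : Finset D) (i : D), i ∈ J → S.Disj (f - ∑ j ∈ J, g j) i := fun J i hi => by
    have h1 : f - ∑ j ∈ J, g j = (f - g i) - ∑ j ∈ J.erase i, g j := by
      rw [← Finset.add_sum_erase J _ hi]; abel
    have h2 : ∑ j ∈ J.erase i, g j ∈ S.disjSubmodule hp (i : X) :=
      Submodule.sum_mem _ fun j hj => hdisj j j.2 i i.2
        fun h => (Finset.ne_of_mem_erase hj) (Subtype.ext h)
    rw [h1]
    exact Submodule.sub_mem (S.disjSubmodule hp (i : X)) (hgd i) h2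
  have hsum : ∀ J : Finset D, ‖∑ j ∈ J, g j‖ ^ p = ∑ j ∈ J, ‖g j‖ ^ p := fun J =>
    norm_sum_rpow hp J (fun j : D => g j) fun i _ j _ hij =>
      hdisj' i i.2 j j.2 fun h => hij (Subtype.ext h)
  have hle : ∀ J : Finset D, ∑ j ∈ J, ‖g j‖ ^ p ≤ ‖f‖ ^ p := fun J => by
    have h1 : S.Disj (f - ∑ j ∈ J, g j) (∑ j ∈ J, g j) := by
      refine Disj.symm (S := S) ?_
      have : ∑ j ∈ J, g j ∈ S.disjSubmodule hp (f - ∑ j ∈ J, g j) :=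
        Submodule.sum_mem _ fun i hi => (hrem J i hi).symm.of_mem_band hp (hgb i)
      exact this
    have h2 := h1.norm_add_rpow hp
    rw [sub_add_cancel, hsum] at h2
    rw [h2]
    exact le_add_of_nonneg_left (by positivity)
  have hsummable : Summable fun j : D => g j := by
    have h1 : Summable fun j : D => ‖g j‖ ^ p :=
      summable_of_sum_le (fun _ => by positivity) hle
    rw [summable_iff_vanishing_norm] at h1 ⊢
    intro ε hε
    obtain ⟨s, hs⟩ := h1 (ε ^ p) (by positivity)
    refine ⟨s, fun t ht => ?_⟩
    have h2 := hs t ht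
    rw [← hsum, Real.norm_of_nonneg (by positivity)] at h2
    exact (Real.rpow_lt_rpow_iff (norm_nonneg _) hε.le hp).1 h2
  obtain ⟨w, hw⟩ := hsummable
  have hwY : w ∈ Y := (Submodule.isClosed_topologicalClosure _).mem_of_tendsto hw
    (Eventually.of_forall fun J => Submodule.sum_mem _ fun j _ => hbandY j j.2 (hgb j))
  -- the remainder is disjoint from the whole family, so it vanishes by maximality
  have hr : ∀ i ∈ D, S.Disj (f - w) i := fun i hi => by
    refine (isClosed_disjSubmodule (S := S) hp i).mem_of_tendsto (Tendsto.const_sub f hw) ?_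
    filter_upwards [eventually_ge_atTop {(⟨i, hi⟩ : D)}] with J hJ
    exact hrem J ⟨i, hi⟩ (hJ (Finset.mem_singleton_self _))
  have hzero : f - w = 0 := by
    by_contra hne
    have hmem : f - w ∈ D := by
      refine hD.le_of_ge (y := insert (f - w) D) ⟨?_, ?_⟩ (Set.subset_insert _ _)
        (Set.mem_insert _ _)
      · rintro x (rfl | hx)
        · exact hne
        · exact hD.prop.1 x hx
      · rintro x (rfl | hx) y (rfl | hy) hxy
        · exact absurd rfl hxy
        · exact hr y hy
        · exact (hr x hx).symm
        · exact hD.prop.2 x hx y hy hxy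
    exact hne (eq_zero_of_disj_self (S := S) (hr _ hmem))
  rw [sub_eq_zero.1 hzero]
  exact hwY

end LpStructure

/-! ### Measures on the Stone space of a Boolean ring -/

section Stone

variable (R : Type*) [CommRing R]

/-- The Stone space of a Boolean ring is its prime spectrum, which carries the `σ`-algebra
generated by the clopen sets. -/
def StoneSpace : Type _ := PrimeSpectrum R

variable {R}

/-- The clopen subset of the Stone space given by an element of the Boolean ring. -/
def StoneSpace.clopen (a : R) : Set (StoneSpace R) :=
  (PrimeSpectrum.basicOpen a : Set (PrimeSpectrum R))

variable (R) in
/-- The clopen subsets of the Stone space. -/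
def StoneSpace.clopens : Set (Set (StoneSpace R)) := Set.range StoneSpace.clopen

instance : MeasurableSpace (StoneSpace R) := MeasurableSpace.generateFrom (StoneSpace.clopens R)

namespace StoneSpace

theorem measurableSet_clopen (a : R) : MeasurableSet (clopen a) :=
  MeasurableSpace.measurableSet_generateFrom ⟨a, rfl⟩

theorem clopen_mul (a b : R) : clopen (a * b) = clopen a ∩ clopen b := by
  unfold clopen
  rw [PrimeSpectrum.basicOpen_mul]
  rfl

theorem clopen_zero : clopen (0 : R) = ∅ := by
  unfold clopen
  rw [PrimeSpectrum.basicOpen_zero]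
  rfl

theorem clopen_one : clopen (1 : R) = Set.univ := by
  unfold clopen
  rw [PrimeSpectrum.basicOpen_one]
  rfl

variable (hR : ∀ a : R, a * a = a)

include hR

theorem clopen_one_sub (a : R) : clopen (1 - a) = (clopen a)ᶜ := by
  ext x
  let x : PrimeSpectrum R := x
  change (1 - a ∉ x.asIdeal) ↔ ¬ (a ∉ x.asIdeal)
  rw [not_not]
  constructor
  · intro h
    have h1 : a * (1 - a) ∈ x.asIdeal := by
      rw [mul_sub, mul_one, hR, sub_self]; exact x.asIdeal.zero_mem
    exact (x.isPrime.mem_or_mem h1).resolve_right h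
  · intro h h'
    refine x.isPrime.ne_top ((Ideal.eq_top_iff_one _).2 ?_)
    simpa using x.asIdeal.add_mem h' h

theorem clopen_injective : Function.Injective (clopen (R := R)) := fun a b hab =>
  PrimeSpectrum.basicOpen_injOn_isIdempotentElem (hR a) (hR b) (SetLike.coe_injective hab)

theorem isSetAlgebra_clopens : IsSetAlgebra (clopens R) where
  empty_mem := ⟨0, clopen_zero⟩
  compl_mem := by
    rintro _ ⟨a, rfl⟩
    exact ⟨1 - a, clopen_one_sub hR a⟩
  union_mem := by
    rintro _ _ ⟨a, rfl⟩ ⟨b, rfl⟩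
    refine ⟨1 - (1 - a) * (1 - b), ?_⟩
    rw [clopen_one_sub hR, clopen_mul, clopen_one_sub hR, clopen_one_sub hR, Set.compl_inter,
      compl_compl, compl_compl]

/-- A finitely additive function on a Boolean ring is given by a measure on the Stone space:
since the clopen sets are compact, countable additivity is automatic. -/
theorem exists_measure (w : R → ℝ≥0∞) (h0 : w 0 = 0)
    (hadd : ∀ a b, a * b = 0 → w (a + b) = w a + w b) :
    ∃ ν : Measure (StoneSpace R), ∀ a, ν (clopen a) = w a := by
  classical
  have hring := (isSetAlgebra_clopens hR).isSetRing
  let W : Set (StoneSpace R) → ℝ≥0∞ := fun s => if hs : ∃ a, clopen a = s then w hs.choose else 0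
  have hW : ∀ a : R, W (clopen a) = w a := fun a => by
    have hs : ∃ b : R, clopen b = clopen a := ⟨a, rfl⟩
    simp only [W, dif_pos hs]
    rw [clopen_injective hR hs.choose_spec]
  let m : AddContent ℝ≥0∞ (clopens R) := hring.addContent_of_union W
    (by rw [← clopen_zero, hW, h0]) (by
      rintro _ _ ⟨a, rfl⟩ ⟨b, rfl⟩ hd
      have hab : a * b = 0 := by
        refine clopen_injective hR ?_
        rw [clopen_mul, clopen_zero]
        exact Set.disjoint_iff_inter_eq_empty.1 hd
      have hu : clopen a ∪ clopen b = clopen (a + b) := by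
        have : a + b = 1 - (1 - a) * (1 - b) := by linear_combination hab
        rw [this, clopen_one_sub hR, clopen_mul, clopen_one_sub hR, clopen_one_sub hR,
          Set.compl_inter, compl_compl, compl_compl]
      rw [hu, hW, hW, hW, hadd a b hab])
  have hm : ∀ a, m (clopen a) = w a := hW
  have hsub : m.IsSigmaSubadditive := by
    rintro f hf ⟨a, ha⟩
    choose b hb using hf
    have hcomp : IsCompact (X := PrimeSpectrum R) (PrimeSpectrum.basicOpen a : Set _) :=
      PrimeSpectrum.isCompact_basicOpen a
    obtain ⟨t, ht⟩ := hcomp.elim_finite_subcover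
      (fun i => (PrimeSpectrum.basicOpen (b i) : Set (PrimeSpectrum R)))
      (fun i => (PrimeSpectrum.basicOpen (b i)).isOpen) (by
        change clopen a ⊆ ⋃ i, clopen (b i)
        rw [ha]
        exact Set.iUnion_mono fun i => (hb i).ge)
    have ht : clopen a ⊆ ⋃ i ∈ t, f i := by
      refine Set.Subset.trans ht (Set.iUnion₂_mono fun i _ => (hb i).le)
    rw [← ha]
    have hf : ∀ i, f i ∈ clopens R := fun i => ⟨b i, hb i⟩
    calc m (clopen a) ≤ m (⋃ i ∈ t, f i) :=
          addContent_mono hring.isSetSemiring ⟨a, rfl⟩ (hring.biUnion_mem t fun i _ => hf i) ht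
      _ ≤ ∑ i ∈ t, m (f i) := addContent_biUnion_le hring fun i _ => hf i
      _ ≤ ∑' i, m (f i) := ENNReal.sum_le_tsum t
  refine ⟨m.measure hring.isSetSemiring le_rfl hsub, fun a => ?_⟩
  rw [AddContent.measure_eq m hring.isSetSemiring rfl hsub ⟨a, rfl⟩, hm]

end StoneSpace

end Stone

/-! ### The representation theorem for abstract `L_p`-spaces -/

namespace LpStructure

open StoneSpace

variable {𝕜 : Type*} [RCLike 𝕜] {p : ℝ} {X : Type*} [NormedAddCommGroup X]
    [NormedSpace 𝕜 X] {R : Type*} [CommRing R] (S : LpStructure 𝕜 p X R)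

include S

theorem norm_T_add_rpow {a b : R} (hab : a * b = 0) (x : X) :
    ‖S.T (a + b) x‖ ^ p = ‖S.T a x‖ ^ p + ‖S.T b x‖ ^ p := by
  have h := S.norm_rpow a (S.T (a + b) x)
  have h1 : S.T a (S.T (a + b) x) = S.T a x := by
    rw [← S.T_mul, mul_add, S.mul_self, hab, add_zero]
  rw [h1, S.T_add hab, add_sub_cancel_left] at h
  rw [S.T_add hab, h]

/-- The spectral measure of a vector on the Stone space. -/
theorem exists_spectralMeasure (hp : 0 < p) (h : X) : ∃ ν : Measure (StoneSpace R),
    ∀ a, ν (clopen a) = ENNReal.ofReal (‖S.T a h‖ ^ p) := by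
  refine exists_measure S.mul_self _ ?_ fun a b hab => ?_
  · rw [S.T_zero, norm_zero, Real.zero_rpow hp.ne', ENNReal.ofReal_zero]
  · rw [S.norm_T_add_rpow hab, ENNReal.ofReal_add (by positivity) (by positivity)]

/-- The norm of a combination of projections of `h` is the `L_p`-norm of the corresponding step
function with respect to the spectral measure. -/
theorem lintegral_step (hp : 0 < p) {h : X} {ν : Measure (StoneSpace R)}
    (hν : ∀ a, ν (clopen a) = ENNReal.ofReal (‖S.T a h‖ ^ p)) (F : Finset R) (c : R → 𝕜) :
    ∀ (b : R) (d : 𝕜),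
      ∫⁻ x in clopen b, ‖∑ a ∈ F, (clopen a).indicator (fun _ => c a) x + d‖ₑ ^ p ∂ν =
        ENNReal.ofReal (‖S.T b (∑ a ∈ F, c a • S.T a h + d • h)‖ ^ p) := by
  classical
  induction F using Finset.induction_on with
  | empty =>
    intro b d
    simp only [Finset.sum_empty, zero_add, lintegral_const, Measure.restrict_apply_univ, hν,
      map_smul, norm_smul]
    rw [← ofReal_norm, ENNReal.ofReal_rpow_of_nonneg (norm_nonneg _) hp.le,
      ← ENNReal.ofReal_mul (by positivity), Real.mul_rpow (norm_nonneg _) (norm_nonneg _)]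
  | insert a₀ F ha₀ ih =>
    intro b d
    simp only [Finset.sum_insert ha₀]
    -- split `b` into the parts inside and outside of `a₀`
    have hd : (b * a₀) * (b * (1 - a₀)) = 0 := by
      linear_combination (-(b * b)) * S.mul_self a₀
    have hsplit : b = b * a₀ + b * (1 - a₀) := by ring
    have hset : clopen b = clopen (b * a₀) ∪ clopen (b * (1 - a₀)) := by
      rw [clopen_mul, clopen_mul, clopen_one_sub S.mul_self, Set.inter_union_compl]
    have hdisj : Disjoint (clopen (b * a₀)) (clopen (b * (1 - a₀))) := by
      rw [Set.disjoint_iff_inter_eq_empty, ← clopen_mul, hd, clopen_zero]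
    have hb1 : S.T (b * a₀) (c a₀ • S.T a₀ h + ∑ a ∈ F, c a • S.T a h + d • h) =
        S.T (b * a₀) (∑ a ∈ F, c a • S.T a h + (c a₀ + d) • h) := by
      have : S.T (b * a₀) (S.T a₀ h) = S.T (b * a₀) h := by
        rw [← S.T_mul, mul_assoc, S.mul_self]
      simp only [map_add, map_smul, this, add_smul]
      abel
    have hb2 : S.T (b * (1 - a₀)) (c a₀ • S.T a₀ h + ∑ a ∈ F, c a • S.T a h + d • h) =
        S.T (b * (1 - a₀)) (∑ a ∈ F, c a • S.T a h + d • h) := by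
      have h1 : b * (1 - a₀) * a₀ = 0 := by linear_combination (-b) * S.mul_self a₀
      have : S.T (b * (1 - a₀)) (S.T a₀ h) = 0 := by
        rw [← S.T_mul, h1, S.T_zero]
      simp only [map_add, map_smul, this, smul_zero, zero_add]
    rw [hset, lintegral_union (measurableSet_clopen _) hdisj]
    conv_rhs => rw [hsplit]
    rw [S.norm_T_add_rpow hd, ENNReal.ofReal_add (by positivity) (by positivity), hb1, hb2,
      ← ih, ← ih]
    congr 1
    · refine setLIntegral_congr_fun (measurableSet_clopen _) fun x hx => ?_
      rw [clopen_mul] at hx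
      simp only [Set.indicator_of_mem hx.2]
      congr 2
      abel
    · refine setLIntegral_congr_fun (measurableSet_clopen _) fun x hx => ?_
      rw [clopen_mul, clopen_one_sub S.mul_self] at hx
      simp only [Set.indicator_of_notMem hx.2, zero_add]

end LpStructure

section SumMeasure

open StoneSpace

variable {I : Type*} [MeasurableSpace I] {R : Type*} [CommRing R]

/-- The disjoint union of a family of measures on the Stone space. -/
noncomputable def stoneSumMeasure (ν : I → Measure (StoneSpace R)) : Measure (I × StoneSpace R) :=
  Measure.sum fun i => (ν i).map (Prod.mk i)

theorem stoneSumMeasure_apply (ν : I → Measure (StoneSpace R)) {s : Set (I × StoneSpace R)}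
    (hs : MeasurableSet s) : stoneSumMeasure ν s = ∑' i, ν i (Prod.mk i ⁻¹' s) := by
  rw [stoneSumMeasure, Measure.sum_apply _ hs]
  exact tsum_congr fun i => Measure.map_apply measurable_prodMk_left hs

theorem lintegral_stoneSumMeasure (ν : I → Measure (StoneSpace R))
    {f : I × StoneSpace R → ℝ≥0∞} (hf : Measurable f) :
    ∫⁻ x, f x ∂(stoneSumMeasure ν) = ∑' i, ∫⁻ x, f (i, x) ∂(ν i) := by
  rw [stoneSumMeasure, lintegral_sum_measure]
  exact tsum_congr fun i => lintegral_map hf measurable_prodMk_left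

variable [DiscreteMeasurableSpace I]

theorem measurableSet_singleton_prod_clopen (i : I) (a : R) :
    MeasurableSet ({i} ×ˢ clopen a : Set (I × StoneSpace R)) :=
  (measurableSet_singleton i).prod (measurableSet_clopen a)

theorem stoneSumMeasure_singleton_prod (ν : I → Measure (StoneSpace R)) (i : I) (a : R) :
    stoneSumMeasure ν ({i} ×ˢ clopen a) = ν i (clopen a) := by
  classical
  rw [stoneSumMeasure_apply _ (measurableSet_singleton_prod_clopen i a), tsum_eq_single i]
  · congr 1
    ext x
    simp
  · intro j hj
    have : (Prod.mk j ⁻¹' ({i} ×ˢ clopen a) : Set (StoneSpace R)) = ∅ := by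
      ext x
      simp [hj]
    rw [this, measure_empty]

/-- The finite unions of clopen pieces. -/
def clopenUnions (I R : Type*) [CommRing R] : Set (Set (I × StoneSpace R)) :=
  {s | ∃ (t : Finset I) (A : I → R), s = ⋃ i ∈ t, {i} ×ˢ clopen (A i)}

theorem measureDense_clopenUnions (hR : ∀ a : R, a * a = a) (ν : I → Measure (StoneSpace R))
    [∀ i, IsFiniteMeasure (ν i)] : (stoneSumMeasure ν).MeasureDense (clopenUnions I R) where
  measurable := by
    rintro _ ⟨t, A, rfl⟩
    exact t.measurableSet_biUnion fun i _ => measurableSet_singleton_prod_clopen _ _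
  approx := by
    classical
    intro s hs hfin ε hε
    rw [stoneSumMeasure_apply ν hs] at hfin
    have hε' : (0 : ℝ≥0∞) < ENNReal.ofReal (ε / 2) := ENNReal.ofReal_pos.2 (half_pos hε)
    obtain ⟨t, ht⟩ := ((ENNReal.tendsto_tsum_compl_atTop_zero hfin).eventually_lt_const hε').exists
    have hpos : 0 < ε / 2 / (t.card + 1) := by positivity
    have hdense : ∀ i, ∃ a : R,
        ν i (symmDiff (Prod.mk i ⁻¹' s) (clopen a)) < ENNReal.ofReal (ε / 2 / (t.card + 1)) :=
      fun i => by
        obtain ⟨_, ⟨a, rfl⟩, ha⟩ := (Measure.MeasureDense.of_generateFrom_isSetAlgebra_finite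
          (ν i) (isSetAlgebra_clopens hR) rfl).approx _ (measurable_prodMk_left hs)
          (measure_ne_top _ _) _ hpos
        exact ⟨a, ha⟩
    choose A hA using hdense
    have hU : MeasurableSet (⋃ i ∈ t, {i} ×ˢ clopen (A i) : Set (I × StoneSpace R)) :=
      t.measurableSet_biUnion fun i _ => measurableSet_singleton_prod_clopen _ _
    refine ⟨_, ⟨t, A, rfl⟩, ?_⟩
    rw [stoneSumMeasure_apply ν (hs.symmDiff hU), ← ENNReal.sum_add_tsum_compl t]
    have hpre : ∀ i, (Prod.mk i ⁻¹' (symmDiff s (⋃ i ∈ t, {i} ×ˢ clopen (A i))) :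
        Set (StoneSpace R)) = symmDiff (Prod.mk i ⁻¹' s) (if i ∈ t then clopen (A i) else ∅) :=
      fun i => by
        ext x
        by_cases hi : i ∈ t <;> simp [Set.mem_symmDiff, hi]
    have e1 : ∑ i ∈ t, ν i (Prod.mk i ⁻¹' (symmDiff s (⋃ i ∈ t, {i} ×ˢ clopen (A i)))) ≤
        ENNReal.ofReal (ε / 2) := by
      calc _ ≤ ∑ i ∈ t, ENNReal.ofReal (ε / 2 / (t.card + 1)) := by
            refine Finset.sum_le_sum fun i hi => ?_
            rw [hpre, if_pos hi]
            exact (hA i).le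
        _ = ENNReal.ofReal (t.card * (ε / 2 / (t.card + 1))) := by
            rw [Finset.sum_const, nsmul_eq_mul, ENNReal.ofReal_mul (by positivity),
              ENNReal.ofReal_natCast]
        _ ≤ _ := by
            refine ENNReal.ofReal_le_ofReal ?_
            rw [mul_div_assoc', div_le_iff₀ (by positivity)]
            nlinarith
    have e2 : ∑' i : {i // i ∉ t},
        ν i (Prod.mk (i : I) ⁻¹' (symmDiff s (⋃ i ∈ t, {i} ×ˢ clopen (A i)))) <
        ENNReal.ofReal (ε / 2) := by
      refine lt_of_eq_of_lt (tsum_congr fun i => ?_) ht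
      rw [hpre, if_neg i.2, ← Set.bot_eq_empty, symmDiff_bot]
    calc _ < ENNReal.ofReal (ε / 2) + ENNReal.ofReal (ε / 2) :=
          ENNReal.add_lt_add_of_le_of_lt (ne_top_of_le_ne_top ENNReal.ofReal_ne_top e1) e1 e2
      _ = ENNReal.ofReal ε := by
          rw [← ENNReal.ofReal_add (by positivity) (by positivity), add_halves]

end SumMeasure

section Representation

open StoneSpace

variable {𝕜 : Type*} [RCLike 𝕜] {p : ℝ≥0∞} {I : Type*} {R : Type*} [CommRing R]

/-- The combinations of projections `T a (h i)` of a family of vectors, with formal coefficients. -/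
noncomputable def LpStructure.combination {X : Type*} [NormedAddCommGroup X] [NormedSpace 𝕜 X]
    {q : ℝ} (S : LpStructure 𝕜 q X R) (h : I → X) : (I →₀ R →₀ 𝕜) →ₗ[𝕜] X :=
  Finsupp.lsum 𝕜 fun i => Finsupp.linearCombination 𝕜 fun a => S.T a (h i)

theorem LpStructure.combination_apply {X : Type*} [NormedAddCommGroup X] [NormedSpace 𝕜 X]
    {q : ℝ} (S : LpStructure 𝕜 q X R) (h : I → X) (v : I →₀ R →₀ 𝕜) :
    S.combination h v = ∑ i ∈ v.support, ∑ a ∈ (v i).support, v i a • S.T a (h i) := rfl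

theorem sum_indicator_singleton_prod_clopen (v : I →₀ R →₀ 𝕜) (x : I × StoneSpace R) :
    ∑ i ∈ v.support, ∑ a ∈ (v i).support,
      ({i} ×ˢ clopen a : Set (I × StoneSpace R)).indicator (fun _ => v i a) x =
    ∑ a ∈ (v x.1).support, (clopen a).indicator (fun _ => v x.1 a) x.2 := by
  classical
  rw [Finset.sum_eq_single x.1]
  · refine Finset.sum_congr rfl fun a _ => ?_
    by_cases hx : x.2 ∈ clopen a <;> simp [Set.indicator, hx, Set.mem_prod]
  · intro j _ hj
    refine Finset.sum_eq_zero fun a _ => Set.indicator_of_notMem (fun hx => hj ?_) _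
    exact (Set.mem_singleton_iff.1 hx.1).symm
  · intro hi
    rw [Finsupp.notMem_support_iff.1 hi]
    simp

variable [MeasurableSpace I] [DiscreteMeasurableSpace I]
  (ν : I → Measure (StoneSpace R)) [∀ i, IsFiniteMeasure (ν i)]

theorem stoneSumMeasure_singleton_prod_ne_top (i : I) (a : R) :
    stoneSumMeasure ν ({i} ×ˢ clopen a) ≠ ∞ := by
  rw [stoneSumMeasure_singleton_prod]
  exact measure_ne_top _ _

variable (𝕜 p) in
/-- The step functions on the disjoint union of copies of the Stone space, with formal
coefficients. -/
noncomputable def stoneStep : (I →₀ R →₀ 𝕜) →ₗ[𝕜] Lp 𝕜 p (stoneSumMeasure ν) :=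
  Finsupp.lsum 𝕜 fun i => Finsupp.linearCombination 𝕜 fun a =>
    indicatorConstLp p (measurableSet_singleton_prod_clopen i a)
      (stoneSumMeasure_singleton_prod_ne_top ν i a) (1 : 𝕜)

theorem stoneStep_apply (v : I →₀ R →₀ 𝕜) :
    stoneStep 𝕜 p ν v = ∑ i ∈ v.support, ∑ a ∈ (v i).support, v i a •
      indicatorConstLp p (measurableSet_singleton_prod_clopen i a)
      (stoneSumMeasure_singleton_prod_ne_top ν i a) (1 : 𝕜) := rfl

theorem coeFn_stoneStep (v : I →₀ R →₀ 𝕜) : stoneStep 𝕜 p ν v =ᵐ[stoneSumMeasure ν]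
    fun x => ∑ a ∈ (v x.1).support, (clopen a).indicator (fun _ => v x.1 a) x.2 := by
  classical
  have key : stoneStep 𝕜 p ν v =ᵐ[stoneSumMeasure ν] fun x => ∑ i ∈ v.support,
      ∑ a ∈ (v i).support, ({i} ×ˢ clopen a : Set (I × StoneSpace R)).indicator
        (fun _ => v i a) x := by
    rw [stoneStep_apply]
    refine (Lp.coeFn_fun_finsetSum _ _).trans ?_
    have : ∀ᵐ x ∂(stoneSumMeasure ν), ∀ i ∈ v.support, (∑ a ∈ (v i).support, v i a •
        indicatorConstLp p (measurableSet_singleton_prod_clopen i a)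
        (stoneSumMeasure_singleton_prod_ne_top ν i a) (1 : 𝕜) : Lp 𝕜 p (stoneSumMeasure ν)) x =
        ∑ a ∈ (v i).support, ({i} ×ˢ clopen a : Set (I × StoneSpace R)).indicator
        (fun _ => v i a) x := by
      refine (Finset.eventually_all _).2 fun i _ => ?_
      refine (Lp.coeFn_fun_finsetSum _ _).trans ?_
      have : ∀ᵐ x ∂(stoneSumMeasure ν), ∀ a ∈ (v i).support, (v i a •
          indicatorConstLp p (measurableSet_singleton_prod_clopen i a)
          (stoneSumMeasure_singleton_prod_ne_top ν i a) (1 : 𝕜) : Lp 𝕜 p (stoneSumMeasure ν)) x =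
          ({i} ×ˢ clopen a : Set (I × StoneSpace R)).indicator (fun _ => v i a) x := by
        refine (Finset.eventually_all _).2 fun a _ => ?_
        filter_upwards [Lp.coeFn_smul (v i a) (indicatorConstLp p
          (measurableSet_singleton_prod_clopen i a)
          (stoneSumMeasure_singleton_prod_ne_top ν i a) (1 : 𝕜)),
          indicatorConstLp_coeFn (p := p) (hs := measurableSet_singleton_prod_clopen i a)
          (hμs := stoneSumMeasure_singleton_prod_ne_top ν i a) (c := (1 : 𝕜))] with x h1 h2
        rw [h1, Pi.smul_apply, h2]
        by_cases hx : x ∈ ({i} ×ˢ clopen a : Set (I × StoneSpace R))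
        · rw [Set.indicator_of_mem hx, Set.indicator_of_mem hx, smul_eq_mul, mul_one]
        · rw [Set.indicator_of_notMem hx, Set.indicator_of_notMem hx, smul_zero]
      filter_upwards [this] with x hx
      exact Finset.sum_congr rfl hx
    filter_upwards [this] with x hx
    exact Finset.sum_congr rfl hx
  exact key.trans (Eventually.of_forall fun x => sum_indicator_singleton_prod_clopen v x)

/-- Combinations of projections of pairwise disjoint vectors have the norms of the corresponding
step functions. -/
theorem norm_stoneStep [Fact (1 ≤ p)] (hp : p ≠ ∞) {X : Type*} [NormedAddCommGroup X]
    [NormedSpace 𝕜 X]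
    (S : LpStructure 𝕜 p.toReal X R) (h : I → X) (hdisj : ∀ i j, i ≠ j → S.Disj (h i) (h j))
    (hν : ∀ i a, ν i (clopen a) = ENNReal.ofReal (‖S.T a (h i)‖ ^ p.toReal)) (v : I →₀ R →₀ 𝕜) :
    ‖stoneStep 𝕜 p ν v‖ = ‖S.combination h v‖ := by
  classical
  have hp0 : p ≠ 0 := (zero_lt_one.trans_le (Fact.out : 1 ≤ p)).ne'
  have hpos : 0 < p.toReal := ENNReal.toReal_pos hp0 hp
  let F : I × StoneSpace R → 𝕜 := fun x =>
    ∑ a ∈ (v x.1).support, (clopen a).indicator (fun _ => v x.1 a) x.2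
  have hF : Measurable F := by
    simp only [F, ← sum_indicator_singleton_prod_clopen]
    exact Finset.measurable_sum _ fun i _ => Finset.measurable_sum _ fun a _ =>
      measurable_const.indicator (measurableSet_singleton_prod_clopen i a)
  -- the integral over the copy of the Stone space with index `i`
  have hint : ∀ i, ∫⁻ x, ‖F (i, x)‖ₑ ^ p.toReal ∂(ν i) =
      ENNReal.ofReal (‖∑ a ∈ (v i).support, v i a • S.T a (h i)‖ ^ p.toReal) := fun i => by
    have := S.lintegral_step hpos (hν i) (v i).support (v i) 1 0
    rw [clopen_one, setLIntegral_univ] at this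
    simpa [S.T_one] using this
  have hcomb : ‖S.combination h v‖ ^ p.toReal =
      ∑ i ∈ v.support, ‖∑ a ∈ (v i).support, v i a • S.T a (h i)‖ ^ p.toReal := by
    rw [S.combination_apply]
    refine LpStructure.norm_sum_rpow (S := S) hpos _ _ fun i _ j _ hij => ?_
    have hmem : ∀ k, ∑ a ∈ (v k).support, v k a • S.T a (h k) ∈ S.band (h k) := fun k =>
      Submodule.sum_mem _ fun a _ => Submodule.smul_mem _ _ (LpStructure.T_mem_band _ _)
    exact (((hdisj i j hij).of_mem_band hpos (hmem i)).symm.of_mem_band hpos (hmem j)).symm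
  refine (Real.rpow_left_inj (norm_nonneg _) (norm_nonneg _) hpos.ne').1 ?_
  rw [Lp.norm_def, eLpNorm_congr_ae (coeFn_stoneStep ν v),
    eLpNorm_eq_lintegral_rpow_enorm_toReal hp0 hp, ENNReal.toReal_rpow, ← ENNReal.rpow_mul,
    one_div_mul_cancel hpos.ne', ENNReal.rpow_one, hcomb]
  change (∫⁻ x, ‖F x‖ₑ ^ p.toReal ∂(stoneSumMeasure ν)).toReal = _
  rw [lintegral_stoneSumMeasure ν (hF.enorm.pow_const _)]
  simp_rw [hint]
  rw [tsum_eq_sum (s := v.support), ← ENNReal.ofReal_sum_of_nonneg fun i _ => by positivity,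
    ENNReal.toReal_ofReal (Finset.sum_nonneg fun i _ => by positivity)]
  intro i hi
  rw [Finsupp.notMem_support_iff.1 hi]
  simp [Real.zero_rpow hpos.ne']

/-- The step functions are dense. -/
theorem denseRange_stoneStep [Fact (1 ≤ p)] (hp : p ≠ ∞) (hR : ∀ a : R, a * a = a) :
    DenseRange (stoneStep 𝕜 p ν) := by
  classical
  have hp' : Fact (p ≠ ∞) := ⟨hp⟩
  suffices h : (LinearMap.range (stoneStep 𝕜 p ν)).topologicalClosure = ⊤ by
    intro f
    have : f ∈ (LinearMap.range (stoneStep 𝕜 p ν)).topologicalClosure := h ▸ Submodule.mem_top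
    exact this
  rw [eq_top_iff]
  rintro f -
  refine Lp.induction hp (fun f => f ∈ (LinearMap.range (stoneStep 𝕜 p ν)).topologicalClosure)
    ?_ ?_ ?_ f
  · intro c s hs hμs
    rw [Lp.simpleFunc.coe_indicatorConst]
    have h1 := (measureDense_clopenUnions hR ν).indicatorConstLp_subset_closure p c
      ⟨s, hs, hμs.ne, rfl⟩
    refine closure_mono ?_ h1
    rintro _ ⟨_, ⟨t, A, rfl⟩, hμ, rfl⟩
    -- the indicator of a finite disjoint union is the sum of the indicators
    refine ⟨∑ i ∈ t, Finsupp.single i (Finsupp.single (A i) c), ?_⟩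
    have hterm : ∀ i, stoneStep 𝕜 p ν (Finsupp.single i (Finsupp.single (A i) c)) =
        indicatorConstLp p (measurableSet_singleton_prod_clopen i (A i))
          (stoneSumMeasure_singleton_prod_ne_top ν i (A i)) c := fun i => by
      rw [stoneStep, Finsupp.lsum_single, Finsupp.linearCombination_single]
      refine Lp.ext ?_
      filter_upwards [Lp.coeFn_smul c (indicatorConstLp p
          (measurableSet_singleton_prod_clopen i (A i))
          (stoneSumMeasure_singleton_prod_ne_top ν i (A i)) (1 : 𝕜)),
          indicatorConstLp_coeFn (p := p) (hs := measurableSet_singleton_prod_clopen i (A i))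
          (hμs := stoneSumMeasure_singleton_prod_ne_top ν i (A i)) (c := (1 : 𝕜)),
          indicatorConstLp_coeFn (p := p) (hs := measurableSet_singleton_prod_clopen i (A i))
          (hμs := stoneSumMeasure_singleton_prod_ne_top ν i (A i)) (c := c)] with x h1 h2 h3
      rw [h1, Pi.smul_apply, h2, h3]
      by_cases hx : x ∈ ({i} ×ˢ clopen (A i) : Set (I × StoneSpace R))
      · rw [Set.indicator_of_mem hx, Set.indicator_of_mem hx, smul_eq_mul, mul_one]
      · rw [Set.indicator_of_notMem hx, Set.indicator_of_notMem hx, smul_zero]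
    rw [map_sum]
    simp only [hterm]
    refine Lp.ext ?_
    have hall : ∀ᵐ x ∂(stoneSumMeasure ν), ∀ i ∈ t,
        indicatorConstLp p (measurableSet_singleton_prod_clopen i (A i))
          (stoneSumMeasure_singleton_prod_ne_top ν i (A i)) c x =
        ({i} ×ˢ clopen (A i) : Set (I × StoneSpace R)).indicator (fun _ => c) x :=
      (Finset.eventually_all _).2 fun i _ => indicatorConstLp_coeFn
    filter_upwards [Lp.coeFn_fun_finsetSum t fun i => indicatorConstLp p
        (measurableSet_singleton_prod_clopen i (A i))
          (stoneSumMeasure_singleton_prod_ne_top ν i (A i)) c, hall,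
      indicatorConstLp_coeFn (p := p) (hs := (measureDense_clopenUnions hR ν).measurable _
        ⟨t, A, rfl⟩) (hμs := hμ) (c := c)] with x h1 h2 h3
    rw [h1, h3, Finset.sum_congr rfl h2]
    obtain ⟨i, x⟩ := x
    by_cases hx : i ∈ t ∧ x ∈ clopen (A i)
    · rw [Finset.sum_eq_single_of_mem i hx.1]
      · simp [Set.indicator, hx]
      · intro j _ hj
        exact Set.indicator_of_notMem (fun h => hj (Set.mem_singleton_iff.1 h.1).symm) _
    · rw [Finset.sum_eq_zero, Set.indicator_of_notMem]
      · intro h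
        simp only [Set.mem_iUnion] at h
        obtain ⟨j, hj, h1, h2⟩ := h
        obtain rfl := Set.mem_singleton_iff.1 h1
        exact hx ⟨hj, h2⟩
      · intro j hj
        refine Set.indicator_of_notMem (fun h => hx ?_) _
        obtain rfl := Set.mem_singleton_iff.1 h.1
        exact ⟨hj, h.2⟩
  · intro f g hf hg _ h1 h2
    exact Submodule.add_mem _ h1 h2
  · exact Submodule.isClosed_topologicalClosure _

end Representation

/-- Two dense linear maps from the same module which induce the same norm have isometric targets. -/
theorem nonempty_linearIsometryEquiv_of_dense {𝕜 M X Y : Type*} [RCLike 𝕜] [AddCommMonoid M]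
    [Module 𝕜 M] [NormedAddCommGroup X] [NormedSpace 𝕜 X] [CompleteSpace X] [NormedAddCommGroup Y]
    [NormedSpace 𝕜 Y] [CompleteSpace Y] (e : M →ₗ[𝕜] X) (φ : M →ₗ[𝕜] Y) (he : DenseRange e)
    (hφ : DenseRange φ) (h : ∀ v, ‖φ v‖ = ‖e v‖) : Nonempty (X ≃ₗᵢ[𝕜] Y) := by
  -- the graph of the isometry is an additive group even if `M` is only a monoid
  let N : Submodule 𝕜 (X × Y) := LinearMap.range (e.prod φ)
  refine ⟨(LinearEquiv.refl 𝕜 N).extendOfIsometry ((LinearMap.fst 𝕜 X Y).comp N.subtype)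
    ((LinearMap.snd 𝕜 X Y).comp N.subtype) ?_ ?_ ?_⟩
  · refine he.mono ?_
    rintro _ ⟨v, rfl⟩
    exact ⟨⟨_, v, rfl⟩, rfl⟩
  · refine hφ.mono ?_
    rintro _ ⟨v, rfl⟩
    exact ⟨⟨_, v, rfl⟩, rfl⟩
  · rintro ⟨_, v, rfl⟩
    exact h v

/-- **Representation of abstract `L_p`-spaces**: a Banach space with a rich Boolean ring of
`L_p`-projections is isometric to an `L_p`-space. -/
theorem LpStructure.exists_equiv_Lp {𝕜 : Type*} [RCLike 𝕜] {p : ℝ≥0∞} [Fact (1 ≤ p)] (hp : p ≠ ∞)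
    {X R : Type u} [NormedAddCommGroup X] [NormedSpace 𝕜 X] [CompleteSpace X] [CommRing R]
    (S : LpStructure 𝕜 p.toReal X R) :
    ∃ (Ω : Type u) (_ : MeasurableSpace Ω) (μ : Measure Ω), Nonempty (X ≃ₗᵢ[𝕜] Lp 𝕜 p μ) := by
  have hpos : 0 < p.toReal :=
    ENNReal.toReal_pos (zero_lt_one.trans_le (Fact.out : 1 ≤ p)).ne' hp
  obtain ⟨D, hdisj, hdense⟩ := S.exists_disjoint_family hpos
  choose ν hν using fun i : D => S.exists_spectralMeasure hpos (i : X)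
  obtain ⟨mD, hmD⟩ : ∃ m : MeasurableSpace D, DiscreteMeasurableSpace D :=
    ⟨⊤, @DiscreteMeasurableSpace.mk D ⊤ fun _ => trivial⟩
  have : ∀ i, IsFiniteMeasure (ν i) := fun i => ⟨by
    rw [← StoneSpace.clopen_one, hν]
    exact ENNReal.ofReal_lt_top⟩
  have hnorm : ∀ v, ‖stoneStep 𝕜 p ν v‖ = ‖S.combination (fun i : D => (i : X)) v‖ :=
    norm_stoneStep ν hp S _ (fun i j hij => hdisj i i.2 j j.2 fun h => hij (Subtype.ext h)) hν
  have hrange : DenseRange (S.combination fun i : D => (i : X)) := by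
    intro x
    have hx : x ∈ (Submodule.span 𝕜 {z | ∃ h ∈ D, ∃ a, z = S.T a h}).topologicalClosure :=
      hdense ▸ Submodule.mem_top
    have hle : Submodule.span 𝕜 {z | ∃ h ∈ D, ∃ a, z = S.T a h} ≤
        LinearMap.range (S.combination fun i : D => (i : X)) := by
      refine Submodule.span_le.2 ?_
      rintro _ ⟨h, hh, a, rfl⟩
      refine ⟨Finsupp.single ⟨h, hh⟩ (Finsupp.single a 1), ?_⟩
      rw [LpStructure.combination, Finsupp.lsum_single, Finsupp.linearCombination_single, one_smul]
    exact closure_mono hle hx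
  exact ⟨D × StoneSpace R, inferInstance, stoneSumMeasure ν,
    nonempty_linearIsometryEquiv_of_dense _ _ hrange (denseRange_stoneStep ν hp S.mul_self) hnorm⟩

/-! ### Gaussian embeddings and complexification of Hilbert spaces -/

/-- Two linear maps from the same module which induce the same norm, the first one with dense
range, differ by a linear isometry. -/
theorem exists_linearIsometry_of_dense {𝕜 M X Y : Type*} [RCLike 𝕜] [AddCommMonoid M]
    [Module 𝕜 M] [NormedAddCommGroup X] [NormedSpace 𝕜 X] [CompleteSpace X] [NormedAddCommGroup Y]
    [NormedSpace 𝕜 Y] [CompleteSpace Y] (e : M →ₗ[𝕜] X) (φ : M →ₗ[𝕜] Y) (he : DenseRange e)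
    (h : ∀ v, ‖φ v‖ = ‖e v‖) : ∃ J : X →ₗᵢ[𝕜] Y, ∀ v, J (e v) = φ v := by
  let N : Submodule 𝕜 (X × Y) := LinearMap.range (e.prod φ)
  let F : N →ₗ[𝕜] X := (LinearMap.fst 𝕜 X Y).comp N.subtype
  let g : N →ₗ[𝕜] Y := (LinearMap.snd 𝕜 X Y).comp N.subtype
  have hF : DenseRange F := by
    refine he.mono ?_
    rintro _ ⟨v, rfl⟩
    exact ⟨⟨_, v, rfl⟩, rfl⟩
  have hn : ∀ w, ‖g w‖ = ‖F w‖ := by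
    rintro ⟨_, v, rfl⟩
    exact h v
  have key : ∀ w, g.extendOfNorm F (F w) = g w :=
    LinearMap.extendOfNorm_eq hF ⟨1, fun w => by rw [hn, one_mul]⟩
  refine ⟨⟨(g.extendOfNorm F : X →L[𝕜] Y), ?_⟩, fun v => key ⟨_, v, rfl⟩⟩
  refine hF.induction ?_ (isClosed_eq (by fun_prop) continuous_norm)
  rintro _ ⟨w, rfl⟩
  change ‖g.extendOfNorm F (F w)‖ = _
  rw [key, hn]

section Complexification

variable {𝕜 ι H : Type*} [RCLike 𝕜] [NormedAddCommGroup H] [InnerProductSpace ℝ H]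

/-- The coordinates of `x` in a Hilbert basis, as a square summable family of scalars of `𝕜`: the
canonical map from a real Hilbert space to its complexification if `𝕜 = ℂ`. -/
noncomputable def HilbertBasis.scalarExtension (𝕜 : Type*) [RCLike 𝕜] (b : HilbertBasis ι ℝ H)
    (x : H) : lp (fun _ : ι => 𝕜) 2 :=
  ⟨fun i => ((b.repr x i : ℝ) : 𝕜), by
    have h := (memℓp_gen_iff (by norm_num)).1 (lp.memℓp (b.repr x))
    exact (memℓp_gen_iff (by norm_num)).2 (by simpa using h)⟩

theorem HilbertBasis.scalarExtension_apply (b : HilbertBasis ι ℝ H) (x : H) (i : ι) :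
    b.scalarExtension 𝕜 x i = ((b.repr x i : ℝ) : 𝕜) := rfl

theorem HilbertBasis.inner_scalarExtension (b : HilbertBasis ι ℝ H) (x y : H) :
    inner 𝕜 (b.scalarExtension 𝕜 x) (b.scalarExtension 𝕜 y) = ((inner ℝ x y : ℝ) : 𝕜) := by
  rw [← b.repr.inner_map_map, lp.inner_eq_tsum, lp.inner_eq_tsum, RCLike.ofReal_tsum]
  refine tsum_congr fun i => ?_
  simp [HilbertBasis.scalarExtension_apply]

theorem HilbertBasis.scalarExtension_sub (b : HilbertBasis ι ℝ H) (x y : H) :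
    b.scalarExtension 𝕜 (x - y) = b.scalarExtension 𝕜 x - b.scalarExtension 𝕜 y := by
  ext i
  rw [HilbertBasis.scalarExtension_apply, map_sub]
  simp only [lp.coeFn_sub, Pi.sub_apply, HilbertBasis.scalarExtension_apply, map_sub]

theorem HilbertBasis.scalarExtension_add (b : HilbertBasis ι ℝ H) (x y : H) :
    b.scalarExtension 𝕜 (x + y) = b.scalarExtension 𝕜 x + b.scalarExtension 𝕜 y := by
  ext i
  rw [HilbertBasis.scalarExtension_apply, map_add]
  simp only [lp.coeFn_add, Pi.add_apply, HilbertBasis.scalarExtension_apply, map_add]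

theorem HilbertBasis.norm_scalarExtension (b : HilbertBasis ι ℝ H) (x : H) :
    ‖b.scalarExtension 𝕜 x‖ = ‖x‖ := by
  have h := b.inner_scalarExtension (𝕜 := 𝕜) x x
  rw [inner_self_eq_norm_sq_to_K, real_inner_self_eq_norm_sq] at h
  norm_cast at h
  exact (pow_left_inj₀ (norm_nonneg _) (norm_nonneg _) two_ne_zero).1 h

theorem HilbertBasis.denseRange_linearCombination_scalarExtension (b : HilbertBasis ι ℝ H) :
    DenseRange (Finsupp.linearCombination 𝕜 (b.scalarExtension 𝕜)) := by
  classical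
  let B : HilbertBasis ι 𝕜 (lp (fun _ : ι => 𝕜) 2) := HilbertBasis.ofRepr (.refl 𝕜 _)
  intro z
  have hz : z ∈ (Submodule.span 𝕜 (Set.range B)).topologicalClosure :=
    B.dense_span ▸ Submodule.mem_top
  have hle : Submodule.span 𝕜 (Set.range B) ≤
      LinearMap.range (Finsupp.linearCombination 𝕜 (b.scalarExtension 𝕜)) := by
    rw [Finsupp.range_linearCombination]
    refine Submodule.span_mono ?_
    rintro _ ⟨i, rfl⟩
    refine ⟨b i, ?_⟩
    ext j
    change ((b.repr (b i) j : ℝ) : 𝕜) = (lp.single 2 i (1 : 𝕜) : lp (fun _ : ι => 𝕜) 2) j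
    rw [b.repr_self]
    rcases eq_or_ne j i with rfl | h
    · simp
    · rw [lp.single_apply_ne _ _ _ h, lp.single_apply_ne _ _ _ h, RCLike.ofReal_zero]
  exact closure_mono hle hz

/-- Inner product preserving maps of a real Hilbert space extend to its complexification. -/
theorem HilbertBasis.exists_scalarExtension_map (b : HilbertBasis ι ℝ H) (V : H → H)
    (hV : ∀ x y, inner ℝ (V x) (V y) = inner ℝ x y) :
    ∃ V' : lp (fun _ : ι => 𝕜) 2 →ₗᵢ[𝕜] lp (fun _ : ι => 𝕜) 2,
      ∀ x, V' (b.scalarExtension 𝕜 x) = b.scalarExtension 𝕜 (V x) := by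
  obtain ⟨V', h⟩ := exists_linearIsometry_of_dense
    (Finsupp.linearCombination 𝕜 (b.scalarExtension 𝕜))
    (Finsupp.linearCombination 𝕜 fun x => b.scalarExtension 𝕜 (V x))
    b.denseRange_linearCombination_scalarExtension (fun v => by
      have : ∀ f : H → lp (fun _ : ι => 𝕜) 2,
          (‖Finsupp.linearCombination 𝕜 f v‖ ^ 2 : 𝕜) = ∑ i ∈ v.support, ∑ j ∈ v.support,
            v j * (starRingEnd 𝕜 (v i) * inner 𝕜 (f i) (f j)) := fun f => by
        rw [← inner_self_eq_norm_sq_to_K, Finsupp.linearCombination_apply, Finsupp.sum, sum_inner]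
        refine Finset.sum_congr rfl fun i _ => ?_
        rw [inner_sum]
        refine Finset.sum_congr rfl fun j _ => ?_
        rw [inner_smul_left, inner_smul_right]
        ring
      have h2 := (this fun x => b.scalarExtension 𝕜 (V x)).trans
        (((this (b.scalarExtension 𝕜)).trans ?_).symm)
      · norm_cast at h2
        exact (pow_left_inj₀ (norm_nonneg _) (norm_nonneg _) two_ne_zero).1 h2
      · simp_rw [b.inner_scalarExtension, hV])
  refine ⟨V', fun x => ?_⟩
  simpa using h (Finsupp.single x 1)

end Complexification

section Gaussian

open ProbabilityTheory

/-- The law of a family of independent standard Gaussian variables. -/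
noncomputable def gaussianProduct (ι : Type*) : Measure (ι → ℝ) :=
  Measure.infinitePi fun _ => gaussianReal 0 1

instance (ι : Type*) : IsProbabilityMeasure (gaussianProduct ι) := by
  unfold gaussianProduct; infer_instance

/-- Gaussian laws are stable: a finite linear combination of the coordinates is Gaussian. -/
theorem map_sum_gaussianProduct {ι : Type*} (s : Finset ι) (v : ι → ℝ) :
    (gaussianProduct ι).map (fun ω => ∑ i ∈ s, v i * ω i) =
      gaussianReal 0 (∑ i ∈ s, ‖v i‖₊ ^ 2) := by
  classical
  have hind : iIndepFun (fun i (ω : ι → ℝ) => v i * ω i) (gaussianProduct ι) :=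
    iIndepFun_infinitePi (P := fun _ : ι => gaussianReal 0 1) (X := fun i x => v i * x)
      (fun i => by fun_prop)
  induction s using Finset.induction_on with
  | empty => simp [Measure.map_const, gaussianReal_zero_var]
  | insert i s hi ih =>
    have h1 : (gaussianProduct ι).map (fun ω => v i * ω i) =
        gaussianReal 0 (‖v i‖₊ ^ 2) := by
      have h2 : (gaussianProduct ι).map (fun ω => ω i) = gaussianReal 0 1 :=
        Measure.infinitePi_map_eval _ i
      have h3 := gaussianReal_map_const_mul (μ := 0) (v := 1) (v i)
      rw [← h2, Measure.map_map (by fun_prop) (by fun_prop)] at h3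
      refine h3.trans ?_
      congr 1
      · simp
      · ext
        simp
    have h4 : IndepFun (fun ω : ι → ℝ => v i * ω i) (fun ω => ∑ j ∈ s, v j * ω j)
        (gaussianProduct ι) := by
      have := (hind.indepFun_finsetSum_of_notMem (fun j => by fun_prop) hi).symm
      convert this using 1
      ext ω
      simp
    have h5 := gaussianReal_add_gaussianReal_of_indepFun h4 h1 ih
    rw [Finset.sum_insert hi, ← add_zero (0 : ℝ), ← h5]
    congr 1
    ext ω
    simp [Finset.sum_insert hi]

variable {𝕜 : Type*} [RCLike 𝕜] {p : ℝ≥0∞} {ι H : Type*}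

theorem memLp_coordinate_gaussianProduct (hp : p ≠ ∞) (i : ι) :
    MemLp (fun ω : ι → ℝ => ((ω i : ℝ) : 𝕜)) p (gaussianProduct ι) := by
  have h := memLp_id_gaussianReal' (μ := 0) (v := 1) p hp
  have h2 : (gaussianProduct ι).map (fun ω => ω i) = gaussianReal 0 1 :=
    Measure.infinitePi_map_eval _ i
  rw [← h2] at h
  exact ((memLp_map_measure_iff aestronglyMeasurable_id (measurable_pi_apply i).aemeasurable).1 h).ofReal

/-- The `i`-th coordinate function as an element of `L_p`. -/
noncomputable def gaussianCoordinate (𝕜 : Type*) [RCLike 𝕜] (hp : p ≠ ∞) (i : ι) :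
    Lp 𝕜 p (gaussianProduct ι) :=
  (memLp_coordinate_gaussianProduct hp i).toLp _

theorem norm_linearCombination_gaussianCoordinate [Fact (1 ≤ p)] (hp : p ≠ ∞) (v : ι →₀ ℝ) :
    ‖Finsupp.linearCombination ℝ (gaussianCoordinate 𝕜 hp) v‖ =
      √(∑ i ∈ v.support, v i ^ 2) * (eLpNorm id p (gaussianReal 0 1)).toReal := by
  have hp0 : p ≠ 0 := (zero_lt_one.trans_le (Fact.out : 1 ≤ p)).ne'
  have h1 : (Finsupp.linearCombination ℝ (gaussianCoordinate 𝕜 hp) v : (ι → ℝ) → 𝕜)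
      =ᵐ[gaussianProduct ι] fun ω => ((∑ i ∈ v.support, v i * ω i : ℝ) : 𝕜) := by
    rw [Finsupp.linearCombination_apply, Finsupp.sum]
    refine (Lp.coeFn_finsetSum _ _).trans ?_
    have : ∀ᵐ ω ∂gaussianProduct ι, ∀ i ∈ v.support,
        (v i • gaussianCoordinate 𝕜 hp i : Lp 𝕜 p _) ω = ((v i * ω i : ℝ) : 𝕜) := by
      refine (ae_ball_iff v.support.countable_toSet).2 fun i _ => ?_
      filter_upwards [Lp.coeFn_smul (v i) (gaussianCoordinate 𝕜 hp i),
        (memLp_coordinate_gaussianProduct (𝕜 := 𝕜) hp i).coeFn_toLp] with ω h2 h3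
      rw [h2, Pi.smul_apply, gaussianCoordinate, h3, RCLike.real_smul_eq_coe_mul]
      push_cast
      rfl
    filter_upwards [this] with ω hω
    rw [Finset.sum_apply, RCLike.ofReal_sum]
    exact Finset.sum_congr rfl hω
  have h2 : (gaussianProduct ι).map (fun ω => ∑ i ∈ v.support, v i * ω i) =
      (gaussianReal 0 1).map fun x => √(∑ i ∈ v.support, v i ^ 2) * x := by
    rw [map_sum_gaussianProduct, gaussianReal_map_const_mul]
    congr 1
    · simp
    · ext
      simp [Real.sq_sqrt (Finset.sum_nonneg fun i _ => sq_nonneg (v i)), NNReal.coe_sum]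
  rw [Lp.norm_def, eLpNorm_congr_ae h1]
  have h3 : eLpNorm (fun ω : ι → ℝ => ((∑ i ∈ v.support, v i * ω i : ℝ) : 𝕜)) p
      (gaussianProduct ι) = eLpNorm (fun ω : ι → ℝ => ∑ i ∈ v.support, v i * ω i) p
      (gaussianProduct ι) :=
    eLpNorm_congr_norm_ae (Eventually.of_forall fun ω => by simp only [RCLike.norm_ofReal,
      Real.norm_eq_abs])
  have h4 : eLpNorm (fun ω : ι → ℝ => ∑ i ∈ v.support, v i * ω i) p (gaussianProduct ι) =
      eLpNorm id p ((gaussianProduct ι).map fun ω => ∑ i ∈ v.support, v i * ω i) := by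
    have hm : Measurable fun ω : ι → ℝ => ∑ i ∈ v.support, v i * ω i := by fun_prop
    rw [eLpNorm_map_measure (by fun_prop) hm.aemeasurable]
    rfl
  have h5 : eLpNorm id p ((gaussianReal 0 1).map fun x => √(∑ i ∈ v.support, v i ^ 2) * x) =
      eLpNorm (√(∑ i ∈ v.support, v i ^ 2) • (id : ℝ → ℝ)) p (gaussianReal 0 1) := by
    rw [eLpNorm_map_measure (by fun_prop) (by fun_prop)]
    rfl
  rw [h3, h4, h2, h5, eLpNorm_const_smul, ENNReal.toReal_mul]
  simp [abs_of_nonneg (Real.sqrt_nonneg _)]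

/-- **Gaussian embedding**: every real Hilbert space embeds into an `L_p`-space, up to a constant
factor isometrically. -/
theorem HilbertBasis.exists_gaussian_embedding [NormedAddCommGroup H] [InnerProductSpace ℝ H]
    [CompleteSpace H] (b : HilbertBasis ι ℝ H) (𝕜 : Type*) [RCLike 𝕜] [Fact (1 ≤ p)]
    (hp : p ≠ ∞) : ∃ (J : H → Lp 𝕜 p (gaussianProduct ι)) (c : ℝ), 0 < c ∧
      ∀ x y, ‖J x - J y‖ = c * ‖x - y‖ := by
  have hp0 : p ≠ 0 := (zero_lt_one.trans_le (Fact.out : 1 ≤ p)).ne'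
  set c : ℝ := (eLpNorm id p (gaussianReal 0 1)).toReal with hc
  have hcpos : 0 < c := by
    refine ENNReal.toReal_pos (fun h => ?_) (memLp_id_gaussianReal' p hp).2.ne
    rw [eLpNorm_eq_zero_iff (by fun_prop) hp0] at h
    have h1 : (gaussianReal 0 1) ({0}ᶜ) = 0 := h
    have h2 : (gaussianReal 0 1) ({0} : Set ℝ) = 0 :=
      (nullSingletonClass_gaussianReal one_ne_zero).measure_singleton 0
    have h3 : (gaussianReal 0 1) Set.univ = 0 := by
      rw [← Set.union_compl_self {(0 : ℝ)}]
      exact measure_union_null h2 h1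
    simp at h3
  have hnorm : ∀ v : ι →₀ ℝ, ‖Finsupp.linearCombination ℝ b v‖ = √(∑ i ∈ v.support, v i ^ 2) := by
    intro v
    rw [Finsupp.linearCombination_apply, Finsupp.sum,
      ← Real.sqrt_sq (norm_nonneg (∑ i ∈ v.support, v i • b i)), ← real_inner_self_eq_norm_sq,
      b.orthonormal.inner_sum]
    simp [sq]
  obtain ⟨J, -⟩ := exists_linearIsometry_of_dense (Finsupp.linearCombination ℝ b)
    (c⁻¹ • Finsupp.linearCombination ℝ (gaussianCoordinate 𝕜 hp)) (by
      intro x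
      have hx : x ∈ (Submodule.span ℝ (Set.range b)).topologicalClosure :=
        b.dense_span ▸ Submodule.mem_top
      rw [← Finsupp.range_linearCombination] at hx
      exact hx) (fun v => by
      rw [LinearMap.smul_apply, norm_smul, norm_linearCombination_gaussianCoordinate, hnorm,
        ← hc, Real.norm_of_nonneg (inv_nonneg.2 hcpos.le), mul_comm, mul_assoc,
        mul_inv_cancel₀ hcpos.ne', mul_one])
  refine ⟨fun x => c • J x, c, hcpos, fun x y => ?_⟩
  rw [← smul_sub, norm_smul, ← map_sub, J.norm_map, Real.norm_of_nonneg hcpos.le]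

end Gaussian

/-! ### Geometry of warped cones -/

section WordLength

variable {Γ : Type*} [Group Γ] {S : Set Γ}

theorem exists_list_length_eq_wordLength (hS : Subgroup.closure S = ⊤) (γ : Γ) :
    ∃ l : List Γ, l.length = wordLength S γ ∧ (∀ g ∈ l, g ∈ S ∨ g⁻¹ ∈ S) ∧ l.prod = γ := by
  have hne : {n | ∃ l : List Γ, l.length = n ∧ (∀ g ∈ l, g ∈ S ∨ g⁻¹ ∈ S) ∧
      l.prod = γ}.Nonempty := by
    obtain ⟨l, h1, h2⟩ := exists_word hS γ
    exact ⟨_, l, rfl, h1, h2⟩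
  exact Nat.sInf_mem hne

theorem wordLength_mul_le (hS : Subgroup.closure S = ⊤) (γ γ' : Γ) :
    wordLength S (γ * γ') ≤ wordLength S γ + wordLength S γ' := by
  obtain ⟨l, hl, h1, rfl⟩ := exists_list_length_eq_wordLength hS γ
  obtain ⟨l', hl', h1', rfl⟩ := exists_list_length_eq_wordLength hS γ'
  rw [← hl, ← hl']
  refine Nat.sInf_le ⟨l ++ l', by simp, fun g hg => ?_, by simp⟩
  rcases List.mem_append.1 hg with h | h
  exacts [h1 g h, h1' g h]

theorem finite_wordLength_le (hSfin : S.Finite) (hS : Subgroup.closure S = ⊤) (n : ℕ) :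
    {γ | wordLength S γ ≤ n}.Finite := by
  have hT : (S ∪ S⁻¹).Finite := hSfin.union hSfin.inv
  have h : {l : List Γ | l.length ≤ n ∧ ∀ g ∈ l, g ∈ S ∪ S⁻¹}.Finite := by
    have : Finite (S ∪ S⁻¹ : Set Γ) := hT
    have h2 := List.finite_length_le (S ∪ S⁻¹ : Set Γ) n
    refine (h2.image (List.map Subtype.val)).subset ?_
    rintro l ⟨hl, hg⟩
    exact ⟨l.pmap Subtype.mk hg, by simpa using hl, by simp [List.map_pmap]⟩
  refine (h.image List.prod).subset fun γ hγ => ?_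
  obtain ⟨l, hl, h1, rfl⟩ := exists_list_length_eq_wordLength hS γ
  exact ⟨l, ⟨hl.trans_le hγ, fun g hg => (h1 g hg).imp_right fun h => Set.mem_inv.2 h⟩, rfl⟩

theorem tendsto_wordLength (hSfin : S.Finite) (hS : Subgroup.closure S = ⊤) :
    Tendsto (wordLength S) cofinite atTop := by
  refine tendsto_atTop.2 fun n => ?_
  refine (finite_wordLength_le hSfin hS n).subset fun γ hγ => ?_
  have h : ¬ n ≤ wordLength S γ := hγ
  exact (not_le.1 h).le

/-- For an isometric action, a chain can be shortened to a chain of one step. -/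
theorem WarpedChain.exists_single_le {X : Type*} [MulAction Γ X] [PseudoMetricSpace X]
    [IsIsometricSMul Γ X] (hS : Subgroup.closure S = ⊤) {x y : X} {c : ℝ}
    (h : WarpedChain S x y c) : ∃ γ : Γ, dist (γ • x) y + wordLength S γ ≤ c := by
  induction h with
  | nil => exact ⟨1, by simp [wordLength_one]⟩
  | @snoc y c γ z h ih =>
    obtain ⟨γ', h'⟩ := ih
    refine ⟨γ * γ', ?_⟩
    have h1 : dist ((γ * γ') • x) z ≤ dist (γ' • x) y + dist (γ • y) z := by
      refine (dist_triangle _ (γ • y) _).trans_eq ?_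
      rw [mul_smul, dist_smul]
    have h2 : (wordLength S (γ * γ') : ℝ) ≤ wordLength S γ + wordLength S γ' := by
      exact_mod_cast wordLength_mul_le hS γ γ'
    linarith

end WordLength

namespace UnitaryLinearization

variable {𝕂 Γ G H : Type*} [RCLike 𝕂] [Group Γ] [TopologicalSpace G] [MulAction Γ G]
  [NormedAddCommGroup H] [InnerProductSpace 𝕂 H] (L : UnitaryLinearization 𝕂 Γ G H)

/-- The point of the open cone on the ray through `m` at distance `t` of the origin. -/
def conePoint (t : ℝ≥0) (m : G) : L.openCone :=
  ⟨((t : ℝ) : 𝕂) • L.ι m, t, m, t.2, rfl⟩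

theorem exists_eq_conePoint (x : L.openCone) : ∃ t m, x = L.conePoint t m := by
  obtain ⟨_, t, m, ht, rfl⟩ := x
  exact ⟨⟨t, ht⟩, m, rfl⟩

@[simp]
theorem norm_conePoint (t : ℝ≥0) (m : G) : ‖(L.conePoint t m : H)‖ = t := by
  simp [conePoint, norm_smul, L.norm_eq_one]

theorem smul_conePoint (γ : Γ) (t : ℝ≥0) (m : G) :
    γ • L.conePoint t m = L.conePoint t (γ • m) :=
  Subtype.ext (by
    change L.U γ (((t : ℝ) : 𝕂) • L.ι m) = ((t : ℝ) : 𝕂) • L.ι (γ • m)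
    rw [_root_.map_smul, L.map_smul])

theorem coe_smul (γ : Γ) (x : L.openCone) : ((γ • x : L.openCone) : H) = L.U γ x := rfl

instance : IsIsometricSMul Γ L.openCone :=
  ⟨fun γ => Isometry.of_dist_eq fun x y => by
    rw [Subtype.dist_eq, Subtype.dist_eq, coe_smul, coe_smul, (L.U γ).dist_map]⟩

theorem dist_conePoint (t : ℝ≥0) (m m' : G) :
    dist (L.conePoint t m) (L.conePoint t m') = t * ‖L.ι m - L.ι m'‖ := by
  rw [Subtype.dist_eq, dist_eq_norm]
  change ‖((t : ℝ) : 𝕂) • L.ι m - ((t : ℝ) : 𝕂) • L.ι m'‖ = _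
  rw [← smul_sub, norm_smul]
  simp

variable (S : Set Γ) (hS : Subgroup.closure S = ⊤)

/-- The map from the open cone to the warped cone which is the identity on points. -/
def toWarped (x : L.openCone) : L.warpedCone S hS := x

/-- The map from the warped cone to the open cone which is the identity on points. -/
def ofWarped (x : L.warpedCone S hS) : L.openCone := x

variable {S hS}

theorem dist_warpedCone_le (γ : Γ) (x y : L.warpedCone S hS) :
    dist x y ≤ dist (γ • L.ofWarped S hS x) (L.ofWarped S hS y) + wordLength S γ :=
  warpedDist_le (.single S γ _ _)

theorem exists_dist_add_wordLength_lt {x y : L.warpedCone S hS} {r : ℝ} (h : dist x y < r) :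
    ∃ γ : Γ, dist (γ • L.ofWarped S hS x) (L.ofWarped S hS y) + wordLength S γ < r := by
  obtain ⟨c, hc, hcr⟩ := exists_warpedChain_lt (X := L.openCone) (S := S) x y h
  obtain ⟨γ, hγ⟩ := hc.exists_single_le hS
  exact ⟨γ, hγ.trans_lt hcr⟩

theorem abs_norm_sub_norm_le (x y : L.warpedCone S hS) :
    |‖(L.ofWarped S hS x : H)‖ - ‖(L.ofWarped S hS y : H)‖| ≤ dist x y := by
  refine le_of_forall_gt_imp_ge_of_dense fun r hr => ?_
  obtain ⟨γ, h⟩ := L.exists_dist_add_wordLength_lt hr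
  rw [Subtype.dist_eq, dist_eq_norm] at h
  have h1 := _root_.abs_norm_sub_norm_le ((γ • L.ofWarped S hS x : L.openCone) : H) (L.ofWarped S hS y)
  rw [coe_smul, (L.U γ).norm_map] at h1
  rw [coe_smul] at h
  have : (0 : ℝ) ≤ wordLength S γ := Nat.cast_nonneg _
  linarith

theorem exists_norm_lt_of_isBounded {K : Set (L.warpedCone S hS)} (hK : Bornology.IsBounded K) :
    ∃ R : ℝ, ∀ x ∈ K, ‖(L.ofWarped S hS x : H)‖ < R := by
  rcases K.eq_empty_or_nonempty with rfl | ⟨y, hy⟩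
  · exact ⟨0, by simp⟩
  obtain ⟨C, hC⟩ := Metric.isBounded_iff.1 hK
  refine ⟨‖(L.ofWarped S hS y : H)‖ + C + 1, fun x hx => ?_⟩
  have h1 := hC hx hy
  have h2 := (le_abs_self _).trans (L.abs_norm_sub_norm_le x y)
  linarith

theorem isBounded_setOf_norm_le (R : ℝ) :
    Bornology.IsBounded {x : L.warpedCone S hS | ‖(L.ofWarped S hS x : H)‖ ≤ R} := by
  have key : ∀ x y : L.warpedCone S hS, dist x y ≤
      ‖(L.ofWarped S hS x : H)‖ + ‖(L.ofWarped S hS y : H)‖ := by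
    intro x y
    have h := L.dist_warpedCone_le 1 x y
    rw [one_smul, wordLength_one, Nat.cast_zero, add_zero, Subtype.dist_eq] at h
    exact h.trans (dist_le_norm_add_norm _ _)
  refine Metric.isBounded_iff.2 ⟨R + R, fun x hx y hy => (key x y).trans (add_le_add hx hy)⟩

/-- If `Γ` acts freely, then far from the origin the elements of bounded length move the points of
the cone far away from each other. -/
theorem exists_forall_eq_of_dist_lt [CompactSpace G] (hcont : ∀ γ : Γ, Continuous fun g : G => γ • g)
    (hfree : ∀ (γ : Γ) (g : G), γ • g = g → γ = 1) (hSfin : S.Finite)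
    (hS : Subgroup.closure S = ⊤) (r : ℝ) :
    ∃ R : ℝ, ∀ x : L.openCone, R < ‖(x : H)‖ → ∀ γ γ' : Γ, (wordLength S γ : ℝ) < r →
      (wordLength S γ' : ℝ) < r → dist (γ • x) (γ' • x) < r → γ = γ' := by
  have hpos : ∀ γ : Γ, ∃ ε > 0, γ ≠ 1 → ∀ m, ε ≤ ‖L.ι (γ • m) - L.ι m‖ := by
    intro γ
    rcases eq_or_ne γ 1 with rfl | hγ
    · exact ⟨1, one_pos, fun h => (h rfl).elim⟩
    have hc : Continuous fun m => ‖L.ι (γ • m) - L.ι m‖ :=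
      ((L.isEmbedding.continuous.comp (hcont γ)).sub L.isEmbedding.continuous).norm
    rcases isEmpty_or_nonempty G with hG | hG
    · exact ⟨1, one_pos, fun _ m => hG.elim m⟩
    obtain ⟨m₀, -, hm⟩ := isCompact_univ.exists_isMinOn Set.univ_nonempty hc.continuousOn
    refine ⟨_, ?_, fun _ m => hm (Set.mem_univ m)⟩
    refine norm_pos_iff.2 (sub_ne_zero.2 fun h => hγ ?_)
    exact hfree γ m₀ (L.isEmbedding.injective h)
  choose ε hε hmove using hpos
  have hfin := finite_wordLength_le hSfin hS (⌈r⌉₊ + ⌈r⌉₊)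
  obtain ⟨δ, hδ, hδle⟩ : ∃ δ > 0, ∀ γ : Γ, wordLength S γ ≤ ⌈r⌉₊ + ⌈r⌉₊ → δ ≤ ε γ := by
    obtain ⟨γ₀, -, h⟩ := hfin.exists_minimalFor ε _ ⟨1, by simp [wordLength_one]⟩
    exact ⟨ε γ₀, hε _, fun γ hγ => (le_total (ε γ₀) (ε γ)).elim id fun h' => h hγ h'⟩
  refine ⟨r / δ, fun x hx γ γ' hγ hγ' hd => ?_⟩
  by_contra hne
  obtain ⟨t, m, rfl⟩ := L.exists_eq_conePoint x
  have hne1 : γ'⁻¹ * γ ≠ 1 := fun h => hne (inv_mul_eq_one.1 h).symm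
  have hlen : wordLength S (γ'⁻¹ * γ) ≤ ⌈r⌉₊ + ⌈r⌉₊ := by
    refine (wordLength_mul_le hS _ _).trans (add_le_add ?_ ?_)
    · rw [wordLength_inv]
      exact_mod_cast hγ'.le.trans (Nat.le_ceil r)
    · exact_mod_cast hγ.le.trans (Nat.le_ceil r)
  have h1 := (hδle _ hlen).trans (hmove _ hne1 m)
  have h2 : dist (γ • L.conePoint t m) (γ' • L.conePoint t m) =
      t * ‖L.ι ((γ'⁻¹ * γ) • m) - L.ι m‖ := by
    rw [← dist_smul γ'⁻¹ (γ • L.conePoint t m), inv_smul_smul, smul_smul, smul_conePoint,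
      dist_conePoint]
  rw [norm_conePoint, div_lt_iff₀ hδ] at hx
  have h3 : (t : ℝ) * δ ≤ t * ‖L.ι ((γ'⁻¹ * γ) • m) - L.ι m‖ :=
    mul_le_mul_of_nonneg_left h1 t.2
  linarith

end UnitaryLinearization

/-! ### Fibred coarse embeddings give proper actions -/

/-- The transition maps of a fibred coarse embedding: after the choice of origins in the fibres, the
local trivializations yield affine isometries `A x y` of `E` for `x` and `y` outside a bounded set
which form a cocycle at small scales and whose displacement of the origin is controlled. -/
theorem FibredCoarseEmbedding.exists_transition {𝕜 : Type*} [RCLike 𝕜] {X : Type*} [MetricSpace X]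
    {E : Type v} [NormedAddCommGroup E] [NormedSpace 𝕜 E] (F : FibredCoarseEmbedding 𝕜 X E)
    {r : ℝ} (hr : 0 < r) :
    ∃ K : Set X, Bornology.IsBounded K ∧ ∃ A : (Kᶜ : Set X) → (Kᶜ : Set X) → (E ≃ᵃⁱ[𝕜] E),
      (∀ x y : (Kᶜ : Set X), dist x y < r → F.ρ₁ (nndist (x : X) y) ≤ ‖A x y 0‖ ∧
        ‖A x y 0‖ ≤ F.ρ₂ (nndist (x : X) y)) ∧
      ∀ x y z, dist x y < r → dist y z < r → dist x z < r → ∀ v, A x y (A y z v) = A x z v := by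
  classical
  let _ := F.normedAddCommGroup
  let _ := F.normedSpace
  obtain ⟨K, hK, t, hρ, ht⟩ := F.exists_trivialization r hr
  have hedist : ∀ x y : (Kᶜ : Set X), dist x y < r → edist (x : X) y < ENNReal.ofReal r :=
    fun x y h => by
      rw [edist_dist]
      exact (ENNReal.ofReal_lt_ofReal_iff hr).2 h
  let C1 : (Kᶜ : Set X) → {C : Set X // C ⊆ Kᶜ ∧ Metric.ediam C < ENNReal.ofReal r} := fun x =>
    ⟨{(x : X)}, Set.singleton_subset_iff.2 x.2, by simpa using hr⟩
  let C2 : ∀ x y : (Kᶜ : Set X), dist x y < r →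
      {C : Set X // C ⊆ Kᶜ ∧ Metric.ediam C < ENNReal.ofReal r} := fun x y h =>
    ⟨{(x : X), (y : X)}, Set.insert_subset x.2 (Set.singleton_subset_iff.2 y.2), by
      rw [Metric.ediam_pair]; exact hedist x y h⟩
  -- the comparison map between two fibres does not depend on the trivialization
  have key : ∀ C D : {C : Set X // C ⊆ Kᶜ ∧ Metric.ediam C < ENNReal.ofReal r}, ∀ x y : X,
      ∀ (hx : x ∈ C.1) (hy : y ∈ C.1) (hx' : x ∈ D.1) (hy' : y ∈ D.1) (v : F.fiber y),
      (t C ⟨x, hx⟩).symm (t C ⟨y, hy⟩ v) = (t D ⟨x, hx'⟩).symm (t D ⟨y, hy'⟩ v) := by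
    intro C D x y hx hy hx' hy' v
    obtain ⟨T, hT⟩ := ht D C ⟨x, hx', hx⟩
    have h : ∀ (w : X) (hw : w ∈ C.1) (hw' : w ∈ D.1) (z : F.fiber w),
        t D ⟨w, hw'⟩ z = T (t C ⟨w, hw⟩ z) := fun w hw hw' z => by
      rw [← hT w hw' hw]
      simp
    rw [eq_comm, AffineIsometryEquiv.symm_apply_eq, h x hx hx', h y hy hy',
      AffineIsometryEquiv.apply_symm_apply]
  let o : ∀ x : (Kᶜ : Set X), F.fiber x ≃ᵃⁱ[𝕜] E := fun x =>
    (t (C1 x) ⟨x, rfl⟩).trans (AffineIsometryEquiv.constVAdd 𝕜 E (-t (C1 x) ⟨x, rfl⟩ (F.s x)))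
  have ho : ∀ x, o x (F.s x) = 0 := fun x => by simp [o]
  have ho' : ∀ x, (o x).symm 0 = F.s x := fun x => by
    rw [AffineIsometryEquiv.symm_apply_eq, ho]
  let A : (Kᶜ : Set X) → (Kᶜ : Set X) → (E ≃ᵃⁱ[𝕜] E) := fun x y =>
    if h : dist x y < r then
      ((o y).symm.trans (t (C2 x y h) ⟨y, Set.mem_insert_of_mem _ rfl⟩)).trans
        ((t (C2 x y h) ⟨x, Set.mem_insert _ _⟩).symm.trans (o x))
    else .refl 𝕜 E
  have hA : ∀ x y (h : dist x y < r) v, A x y v =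
      o x ((t (C2 x y h) ⟨x, Set.mem_insert _ _⟩).symm
        (t (C2 x y h) ⟨y, Set.mem_insert_of_mem _ rfl⟩ ((o y).symm v))) := fun x y h v => by
    simp only [A, dif_pos h]
    rfl
  refine ⟨K, hK, A, fun x y h => ?_, fun x y z h1 h2 h3 v => ?_⟩
  · have h1 := hρ (C2 x y h) ⟨x, Set.mem_insert _ _⟩ ⟨y, Set.mem_insert_of_mem _ rfl⟩
    have h2 : ‖A x y 0‖ = ‖t (C2 x y h) ⟨x, Set.mem_insert _ _⟩ (F.s x) -
        t (C2 x y h) ⟨y, Set.mem_insert_of_mem _ rfl⟩ (F.s y)‖ := by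
      rw [hA x y h, ho', ← dist_zero_right, ← ho x, AffineIsometryEquiv.dist_map,
        ← AffineIsometryEquiv.dist_map (t (C2 x y h) ⟨x, Set.mem_insert _ _⟩),
        AffineIsometryEquiv.apply_symm_apply, dist_comm, dist_eq_norm]
    rw [h2]
    exact h1
  · have hD : Metric.ediam ({(x : X), (y : X), (z : X)} : Set X) < ENNReal.ofReal r := by
      rw [Metric.ediam_triple]
      exact max_lt (max_lt (hedist x y h1) (hedist x z h3)) (hedist y z h2)
    let D : {C : Set X // C ⊆ Kᶜ ∧ Metric.ediam C < ENNReal.ofReal r} :=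
      ⟨{(x : X), (y : X), (z : X)}, Set.insert_subset x.2 (Set.insert_subset y.2
        (Set.singleton_subset_iff.2 z.2)), hD⟩
    have hx : (x : X) ∈ D.1 := Set.mem_insert _ _
    have hy : (y : X) ∈ D.1 := Set.mem_insert_of_mem _ (Set.mem_insert _ _)
    have hz : (z : X) ∈ D.1 := Set.mem_insert_of_mem _ (Set.mem_insert_of_mem _ rfl)
    rw [hA x y h1, hA y z h2, hA x z h3, AffineIsometryEquiv.symm_apply_apply, key _ D x y _ _ hx hy,
      key _ D y z _ _ hy hz, key _ D x z _ _ hx hz, AffineIsometryEquiv.apply_symm_apply]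

theorem le_norm_Lp_of_le {α E : Type*} [MeasurableSpace α] {μ : Measure α} [IsProbabilityMeasure μ]
    [NormedAddCommGroup E] {p : ℝ≥0∞} (hp0 : p ≠ 0) (f : Lp E p μ) {c : ℝ}
    (h : ∀ᵐ x ∂μ, c ≤ ‖f x‖) : c ≤ ‖f‖ := by
  rcases le_total c 0 with hc | hc
  · exact hc.trans ENNReal.toReal_nonneg
  rw [Lp.norm_def]
  refine (ENNReal.ofReal_le_iff_le_toReal (Lp.eLpNorm_ne_top f)).1 ?_
  calc ENNReal.ofReal c = eLpNorm (fun _ : α => c) p μ := by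
        rw [eLpNorm_const _ hp0 (IsProbabilityMeasure.ne_zero μ)]
        simp [← ofReal_norm, abs_of_nonneg hc]
    _ ≤ eLpNorm f p μ := eLpNorm_mono_ae (h.mono fun x hx => by
        rwa [Real.norm_of_nonneg hc])

theorem norm_Lp_le_of_le {α E : Type*} [MeasurableSpace α] {μ : Measure α} [IsProbabilityMeasure μ]
    [NormedAddCommGroup E] {p : ℝ≥0∞} (f : Lp E p μ) {c : ℝ} (hc : 0 ≤ c)
    (h : ∀ᵐ x ∂μ, ‖f x‖ ≤ c) : ‖f‖ ≤ c := by
  have := Lp.norm_le_of_ae_bound hc h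
  have h1 : measureUnivNNReal μ = 1 := by simp [measureUnivNNReal]
  simpa [h1] using this

/-- A compact subset of a metric space can be approximated by measurable maps with finitely many
values. -/
theorem exists_simpleFunc_norm_lt {G H : Type*} [TopologicalSpace G] [CompactSpace G] [Nonempty G]
    [MeasurableSpace G] [BorelSpace G] [NormedAddCommGroup H] {ι : G → H} (hι : IsEmbedding ι)
    {ε : ℝ} (hε : 0 < ε) : ∃ q : SimpleFunc G G, ∀ g, ‖ι (q g) - ι g‖ < ε := by
  let _ : MetricSpace G := hι.comapMetricSpace ι
  obtain ⟨N, hN⟩ := exists_edist_nearestPt_lt (isCompact_univ : IsCompact (Set.univ : Set G))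
    (TopologicalSpace.denseSeq G)
    (by rw [(TopologicalSpace.denseRange_denseSeq G).closure_range])
    (ENNReal.ofReal_pos.2 hε)
  refine ⟨SimpleFunc.nearestPt (TopologicalSpace.denseSeq G) N, fun g => ?_⟩
  have h := hN g (Set.mem_univ g)
  rw [edist_dist, ENNReal.ofReal_lt_ofReal_iff hε] at h
  rw [← dist_eq_norm]
  exact h

theorem AffineIsometryEquiv.apply_eq_linear_add {𝕜 E : Type*} [RCLike 𝕜] [NormedAddCommGroup E]
    [NormedSpace 𝕜 E] (T : E ≃ᵃⁱ[𝕜] E) (x : E) : T x = T.linearIsometryEquiv x + T 0 := by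
  simpa using T.map_vadd 0 x

/-- A fibred coarse embedding of the warped cone into `E` yields a proper action of `Γ` on an
ultrapower of `L_p (G; E)`: at the scale `n`, the transition maps along the orbits in a far away
slice of the cone define affine isometries of `L_p (G; E)` which cover the translations of `G`,
and each relation of `Γ` holds for them once `n` is large. -/
theorem FibredCoarseEmbedding.admitsProperAffineIsometricAction {𝕜 𝕂 G H : Type*} [RCLike 𝕜]
    [RCLike 𝕂] [Group G] [TopologicalSpace G] [IsTopologicalGroup G] [CompactSpace G]
    [MeasurableSpace G] [BorelSpace G] {μ : Measure G} [IsProbabilityMeasure μ]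
    [μ.IsMulLeftInvariant] {Γ : Subgroup G} {S : Set Γ} (hSfin : S.Finite)
    {hS : Subgroup.closure S = ⊤} [NormedAddCommGroup H] [InnerProductSpace 𝕂 H]
    {L : UnitaryLinearization 𝕂 Γ G H} {E : Type v} [NormedAddCommGroup E] [NormedSpace 𝕜 E]
    (F : FibredCoarseEmbedding 𝕜 (L.warpedCone S hS) E) (p : ℝ≥0∞) [Fact (1 ≤ p)] :
    AdmitsProperAffineIsometricAction 𝕜 Γ (Ultrapower 𝕜 (Lp E p μ)) := by
  have hp0 : p ≠ 0 := (zero_lt_one.trans_le (Fact.out : 1 ≤ p)).ne'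
  -- the discretization of the slices perturbs distances by less than `2`
  have hr : ∀ n : ℕ, (0 : ℝ) < n + 3 := fun n => by positivity
  choose K hK A hρ hcoc using fun n : ℕ => F.exists_transition (hr n)
  choose R hR using fun n => L.exists_norm_lt_of_isBounded (hK n)
  let t : ℕ → ℝ≥0 := fun n => max (R n).toNNReal n
  have htR : ∀ n, R n ≤ t n := fun n => by
    refine (Real.le_coe_toNNReal _).trans ?_
    exact_mod_cast le_max_left _ _
  have htn : ∀ n : ℕ, (n : ℝ) ≤ t n := fun n => by
    have : (n : ℝ≥0) ≤ t n := le_max_right _ _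
    exact_mod_cast this
  -- `q n` moves the points of the slice at height `t n` by less than `1`
  choose q hq using fun n => exists_simpleFunc_norm_lt L.isEmbedding
    (ε := ((t n : ℝ) + 1)⁻¹) (by positivity)
  have hq' : ∀ n g, dist (L.conePoint (t n) (q n g)) (L.conePoint (t n) g) < 1 := by
    intro n g
    rw [L.dist_conePoint]
    have h1 := (hq n g).le
    have h2 : (t n : ℝ) * ((t n : ℝ) + 1)⁻¹ < 1 := by
      rw [← div_eq_mul_inv, div_lt_one (by positivity)]
      linarith
    exact (mul_le_mul_of_nonneg_left h1 (t n).2).trans_lt h2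
  let Z : ∀ n, G → ((K n)ᶜ : Set (L.warpedCone S hS)) := fun n m =>
    ⟨L.toWarped S hS (L.conePoint (t n) m), fun h => by
      have h1 := hR n _ h
      have h2 : ‖(L.ofWarped S hS (L.toWarped S hS (L.conePoint (t n) m)) : H)‖ = t n :=
        L.norm_conePoint _ _
      linarith [htR n]⟩
  let w : ∀ n, G → ((K n)ᶜ : Set (L.warpedCone S hS)) := fun n g => Z n (q n g)
  have hsmul : ∀ (γ : Γ) (g : G), γ • ((γ⁻¹ : Γ) * g : G) = g := fun γ g => by
    rw [Subgroup.smul_def, smul_eq_mul]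
    simp
  have hmove : ∀ n (γ : Γ) g, dist (γ • L.conePoint (t n) (q n ((γ⁻¹ : Γ) * g)))
      (L.conePoint (t n) (q n g)) < 2 := by
    intro n γ g
    have h1 := hq' n ((γ⁻¹ : Γ) * g)
    rw [← dist_smul γ, L.smul_conePoint γ (t n) ((γ⁻¹ : Γ) * g : G), hsmul] at h1
    have h2 := hq' n g
    have h3 := dist_triangle_right (γ • L.conePoint (t n) (q n ((γ⁻¹ : Γ) * g)))
      (L.conePoint (t n) (q n g)) (L.conePoint (t n) g)
    linarith
  have hupper : ∀ n (γ : Γ) g, dist (w n g) (w n ((γ⁻¹ : Γ) * g)) ≤ wordLength S γ + 2 := by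
    intro n γ g
    have h := L.dist_warpedCone_le γ (w n ((γ⁻¹ : Γ) * g) : L.warpedCone S hS) (w n g)
    have h1 := hmove n γ g
    rw [dist_comm, Subtype.dist_eq]
    refine h.trans ?_
    have h2 : dist (γ • L.ofWarped S hS (w n ((γ⁻¹ : Γ) * g))) (L.ofWarped S hS (w n g)) < 2 := h1
    linarith
  have hlower : ∀ γ : Γ, ∀ᶠ n : ℕ in atTop, ∀ g,
      (wordLength S γ : ℝ) ≤ dist (w n g) (w n ((γ⁻¹ : Γ) * g)) := by
    intro γ
    obtain ⟨R', hR'⟩ := L.exists_forall_eq_of_dist_lt (fun γ => continuous_const_smul γ)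
      (fun γ g h => by
        rw [Subgroup.smul_def, smul_eq_mul, mul_eq_right] at h
        exact_mod_cast h) hSfin hS (wordLength S γ + 2)
    filter_upwards [eventually_gt_atTop ⌈R'⌉₊] with n hn g
    by_contra! hlt
    rw [dist_comm] at hlt
    obtain ⟨γ', h⟩ := L.exists_dist_add_wordLength_lt
      (x := (w n ((γ⁻¹ : Γ) * g) : L.warpedCone S hS)) (y := w n g) hlt
    have h1 := hmove n γ g
    have h0 : (0 : ℝ) ≤ wordLength S γ' := Nat.cast_nonneg _
    have hd0 : 0 ≤ dist (γ' • L.ofWarped S hS (w n ((γ⁻¹ : Γ) * g))) (L.ofWarped S hS (w n g)) :=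
      dist_nonneg
    have h2 : dist (γ' • L.conePoint (t n) (q n ((γ⁻¹ : Γ) * g))) (L.conePoint (t n) (q n g)) <
        wordLength S γ - wordLength S γ' := by
      have h' : dist (γ' • L.ofWarped S hS (w n ((γ⁻¹ : Γ) * g))) (L.ofWarped S hS (w n g)) <
        wordLength S γ - wordLength S γ' := by linarith
      exact h'
    have h3 := dist_triangle_right (γ' • L.conePoint (t n) (q n ((γ⁻¹ : Γ) * g)))
      (γ • L.conePoint (t n) (q n ((γ⁻¹ : Γ) * g))) (L.conePoint (t n) (q n g))
    -- a shorter chain would be given by an element other than `γ`, which freeness forbids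
    have h4 : γ' = γ := by
      refine hR' (L.conePoint (t n) (q n ((γ⁻¹ : Γ) * g))) ?_ γ' γ ?_ ?_ ?_
      · rw [L.norm_conePoint]
        have : (⌈R'⌉₊ : ℝ) < n := by exact_mod_cast hn
        linarith [Nat.le_ceil R', htn n]
      · linarith
      · linarith
      · linarith
    subst h4
    linarith
  have hscale : ∀ γ : Γ, ∀ᶠ n : ℕ in atTop, ∀ g, dist (w n g) (w n ((γ⁻¹ : Γ) * g)) < n + 3 := by
    intro γ
    filter_upwards [eventually_ge_atTop (wordLength S γ)] with n hn g
    have : (wordLength S γ : ℝ) ≤ n := by exact_mod_cast hn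
    linarith [hupper n γ g]
  let θ : Γ → G → G := fun γ g => (γ⁻¹ : Γ) * g
  have hθ : ∀ γ, MeasurePreserving (θ γ) μ μ := fun γ => measurePreserving_mul_left μ _
  let Q : ℕ → Γ → SimpleFunc G (G × G) := fun n γ =>
    (q n).pair ((q n).comp (θ γ) (hθ γ).measurable)
  let op : ∀ _ : ℕ, G × G → E →ₗᵢ[𝕜] E := fun n m =>
    (A n (Z n m.1) (Z n m.2)).linearIsometryEquiv.toLinearIsometry
  let b₀ : ℕ → Γ → SimpleFunc G E := fun n γ => (Q n γ).map fun m => A n (Z n m.1) (Z n m.2) 0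
  let π : ℕ → Γ → Lp E p μ →ₗᵢ[𝕜] Lp E p μ := fun n γ => Lp_weightedComp (Q n γ) (op n) (hθ γ)
  have hπ : ∀ n γ f, π n γ f =ᵐ[μ] fun g =>
      (A n (w n g) (w n (θ γ g))).linearIsometryEquiv (f (θ γ g)) :=
    fun n γ f => coeFn_Lp_weightedComp (Q n γ) (op n) (hθ γ) f
  let b : ℕ → Γ → Lp E p μ := fun n γ =>
    (SimpleFunc.memLp_of_isFiniteMeasure (b₀ n γ) p μ).toLp _
  have hb : ∀ n γ, b n γ =ᵐ[μ] fun g => A n (w n g) (w n (θ γ g)) 0 :=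
    fun n γ => (SimpleFunc.memLp_of_isFiniteMeasure (b₀ n γ) p μ).coeFn_toLp
  have hθmul : ∀ γ γ' g, θ (γ * γ') g = θ γ' (θ γ g) := fun γ γ' g => by
    simp [θ, mul_assoc]
  have hcoc' : ∀ γ γ', ∀ᶠ n in atTop, ∀ g v, A n (w n g) (w n (θ γ g))
      (A n (w n (θ γ g)) (w n (θ (γ * γ') g)) v) = A n (w n g) (w n (θ (γ * γ') g)) v := by
    intro γ γ'
    filter_upwards [hscale γ, hscale γ', hscale (γ * γ')] with n h1 h2 h3 g v
    refine hcoc n _ _ _ (h1 g) ?_ (h3 g) v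
    change dist (w n (θ γ g)) (w n (θ (γ * γ') g)) < _
    rw [hθmul]
    exact h2 (θ γ g)
  refine .ultrapower π b (fun γ => F.ρ₁ (wordLength S γ)) ?_ ?_ ?_ ?_ ?_ ?_
  · exact F.tendsto_ρ₁.comp (tendsto_natCast_atTop_atTop.comp (tendsto_wordLength hSfin hS))
  · intro γ
    obtain ⟨N, hN⟩ := eventually_atTop.1 (hscale γ)
    refine ⟨max (∑ n ∈ Finset.range N, ‖b n γ‖) (F.ρ₂ (wordLength S γ + 2)), fun n => ?_⟩
    -- the finitely many scales which are too small for `γ` do not affect boundedness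
    rcases lt_or_ge n N with hn | hn
    · exact (Finset.single_le_sum (f := fun n => ‖b n γ‖) (fun _ _ => norm_nonneg _)
        (Finset.mem_range.2 hn)).trans (le_max_left _ _)
    · have key : ∀ g, ‖A n (w n g) (w n (θ γ g)) 0‖ ≤ F.ρ₂ (wordLength S γ + 2) := fun g => by
        refine ((hρ n _ _ (hN n hn g)).2).trans (F.monotone_ρ₂ ?_)
        rw [← NNReal.coe_le_coe]
        exact_mod_cast hupper n γ g
      refine (norm_Lp_le_of_le _ ((norm_nonneg _).trans (key 1)) ?_).trans (le_max_right _ _)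
      filter_upwards [hb n γ] with g hg
      rw [hg]
      exact key g
  · filter_upwards [hcoc' 1 1] with n h f
    refine Lp.ext ((hπ n 1 f).trans (Eventually.of_forall fun g => ?_))
    have h1 : θ 1 g = g := by simp [θ]
    have h2 := h g
    simp only [mul_one, h1] at h2 ⊢
    have h3 : ∀ v, A n (w n g) (w n g) v = v := fun v =>
      (A n (w n g) (w n g)).injective (h2 v)
    have h4 := AffineIsometryEquiv.apply_eq_linear_add (A n (w n g) (w n g)) (f g)
    rw [h3, h3, add_zero] at h4
    exact h4.symm
  · intro γ γ'
    filter_upwards [hcoc' γ γ'] with n h f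
    refine Lp.ext ?_
    filter_upwards [hπ n (γ * γ') f, hπ n γ (π n γ' f),
      (hθ γ).quasiMeasurePreserving.ae (hπ n γ' f)] with g h1 h2 h3
    rw [h1, h2, h3, ← hθmul]
    have h4 := h g (f (θ (γ * γ') g))
    have h5 := h g 0
    simp only [AffineIsometryEquiv.apply_eq_linear_add _ (f (θ (γ * γ') g))] at h4
    rw [AffineIsometryEquiv.apply_eq_linear_add, map_add, add_assoc,
      ← AffineIsometryEquiv.apply_eq_linear_add, h5] at h4
    exact (add_right_cancel h4).symm
  · intro γ γ'
    filter_upwards [hcoc' γ γ'] with n h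
    refine Lp.ext ?_
    filter_upwards [hb n (γ * γ'), hb n γ, hπ n γ (b n γ'),
      (hθ γ).quasiMeasurePreserving.ae (hb n γ'), Lp.coeFn_add (π n γ (b n γ')) (b n γ)]
      with g h1 h2 h3 h4 h5
    rw [h5, Pi.add_apply, h1, h2, h3, h4, ← hθmul, ← h g,
      AffineIsometryEquiv.apply_eq_linear_add]
  · intro γ
    filter_upwards [hscale γ, hlower γ] with n h1 h2
    refine le_norm_Lp_of_le hp0 _ ?_
    filter_upwards [hb n γ] with g hg
    rw [hg]
    refine (F.monotone_ρ₁ ?_).trans (hρ n _ _ (h1 g)).1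
    rw [← NNReal.coe_le_coe]
    exact_mod_cast h2 g

/-! ### Proper actions give fibred coarse embeddings -/

/-- A fibred coarse embedding into `E` can be transported to an isometric Banach space. -/
theorem AdmitsFibredCoarseEmbedding.congr {𝕜 : Type*} [RCLike 𝕜] {X : Type*} [MetricSpace X]
    {E F : Type v} [NormedAddCommGroup E] [NormedSpace 𝕜 E] [NormedAddCommGroup F]
    [NormedSpace 𝕜 F] (e : E ≃ₗᵢ[𝕜] F) (h : AdmitsFibredCoarseEmbedding 𝕜 X E) :
    AdmitsFibredCoarseEmbedding 𝕜 X F := by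
  obtain ⟨A⟩ := h
  let _ := A.normedAddCommGroup
  let _ := A.normedSpace
  have hc := A.completeSpace
  let e' : E ≃ᵃⁱ[𝕜] F := e.toAffineIsometryEquiv
  refine ⟨⟨A.fiber, A.s, A.ρ₁, A.ρ₂, A.monotone_ρ₁, A.monotone_ρ₂, A.tendsto_ρ₁, A.tendsto_ρ₂,
    fun r hr => ?_⟩⟩
  obtain ⟨K, hK, t, h1, h2⟩ := A.exists_trivialization r hr
  refine ⟨K, hK, fun C x => (t C x).trans e', fun C x y => ?_, fun C₁ C₂ hC => ?_⟩
  · have h3 : ‖((t C x).trans e') (A.s x) - ((t C y).trans e') (A.s y)‖ =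
        ‖t C x (A.s x) - t C y (A.s y)‖ := by
      rw [← dist_eq_norm, ← dist_eq_norm]
      exact e'.dist_map _ _
    rw [h3]
    exact h1 C x y
  · obtain ⟨T, hT⟩ := h2 C₁ C₂ hC
    refine ⟨(e'.symm.trans T).trans e', fun x hx₁ hx₂ => ?_⟩
    rw [← hT x hx₁ hx₂]
    rfl

namespace UnitaryLinearization

/-- **Descent to the warped cone**: let `Γ` act freely on `G` and by affine isometries `τ` on `W`.
If the displacements `‖τ β (s y) - s x‖` of a map `s` from the cone to `W` are bounded from below
in terms of the warped distance of `x` and `y`, and from above in terms of the length of the chain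
given by `β`, then `s` is the section of a fibred coarse embedding: far from the origin, a set of
bounded diameter is contained in a neighbourhood of an orbit of a ball of `Γ`, whose points have
unique coordinates in `Γ`, and the trivializations are translations by these coordinates. -/
theorem admitsFibredCoarseEmbedding {𝕜 𝕂 Γ G H : Type*} [RCLike 𝕜]
    [RCLike 𝕂] [Group Γ] [TopologicalSpace G] [MulAction Γ G] [CompactSpace G]
    [NormedAddCommGroup H] [InnerProductSpace 𝕂 H] (L : UnitaryLinearization 𝕂 Γ G H)
    (hcont : ∀ γ : Γ, Continuous fun g : G => γ • g)
    (hfree : ∀ (γ : Γ) (g : G), γ • g = g → γ = 1) {S : Set Γ} (hSfin : S.Finite)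
    (hS : Subgroup.closure S = ⊤) {W : Type v} [NormedAddCommGroup W] [NormedSpace 𝕜 W]
    [CompleteSpace W] (τ : Γ →* (W ≃ᵃⁱ[𝕜] W)) (s : L.openCone → W) {ρ ψ : ℝ≥0 → ℝ}
    (hρ : Monotone ρ) (hψ : Monotone ψ) (hρt : Tendsto ρ atTop atTop)
    (hψt : Tendsto ψ atTop atTop)
    (hlow : ∀ (β : Γ) (x y : L.warpedCone S hS),
      ρ (nndist x y) ≤ ‖τ β (s (L.ofWarped S hS y)) - s (L.ofWarped S hS x)‖)
    (hup : ∀ (β : Γ) (x y : L.openCone) (u : ℝ≥0), dist (β • y) x + wordLength S β ≤ u →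
      ‖τ β (s y) - s x‖ ≤ ψ u) :
    AdmitsFibredCoarseEmbedding 𝕜 (L.warpedCone S hS) W := by
  let s' : L.warpedCone S hS → W := fun x => s (L.ofWarped S hS x)
  let ψ' : ℝ≥0 → ℝ := fun u => ψ (u + 1)
  have hψ' : Monotone ψ' := fun a b hab => hψ (by gcongr)
  have hψt' : Tendsto ψ' atTop atTop :=
    hψt.comp (tendsto_atTop_mono (fun u => le_self_add) tendsto_id)
  refine ⟨⟨fun _ => W, s', ρ, ψ', hρ, hψ', hρt, hψt', fun r hr => ?_⟩⟩
  -- two coordinates of length and displacement less than `2 * r` are to be distinguished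
  obtain ⟨R, hR⟩ := L.exists_forall_eq_of_dist_lt hcont hfree hSfin hS (4 * r)
  refine ⟨_, L.isBounded_setOf_norm_le R, ?_⟩
  set K : Set (L.warpedCone S hS) := {x | ‖(L.ofWarped S hS x : H)‖ ≤ R} with hK
  -- the coordinates in `Γ` of the points of `C`
  have hcoord : ∀ C : {C : Set (L.warpedCone S hS) // C ⊆ Kᶜ ∧ Metric.ediam C < ENNReal.ofReal r},
      ∃ γ : C.1 → Γ, ∀ x y, (wordLength S (γ x * (γ y)⁻¹) : ℝ) < 2 * r ∧
        dist ((γ x * (γ y)⁻¹) • L.ofWarped S hS y) (L.ofWarped S hS x) < 2 * r := by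
    intro C
    rcases isEmpty_or_nonempty C.1 with hC | ⟨⟨x₀, hx₀⟩⟩
    · exact ⟨fun _ => 1, fun x => hC.elim x⟩
    have h1 : ∀ x : C.1, ∃ γ : Γ,
        dist (γ • L.ofWarped S hS x₀) (L.ofWarped S hS x) + wordLength S γ < r := fun x => by
      refine L.exists_dist_add_wordLength_lt ?_
      have h2 := (Metric.edist_le_ediam_of_mem hx₀ x.2).trans_lt C.2.2
      rwa [edist_dist, ENNReal.ofReal_lt_ofReal_iff hr] at h2
    choose γ hγ using h1
    have hpos : ∀ x, (0 : ℝ) ≤ dist (γ x • L.ofWarped S hS x₀) (L.ofWarped S hS x) :=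
      fun x => dist_nonneg
    have hpos' : ∀ x, (0 : ℝ) ≤ wordLength S (γ x) := fun x => Nat.cast_nonneg _
    refine ⟨γ, fun x y => ⟨?_, ?_⟩⟩
    · have h3 : (wordLength S (γ x * (γ y)⁻¹) : ℝ) ≤ wordLength S (γ x) + wordLength S (γ y) := by
        have := wordLength_mul_le hS (γ x) (γ y)⁻¹
        rw [wordLength_inv] at this
        exact_mod_cast this
      linarith [hγ x, hγ y, hpos x, hpos y]
    · have h3 := dist_triangle ((γ x * (γ y)⁻¹) • L.ofWarped S hS y)
        (γ x • L.ofWarped S hS x₀) (L.ofWarped S hS x)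
      have h4 : dist ((γ x * (γ y)⁻¹) • L.ofWarped S hS y) (γ x • L.ofWarped S hS x₀) =
          dist (γ y • L.ofWarped S hS x₀) (L.ofWarped S hS y) := by
        rw [mul_smul, dist_smul, ← dist_smul (γ y), smul_inv_smul, dist_comm]
      linarith [hγ x, hγ y, hpos' x, hpos' y]
  choose γ hγ using hcoord
  have hfar : ∀ (C : {C : Set (L.warpedCone S hS) // C ⊆ Kᶜ ∧
      Metric.ediam C < ENNReal.ofReal r}) (x : C.1), R < ‖(L.ofWarped S hS x : H)‖ :=
    fun C x => not_le.1 (C.2.1 x.2)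
  refine ⟨fun C x => (τ (γ C x)).symm, fun C x y => ?_, fun C₁ C₂ hC => ?_⟩
  · have h1 : ‖(τ (γ C x)).symm (s (L.ofWarped S hS x)) -
        (τ (γ C y)).symm (s (L.ofWarped S hS y))‖ =
        ‖τ (γ C x * (γ C y)⁻¹) (s (L.ofWarped S hS y)) - s (L.ofWarped S hS x)‖ := by
      rw [← dist_eq_norm, ← dist_eq_norm, dist_comm, ← (τ (γ C x)).dist_map,
        AffineIsometryEquiv.apply_symm_apply, map_mul, map_inv]
      rfl
    have h1' : ‖(τ (γ C x)).symm (s (L.ofWarped S hS x)) -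
        (τ (γ C y)).symm (s (L.ofWarped S hS y))‖ ∈ Set.Icc (ρ (nndist x y))
        (ψ (nndist x y + 1)) := by
      rw [h1]
      refine ⟨hlow _ x y, hup _ _ _ _ ?_⟩
      have h2 : dist (y : L.warpedCone S hS) x < r := by
        have h2 := (Metric.edist_le_ediam_of_mem y.2 x.2).trans_lt C.2.2
        rwa [edist_dist, ENNReal.ofReal_lt_ofReal_iff hr] at h2
      obtain ⟨β, hβ⟩ := L.exists_dist_add_wordLength_lt
        (lt_min h2 (lt_add_one (dist (y : L.warpedCone S hS) x)))
      have hβr := hβ.trans_le (min_le_left _ _)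
      have h0 : (0 : ℝ) ≤ wordLength S β := Nat.cast_nonneg _
      have h0' : 0 ≤ dist (β • L.ofWarped S hS y) (L.ofWarped S hS x) := dist_nonneg
      -- the chain of the coordinates is the shortest one
      have hβγ : γ C x * (γ C y)⁻¹ = β := by
        refine hR (L.ofWarped S hS y) (hfar C y) _ _ ?_ ?_ ?_
        · linarith [(hγ C x y).1]
        · linarith
        · have h3 := dist_triangle_right ((γ C x * (γ C y)⁻¹) • L.ofWarped S hS y)
            (β • L.ofWarped S hS y) (L.ofWarped S hS x)
          linarith [(hγ C x y).2]
      rw [hβγ]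
      refine (hβ.trans_le (min_le_right _ _)).le.trans_eq ?_
      rw [dist_comm]
      rfl
    exact h1'
  · obtain ⟨x₀, hx₁, hx₂⟩ := hC
    refine ⟨τ ((γ C₁ ⟨x₀, hx₁⟩)⁻¹ * γ C₂ ⟨x₀, hx₂⟩), fun x h₁ h₂ => ?_⟩
    have h1 : γ C₁ ⟨x₀, hx₁⟩ * (γ C₁ ⟨x, h₁⟩)⁻¹ = γ C₂ ⟨x₀, hx₂⟩ * (γ C₂ ⟨x, h₂⟩)⁻¹ := by
      have e1 := hγ C₁ ⟨x₀, hx₁⟩ ⟨x, h₁⟩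
      have e2 := hγ C₂ ⟨x₀, hx₂⟩ ⟨x, h₂⟩
      refine hR (L.ofWarped S hS x) (hfar C₁ ⟨x, h₁⟩) _ _ ?_ ?_ ?_
      · linarith [e1.1]
      · linarith [e2.1]
      · refine (dist_triangle_right _ _ (L.ofWarped S hS x₀)).trans_lt ?_
        have e3 := add_lt_add e1.2 e2.2
        rw [show (4 : ℝ) * r = 2 * r + 2 * r by ring]
        exact e3
    have h2 : (γ C₁ ⟨x₀, hx₁⟩)⁻¹ * γ C₂ ⟨x₀, hx₂⟩ = (γ C₁ ⟨x, h₁⟩)⁻¹ * γ C₂ ⟨x, h₂⟩ := by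
      rw [inv_mul_eq_iff_eq_mul, ← mul_assoc, h1, inv_mul_cancel_right]
    rw [h2, map_mul, map_inv]
    rfl

end UnitaryLinearization

/-- Lower and upper control functions attached to a proper function `ℓ` on a finitely generated
group. In the application, `ℓ γ` and `c * d` are the norms of the two components of a displacement,
and `d + |γ|` is the length of a chain. -/
theorem exists_control_functions {Γ : Type*} [Group Γ] {S : Set Γ} (hSfin : S.Finite)
    (hS : Subgroup.closure S = ⊤) (ℓ : Γ → ℝ) (hℓ0 : ∀ γ, 0 ≤ ℓ γ)
    (hℓ : Tendsto ℓ cofinite atTop) {c : ℝ} (hc : 0 < c) :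
    ∃ ρ ψ : ℝ≥0 → ℝ, Monotone ρ ∧ Monotone ψ ∧ Tendsto ρ atTop atTop ∧ Tendsto ψ atTop atTop ∧
      (∀ (γ : Γ) (d : ℝ) (u : ℝ≥0), u ≤ d + wordLength S γ → ρ u ≤ max (ℓ γ) (c * d)) ∧
      ∀ (γ : Γ) (d : ℝ) (u : ℝ≥0), 0 ≤ d → d + wordLength S γ ≤ u → ℓ γ + c * d ≤ ψ u := by
  -- a proper monotone function with `φ u ≤ ℓ γ` for all `γ` of length at least `u`
  let φ : ℝ → ℝ := fun u => ⨅ γ : Γ, (ℓ γ + max (u - (wordLength S γ : ℝ)) (0 : ℝ))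
  have hbdd : ∀ u : ℝ, BddBelow (Set.range fun γ : Γ => ℓ γ + max (u - (wordLength S γ : ℝ)) (0 : ℝ)) :=
    fun u => ⟨0, by rintro _ ⟨γ, rfl⟩; exact add_nonneg (hℓ0 γ) (le_max_right _ _)⟩
  have hφ : Monotone φ := fun u v huv => ciInf_mono (hbdd u) fun γ => by gcongr
  have hφt : Tendsto φ atTop atTop := by
    refine tendsto_atTop.2 fun M => ?_
    have hfin : {γ | ¬ M ≤ ℓ γ}.Finite := (tendsto_atTop.1 hℓ M)
    obtain ⟨N, hN⟩ := (hfin.image (wordLength S)).bddAbove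
    filter_upwards [eventually_ge_atTop (M + N)] with u hu
    refine le_ciInf fun γ => ?_
    by_cases h : M ≤ ℓ γ
    · exact h.trans (le_add_of_nonneg_right (le_max_right _ _))
    · have h1 : (wordLength S γ : ℝ) ≤ N := by exact_mod_cast hN ⟨γ, h, rfl⟩
      have h2 := le_max_left (u - wordLength S γ) 0
      linarith [hℓ0 γ]
  have hhalf : Tendsto (fun u : ℝ≥0 => (u : ℝ) / 2) atTop atTop :=
    NNReal.tendsto_coe_atTop.2 tendsto_id |>.atTop_div_const two_pos
  have hfin := fun n => finite_wordLength_le hSfin hS n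
  refine ⟨fun u => min (φ (u / 2)) (c * (u / 2)),
    fun u => ∑ γ ∈ (hfin ⌈u⌉₊).toFinset, ℓ γ + c * u, fun u v huv => ?_, fun u v huv => ?_, ?_, ?_,
    fun γ d u h => ?_, fun γ d u hd h => ?_⟩
  · have h : (u : ℝ) / 2 ≤ v / 2 := by
      have : (u : ℝ) ≤ v := huv
      linarith
    exact min_le_min (hφ h) (mul_le_mul_of_nonneg_left h hc.le)
  · refine add_le_add (Finset.sum_le_sum_of_subset_of_nonneg (fun γ hγ => ?_)
      fun γ _ _ => hℓ0 γ) (mul_le_mul_of_nonneg_left huv hc.le)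
    simp only [Set.Finite.mem_toFinset, Set.mem_ofPred_eq] at hγ ⊢
    exact hγ.trans (Nat.ceil_mono huv)
  · refine tendsto_atTop.2 fun M => ?_
    filter_upwards [tendsto_atTop.1 (hφt.comp hhalf) M,
      tendsto_atTop.1 (hhalf.const_mul_atTop hc) M] with u h1 h2
    exact le_min h1 h2
  · refine tendsto_atTop_mono (fun u => ?_) ((NNReal.tendsto_coe_atTop.2 tendsto_id).const_mul_atTop
      hc)
    exact le_add_of_nonneg_left (Finset.sum_nonneg fun γ _ => hℓ0 γ)
  -- one of the two summands of `d + |γ|` is at least `u / 2`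
  · rcases le_total ((u : ℝ) / 2) d with h1 | h1
    · exact (min_le_right _ _).trans ((mul_le_mul_of_nonneg_left h1 hc.le).trans (le_max_right _ _))
    · refine (min_le_left _ _).trans ((ciInf_le (hbdd _) γ).trans (le_max_of_le_left ?_))
      rw [max_eq_right (by linarith), add_zero]
  · have h0 : (0 : ℝ) ≤ wordLength S γ := Nat.cast_nonneg _
    refine add_le_add (Finset.single_le_sum (f := ℓ) (fun γ _ => hℓ0 γ) ?_)
      (mul_le_mul_of_nonneg_left (by linarith) hc.le)
    simp only [Set.Finite.mem_toFinset, Set.mem_ofPred_eq]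
    have h1 : (wordLength S γ : ℝ) ≤ u := by linarith
    have h2 : (wordLength S γ : ℝ) ≤ ⌈u⌉₊ := h1.trans (by exact_mod_cast Nat.le_ceil u)
    exact_mod_cast h2

namespace UnitaryLinearization

variable {𝕂 G H : Type*} [RCLike 𝕂] [Group G] [TopologicalSpace G] [IsTopologicalGroup G]
  {Γ : Subgroup G} [NormedAddCommGroup H] [InnerProductSpace 𝕂 H]

/-- Since `Γ` is dense, the translations by all elements of `G` act isometrically on the cone. -/
theorem norm_smul_sub_smul_mul_left (L : UnitaryLinearization 𝕂 Γ G H) (hΓ : Dense (Γ : Set G))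
    (t t' : ℝ) (h m m' : G) :
    ‖(t : 𝕂) • L.ι (h * m) - (t' : 𝕂) • L.ι (h * m')‖ =
      ‖(t : 𝕂) • L.ι m - (t' : 𝕂) • L.ι m'‖ := by
  have hι := L.isEmbedding.continuous
  have hclosed : IsClosed {h : G | ‖(t : 𝕂) • L.ι (h * m) - (t' : 𝕂) • L.ι (h * m')‖ =
      ‖(t : 𝕂) • L.ι m - (t' : 𝕂) • L.ι m'‖} :=
    isClosed_eq (by fun_prop) continuous_const
  refine closure_minimal (s := (Γ : Set G)) (fun γ hγ => ?_) hclosed (hΓ h)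
  have h1 : ∀ m : G, L.ι (γ * m) = L.U ⟨γ, hγ⟩ (L.ι m) := fun m => L.map_smul ⟨γ, hγ⟩ m
  change ‖(t : 𝕂) • L.ι (γ * m) - (t' : 𝕂) • L.ι (γ * m')‖ = _
  rw [h1, h1, ← _root_.map_smul, ← _root_.map_smul, ← map_sub, (L.U ⟨γ, hγ⟩).norm_map]

variable [CompactSpace G] [MeasurableSpace G] [BorelSpace G] {μ : Measure G}
  [IsProbabilityMeasure μ] [μ.IsMulLeftInvariant] {Z : Type*} [NormedAddCommGroup Z]

/-- A map `J : H → Z` which scales distances induces a distance scaling map of the cone into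
`L_p (G; Z)` which is equivariant with respect to the translations: the point `x` is mapped to
`g ↦ J (g⁻¹ x)`. -/
theorem exists_equivariant_map (L : UnitaryLinearization 𝕂 Γ G H) (hΓ : Dense (Γ : Set G))
    (p : ℝ≥0∞) [Fact (1 ≤ p)] (J : H → Z) {c : ℝ} (hc : 0 < c)
    (hJ : ∀ x y, ‖J x - J y‖ = c * ‖x - y‖) :
    ∃ f : L.openCone → Lp Z p μ, (∀ x y, ‖f x - f y‖ = c * dist x y) ∧
      ∀ (γ : Γ) x, f (γ • x) =
        Lp.compMeasurePreserving (fun g => ((γ⁻¹ : Γ) : G) * g)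
          (measurePreserving_mul_left μ _) (f x) := by
  have hp0 : p ≠ 0 := (zero_lt_one.trans_le (Fact.out : 1 ≤ p)).ne'
  let _ : MetricSpace G := L.isEmbedding.comapMetricSpace L.ι
  have hJc : Continuous J := by
    refine (LipschitzWith.of_dist_le_mul (K := ⟨c, hc.le⟩) fun x y => ?_).continuous
    rw [dist_eq_norm, dist_eq_norm]
    exact (hJ x y).le
  have hι := L.isEmbedding.continuous
  choose t m hx using L.exists_eq_conePoint
  have hx' : ∀ x : L.openCone, (x : H) = ((t x : ℝ) : 𝕂) • L.ι (m x) := fun x =>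
    congrArg Subtype.val (hx x)
  let F : L.openCone → G → Z := fun x g => J (((t x : ℝ) : 𝕂) • L.ι (g⁻¹ * m x))
  have hFc : ∀ x, Continuous (F x) := fun x => by fun_prop
  have hF : ∀ x, MemLp (F x) p μ := by
    intro x
    obtain ⟨C, hC⟩ := (isCompact_range (hFc x)).isBounded.exists_norm_le
    exact MemLp.of_bound (hFc x).aestronglyMeasurable C
      (Eventually.of_forall fun g => hC _ ⟨g, rfl⟩)
  refine ⟨fun x => (hF x).toLp _, fun x y => ?_, fun γ x => ?_⟩
  · have h1 : ∀ᵐ g ∂μ, ‖((hF x).toLp _ - (hF y).toLp _ : Lp Z p μ) g‖ = c * dist x y := by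
      filter_upwards [Lp.coeFn_sub ((hF x).toLp _) ((hF y).toLp _), (hF x).coeFn_toLp,
        (hF y).coeFn_toLp] with g h2 h3 h4
      rw [h2, Pi.sub_apply, h3, h4, hJ, L.norm_smul_sub_smul_mul_left hΓ, ← hx', ← hx',
        Subtype.dist_eq, dist_eq_norm]
    exact le_antisymm (norm_Lp_le_of_le _ (by positivity) (h1.mono fun g h => h.le))
      (le_norm_Lp_of_le hp0 _ (h1.mono fun g h => h.ge))
  · refine Lp.ext ?_
    have hθ := measurePreserving_mul_left μ ((γ⁻¹ : Γ) : G)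
    filter_upwards [(hF (γ • x)).coeFn_toLp, Lp.coeFn_compMeasurePreserving ((hF x).toLp _) hθ,
      hθ.quasiMeasurePreserving.ae (hF x).coeFn_toLp] with g h1 h2 h3
    rw [h1, h2, Function.comp_apply, h3]
    rw [← sub_eq_zero, ← norm_eq_zero, hJ]
    have h4 : (((γ⁻¹ : Γ) : G) * g)⁻¹ * m x = g⁻¹ * (γ • m x : G) := by
      rw [Subgroup.smul_def, smul_eq_mul]
      simp [mul_assoc]
    rw [h4, L.norm_smul_sub_smul_mul_left hΓ, ← hx', coe_smul, hx' x, _root_.map_smul,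
      ← L.map_smul, sub_self, norm_zero, mul_zero]

/-- A proper affine isometric action of `Γ` on `E` yields a fibred coarse embedding of the warped
cone. The action on `E` takes care of the directions of the orbits of `Γ`, the translation action
on `L_p (G; Z)` of the transversal ones. -/
theorem admitsFibredCoarseEmbedding_of_properAction {𝕜 : Type*} [RCLike 𝕜] {G Z E : Type u}
    [Group G] [TopologicalSpace G] [IsTopologicalGroup G] [CompactSpace G] [MeasurableSpace G]
    [BorelSpace G] (μ : Measure G) [IsProbabilityMeasure μ] [μ.IsMulLeftInvariant]
    {Γ : Subgroup G} (L : UnitaryLinearization 𝕂 Γ G H) (hΓ : Dense (Γ : Set G)) {S : Set Γ}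
    (hSfin : S.Finite) (hS : Subgroup.closure S = ⊤) [NormedAddCommGroup Z] [NormedSpace 𝕜 Z]
    [CompleteSpace Z] [NormedAddCommGroup E] [NormedSpace 𝕜 E] [CompleteSpace E]
    (p : ℝ≥0∞) [Fact (1 ≤ p)] (J : H → Z) {c : ℝ} (hc : 0 < c)
    (hJ : ∀ x y, ‖J x - J y‖ = c * ‖x - y‖) (h : AdmitsProperAffineIsometricAction 𝕜 Γ E) :
    AdmitsFibredCoarseEmbedding 𝕜 (L.warpedCone S hS) (WithLp p (E × Lp Z p μ)) := by
  obtain ⟨π, b, h1, hmul, hb, hprop⟩ := h.exists_cocycle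
  obtain ⟨f, hf, hfγ⟩ := L.exists_equivariant_map (μ := μ) hΓ p J hc hJ
  obtain ⟨ρ, ψ, hρ, hψ, hρt, hψt, hlow, hup⟩ :=
    exists_control_functions hSfin hS (fun γ => ‖b γ‖) (fun γ => norm_nonneg _) hprop hc
  have hθ : ∀ γ : Γ, MeasurePreserving (fun g => ((γ⁻¹ : Γ) : G) * g) μ μ :=
    fun γ => measurePreserving_mul_left μ _
  let lam : Γ → Lp Z p μ →ₗᵢ[𝕜] Lp Z p μ := fun γ => Lp.compMeasurePreservingₗᵢ 𝕜 _ (hθ γ)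
  have hlam : ∀ γ φ, lam γ φ =ᵐ[μ] fun g => φ (((γ⁻¹ : Γ) : G) * g) :=
    fun γ φ => Lp.coeFn_compMeasurePreserving φ (hθ γ)
  have hlam1 : ∀ φ, lam 1 φ = φ := fun φ =>
    Lp.ext ((hlam 1 φ).trans (Eventually.of_forall fun g => by simp))
  have hlammul : ∀ γ γ' φ, lam (γ * γ') φ = lam γ (lam γ' φ) := by
    intro γ γ' φ
    refine Lp.ext ?_
    filter_upwards [hlam (γ * γ') φ, hlam γ (lam γ' φ),
      (hθ γ).quasiMeasurePreserving.ae (hlam γ' φ)] with g h1 h2 h3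
    rw [h1, h2, h3]
    simp [mul_assoc]
  obtain ⟨τ, hτ⟩ := exists_monoidHom_of_cocycle (𝕜 := 𝕜)
    (fun γ => LinearIsometry.withLpProdMap p (π γ).toLinearIsometry (lam γ))
    (fun γ => WithLp.toLp p (b γ, (0 : Lp Z p μ)))
    (fun x => by
      refine WithLp.ofLp_injective p (Prod.ext ?_ ?_)
      · exact h1 x.fst
      · exact hlam1 x.snd)
    (fun γ γ' x => by
      refine WithLp.ofLp_injective p (Prod.ext ?_ ?_)
      · exact hmul γ γ' x.fst
      · exact hlammul γ γ' x.snd)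
    (fun γ γ' => by
      refine WithLp.ofLp_injective p (Prod.ext ?_ ?_)
      · exact hb γ γ'
      · change (0 : Lp Z p μ) = lam γ 0 + 0
        simp)
  -- the components of the displacement of the section `x ↦ (0, f x)`
  have hdisp : ∀ (β : Γ) (x y : L.openCone),
      τ β (WithLp.toLp p (0, f y)) - WithLp.toLp p (0, f x) =
        WithLp.toLp p (b β, f (β • y) - f x) := by
    intro β x y
    rw [hτ]
    refine WithLp.ofLp_injective p (Prod.ext ?_ ?_)
    · change b β + π β 0 - 0 = b β
      simp
    · change 0 + lam β (f y) - f x = f (β • y) - f x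
      rw [zero_add, hfγ]
      rfl
  refine L.admitsFibredCoarseEmbedding (fun γ => continuous_const_smul γ) (fun γ g h => ?_) hSfin hS
    τ (fun x => WithLp.toLp p (0, f x)) hρ hψ hρt hψt (fun β x y => ?_) (fun β x y u h => ?_)
  · rw [Subgroup.smul_def, smul_eq_mul, mul_eq_right] at h
    exact_mod_cast h
  · rw [hdisp]
    refine (hlow β (dist (β • L.ofWarped S hS y) (L.ofWarped S hS x)) _ ?_).trans (max_le ?_ ?_)
    · have := L.dist_warpedCone_le β y x
      rwa [dist_comm] at this
    · exact WithLp.norm_fst_le (p := p) E (WithLp.toLp p (b β, f (β • L.ofWarped S hS y) -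
        f (L.ofWarped S hS x)))
    · rw [← hf]
      exact WithLp.norm_snd_le (p := p) E (WithLp.toLp p (b β, f (β • L.ofWarped S hS y) -
        f (L.ofWarped S hS x)))
  · rw [hdisp]
    refine le_trans ?_ (hup β _ u dist_nonneg h)
    rw [← hf, ← WithLp.norm_toLp_fst p E (Lp Z p μ) (b β),
      ← WithLp.norm_toLp_snd p E (Lp Z p μ) (f (β • y) - f x)]
    refine le_trans (le_of_eq (congrArg norm ?_)) (norm_add_le _ _)
    refine WithLp.ofLp_injective p (Prod.ext ?_ ?_)
    · simp
    · simp

end UnitaryLinearization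

/-! ### Classes of Banach spaces described by norm inequalities -/

section UniformConvexity

variable {𝕜 : Type*} [RCLike 𝕜]

/-- The inequality
`δ ‖x - y‖ ^ 2 ≤ (‖x‖ ^ 2 + ‖y‖ ^ 2) / 2 - ‖(x + y) / 2‖ ^ 2 + δ ε (‖x‖ ^ 2 + ‖y‖ ^ 2)`, a
quadratic form of uniform convexity. -/
def SatisfiesConvexityInequality (𝕜 : Type*) [RCLike 𝕜] (ε δ : ℝ) (E : Type*)
    [NormedAddCommGroup E] [NormedSpace 𝕜 E] : Prop :=
  SatisfiesNormInequality (𝕜 := 𝕜) (2 : ℝ≥0∞).toReal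
    ![1 / 2 + δ * ε, 1 / 2 + δ * ε, -1 / 4, -δ] ![![1, 0], ![0, 1], ![1, 1], ![1, -1]] E

variable {E : Type*} [NormedAddCommGroup E]

theorem satisfiesConvexityInequality_iff [NormedSpace 𝕜 E] {ε δ : ℝ} :
    SatisfiesConvexityInequality 𝕜 ε δ E ↔ ∀ x y : E,
      δ * ‖x - y‖ ^ 2 + ‖x + y‖ ^ 2 / 4 ≤ (1 / 2 + δ * ε) * (‖x‖ ^ 2 + ‖y‖ ^ 2) := by
  have key : ∀ x : Fin 2 → E, ∑ j, (![1 / 2 + δ * ε, 1 / 2 + δ * ε, -1 / 4, -δ] : Fin 4 → ℝ) j *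
      ‖∑ i, (![![1, 0], ![0, 1], ![1, 1], ![1, -1]] : Fin 4 → Fin 2 → 𝕜) j i • x i‖ ^
        (2 : ℝ≥0∞).toReal =
      (1 / 2 + δ * ε) * (‖x 0‖ ^ 2 + ‖x 1‖ ^ 2) - ‖x 0 + x 1‖ ^ 2 / 4 - δ * ‖x 0 - x 1‖ ^ 2 := by
    intro x
    simp [Fin.sum_univ_four, ← sub_eq_add_neg]
    ring
  constructor
  · intro h x y
    have h1 := h ![x, y]
    rw [key] at h1
    simp only [Matrix.cons_val_zero, Matrix.cons_val_one] at h1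
    linarith
  · intro h x
    rw [key]
    linarith [h (x 0) (x 1)]

theorem satisfiesConvexityInequality_of_innerProductSpace [InnerProductSpace 𝕜 E] {ε δ : ℝ}
    (hε : 0 ≤ ε) (hδ0 : 0 ≤ δ) (hδ : δ ≤ 1 / 4) : SatisfiesConvexityInequality 𝕜 ε δ E := by
  rw [satisfiesConvexityInequality_iff]
  intro x y
  have h := parallelogram_law_with_norm 𝕜 x y
  have h1 : δ * ‖x - y‖ ^ 2 ≤ 1 / 4 * ‖x - y‖ ^ 2 := by gcongr
  have h2 : 0 ≤ δ * ε * (‖x‖ ^ 2 + ‖y‖ ^ 2) := by positivity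
  nlinarith

variable [NormedSpace 𝕜 E]

theorem UniformConvexSpace.exists_convexityInequality (𝕜 : Type*) [RCLike 𝕜] [NormedSpace 𝕜 E]
    [UniformConvexSpace E] {ε : ℝ} (hε : 0 < ε) :
    ∃ δ, 0 < δ ∧ δ ≤ 1 / 4 ∧ SatisfiesConvexityInequality 𝕜 ε δ E := by
  let _ : NormedSpace ℝ E := NormedSpace.restrictScalars ℝ 𝕜 E
  obtain ⟨δ₁, hδ₁, h⟩ := exists_forall_closed_ball_dist_add_le_two_sub E (Real.sqrt_pos.2 hε)
  obtain ⟨δ₀, hδ₀, hδ₀1, hδ₀le⟩ : ∃ δ₀ : ℝ, 0 < δ₀ ∧ δ₀ ≤ 1 ∧ δ₀ ≤ δ₁ :=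
    ⟨min 1 δ₁, lt_min one_pos hδ₁, min_le_left _ _, min_le_right _ _⟩
  have hsq : δ₀ ^ 2 ≤ 1 := pow_le_one₀ hδ₀.le hδ₀1
  refine ⟨δ₀ ^ 2 / 64, by positivity, by linarith, satisfiesConvexityInequality_iff.2 ?_⟩
  -- by symmetry and homogeneity, `x` is a unit vector and `y` belongs to the unit ball
  have unit : ∀ x y : E, ‖x‖ = 1 → ‖y‖ ≤ 1 → δ₀ ^ 2 / 64 * ‖x - y‖ ^ 2 + ‖x + y‖ ^ 2 / 4 ≤
      (1 / 2 + δ₀ ^ 2 / 64 * ε) * (‖x‖ ^ 2 + ‖y‖ ^ 2) := by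
    intro x y hx hy
    have hy0 := norm_nonneg y
    have ht0 := norm_nonneg (x + y)
    have ht : ‖x + y‖ ≤ 1 + ‖y‖ := hx ▸ norm_add_le x y
    have hd0 := norm_nonneg (x - y)
    have hd : ‖x - y‖ ≤ 1 + ‖y‖ := hx ▸ norm_sub_le x y
    rw [hx]
    have ht2 : ‖x + y‖ ^ 2 ≤ (1 + ‖y‖) ^ 2 := by gcongr
    -- if `‖x - y‖ ^ 2 ≤ ε`, the error term dominates; otherwise uniform convexity applies
    rcases lt_or_ge ‖x - y‖ (√ε) with h1 | h1
    · have h2 : ‖x - y‖ ^ 2 ≤ ε := by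
        rw [← Real.sq_sqrt hε.le]
        gcongr
      have h3 : δ₀ ^ 2 / 64 * ‖x - y‖ ^ 2 ≤ δ₀ ^ 2 / 64 * ε := by gcongr
      have h4 : 0 ≤ δ₀ ^ 2 / 64 * ε * ‖y‖ ^ 2 := by positivity
      nlinarith [sq_nonneg (1 - ‖y‖)]
    · have h2 : ‖x + y‖ ≤ 2 - δ₀ := (h hx.le hy h1).trans (by linarith)
      have h3 : δ₀ ^ 2 / 64 * ‖x - y‖ ^ 2 ≤ δ₀ ^ 2 / 64 * 2 ^ 2 := by
        have : ‖x - y‖ ≤ 2 := by linarith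
        gcongr
      have h4 : 0 ≤ δ₀ ^ 2 / 64 * ε * (1 + ‖y‖ ^ 2) := by positivity
      have h5 : δ₀ ^ 2 / 16 ≤ (1 + ‖y‖ ^ 2) / 2 - ‖x + y‖ ^ 2 / 4 := by
        -- either the norms of `x` and `y` differ, or `‖x + y‖` is small compared to both
        rcases le_total ‖y‖ (1 - δ₀ / 2) with h6 | h6
        · have h7 : (δ₀ / 2) ^ 2 ≤ (1 - ‖y‖) ^ 2 := by
            have : δ₀ / 2 ≤ 1 - ‖y‖ := by linarith
            gcongr
          nlinarith
        · have h7 : ‖x + y‖ ^ 2 ≤ (2 - δ₀) ^ 2 := by gcongr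
          have h8 : (1 - δ₀ / 2) ^ 2 ≤ ‖y‖ ^ 2 := by
            have : 0 ≤ 1 - δ₀ / 2 := by linarith
            gcongr
          nlinarith
      nlinarith
  have main : ∀ x y : E, ‖y‖ ≤ ‖x‖ → δ₀ ^ 2 / 64 * ‖x - y‖ ^ 2 + ‖x + y‖ ^ 2 / 4 ≤
      (1 / 2 + δ₀ ^ 2 / 64 * ε) * (‖x‖ ^ 2 + ‖y‖ ^ 2) := by
    intro x y hxy
    rcases eq_or_ne x 0 with rfl | hx
    · have hy : y = 0 := norm_le_zero_iff.1 (by simpa using hxy)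
      simp [hy]
    have hm : 0 < ‖x‖ := norm_pos_iff.2 hx
    have hu : ∀ z : E, ‖z‖ = ‖x‖ * ‖‖x‖⁻¹ • z‖ := fun z => by
      rw [norm_smul, norm_inv, norm_norm, mul_inv_cancel_left₀ hm.ne']
    have hx1 : ‖‖x‖⁻¹ • x‖ = 1 := by rw [norm_smul, norm_inv, norm_norm, inv_mul_cancel₀ hm.ne']
    have h1 := unit (‖x‖⁻¹ • x) (‖x‖⁻¹ • y) hx1
      (by rw [norm_smul, norm_inv, norm_norm, inv_mul_le_iff₀ hm, mul_one]; exact hxy)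
    rw [← smul_sub, ← smul_add, hx1] at h1
    have h2 := mul_le_mul_of_nonneg_left h1 (sq_nonneg ‖x‖)
    rw [hu (x - y), hu (x + y), hu y]
    calc _ = ‖x‖ ^ 2 * (δ₀ ^ 2 / 64 * ‖‖x‖⁻¹ • (x - y)‖ ^ 2 + ‖‖x‖⁻¹ • (x + y)‖ ^ 2 / 4) := by ring
      _ ≤ _ := h2
      _ = _ := by ring
  intro x y
  rcases le_total ‖y‖ ‖x‖ with h1 | h1
  · exact main x y h1
  · have h2 := main y x h1
    rwa [norm_sub_rev, add_comm y x, add_comm (‖y‖ ^ 2)] at h2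

theorem uniformConvexSpace_of_convexityInequality
    (h : ∀ ε > 0, ∃ δ > 0, SatisfiesConvexityInequality 𝕜 ε δ E) : UniformConvexSpace E := by
  refine ⟨fun ε hε => ?_⟩
  -- for unit vectors the error term is then at most half of `δ * ‖x - y‖ ^ 2`
  obtain ⟨δ, hδ, hE⟩ := h (ε ^ 2 / 4) (by positivity)
  rw [satisfiesConvexityInequality_iff] at hE
  refine ⟨δ * ε ^ 2 / 2, by positivity, fun x hx y hy hxy => ?_⟩
  have h1 := hE x y
  rw [hx, hy] at h1
  have h2 : δ * ε ^ 2 ≤ δ * ‖x - y‖ ^ 2 := by gcongr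
  have h3 := sq_nonneg ‖x + y‖
  have h4 : δ * ε ^ 2 / 2 ≤ 2 := by nlinarith
  refine abs_le_of_sq_le_sq' ?_ (by linarith) |>.2
  nlinarith [sq_nonneg (δ * ε ^ 2)]

end UniformConvexity

section RademacherType

variable {𝕜 : Type*} [RCLike 𝕜]

/-- The inequality `𝔼 ‖∑ εᵢ xᵢ‖ ^ q ≤ K ∑ ‖xᵢ‖ ^ q` for families of `n` vectors and random signs:
Rademacher type `q`. -/
def SatisfiesTypeInequality (𝕜 : Type*) [RCLike 𝕜] (q K : ℝ) (n : ℕ) (E : Type*)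
    [NormedAddCommGroup E] [NormedSpace 𝕜 E] : Prop :=
  SatisfiesNormInequality (𝕜 := 𝕜) q
    (Sum.elim (fun _ : Fin n → ℤˣ => -(2 ^ n : ℝ)⁻¹) (fun _ : Fin n => K))
    (Sum.elim (fun ε i => ((ε i : ℤ) : 𝕜)) (fun j => Pi.single j 1)) E

variable {E : Type*} [NormedAddCommGroup E]

theorem satisfiesTypeInequality_iff [NormedSpace 𝕜 E] {q K : ℝ} {n : ℕ} :
    SatisfiesTypeInequality 𝕜 q K n E ↔ ∀ x : Fin n → E,
      (∑ ε : Fin n → ℤˣ, ‖∑ i, ε i • x i‖ ^ q) / 2 ^ n ≤ K * ∑ i, ‖x i‖ ^ q := by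
  refine forall_congr' fun x => ?_
  have h1 : ∀ ε : Fin n → ℤˣ, ∑ i, ((ε i : ℤ) : 𝕜) • x i = ∑ i, ε i • x i := fun ε =>
    Finset.sum_congr rfl fun i _ => by
      rw [Units.smul_def, Int.cast_smul_eq_zsmul]
  have h2 : ∀ j, ∑ i, (Pi.single j 1 : Fin n → 𝕜) i • x i = x j := fun j => by
    rw [Finset.sum_eq_single j (fun i _ hij => by rw [Pi.single_eq_of_ne hij, zero_smul])
      (fun h => (h (Finset.mem_univ j)).elim), Pi.single_eq_same, one_smul]
  rw [Fintype.sum_sum_type]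
  simp only [Sum.elim_inl, Sum.elim_inr, h1, h2, ← Finset.mul_sum]
  rw [div_eq_inv_mul]
  constructor <;> intro h <;> linarith

theorem HasNontrivialType.exists_typeInequality (𝕜 : Type*) [RCLike 𝕜] [NormedSpace 𝕜 E]
    (h : HasNontrivialType E) :
    ∃ q K : ℝ, 1 < q ∧ q ≤ 2 ∧ 1 ≤ K ∧ ∀ n, SatisfiesTypeInequality 𝕜 q K n E := by
  obtain ⟨q, hq1, hq2, C, hC⟩ := h
  have hq0 : 0 < q := by linarith
  refine ⟨q, max C 1 ^ q, hq1, hq2, Real.one_le_rpow (le_max_right _ _) hq0.le, fun n =>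
    satisfiesTypeInequality_iff.2 fun x => ?_⟩
  have h0 : 0 ≤ (∑ ε : Fin n → ℤˣ, ‖∑ i, ε i • x i‖ ^ q) / 2 ^ n := by positivity
  have h1 : 0 ≤ ∑ i, ‖x i‖ ^ q := by positivity
  have h2 := (hC n x).trans (mul_le_mul_of_nonneg_right (le_max_left C 1) (by positivity))
  have h3 := Real.rpow_le_rpow (by positivity) h2 hq0.le
  rwa [Real.mul_rpow (by positivity) (by positivity), ← Real.rpow_mul h0, ← Real.rpow_mul h1,
    one_div_mul_cancel hq0.ne', Real.rpow_one, Real.rpow_one] at h3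

theorem hasNontrivialType_of_typeInequality [NormedSpace 𝕜 E] {q K : ℝ} (hq1 : 1 < q) (hq2 : q ≤ 2)
    (hK : 0 ≤ K) (h : ∀ n, SatisfiesTypeInequality 𝕜 q K n E) : HasNontrivialType E := by
  refine ⟨q, hq1, hq2, K ^ (1 / q), fun n x => ?_⟩
  have h1 : 0 ≤ ∑ i, ‖x i‖ ^ q := by positivity
  rw [← Real.mul_rpow hK h1]
  exact Real.rpow_le_rpow (by positivity) (satisfiesTypeInequality_iff.1 (h n) x) (by
    have : 0 < q := by linarith
    positivity)

/-- A form of Clarkson's inequality in Hilbert spaces. -/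
theorem norm_add_rpow_add_norm_sub_rpow_le [InnerProductSpace 𝕜 E] {q : ℝ} (hq1 : 1 < q)
    (hq2 : q ≤ 2) (x y : E) :
    ‖x + y‖ ^ q + ‖x - y‖ ^ q ≤ 2 * (‖x‖ ^ q + ‖y‖ ^ q) := by
  have hq0 : 0 < q := by linarith
  have h := parallelogram_law_with_norm 𝕜 x y
  have hpow : ∀ z : E, ‖z‖ ^ q = (‖z‖ ^ 2) ^ (q / 2) := fun z => by
    rw [← Real.rpow_natCast_mul (norm_nonneg z)]
    congr 1
    push_cast
    ring
  have hc := (Real.concaveOn_rpow (p := q / 2) (by linarith) (by linarith)).2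
    (Set.mem_Ici.2 (sq_nonneg ‖x + y‖)) (Set.mem_Ici.2 (sq_nonneg ‖x - y‖))
    (show (0 : ℝ) ≤ 1 / 2 by norm_num) (show (0 : ℝ) ≤ 1 / 2 by norm_num) (by norm_num)
  have h1 : (1 / 2 : ℝ) • ‖x + y‖ ^ 2 + (1 / 2 : ℝ) • ‖x - y‖ ^ 2 = ‖x‖ ^ 2 + ‖y‖ ^ 2 := by
    simp only [smul_eq_mul]
    linarith
  rw [h1] at hc
  have h2 := Real.rpow_add_le_add_rpow (sq_nonneg ‖x‖) (sq_nonneg ‖y‖) (p := q / 2) (by linarith)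
    (by linarith)
  simp only [smul_eq_mul, ← hpow] at hc h2
  linarith

/-- Hilbert spaces have type `q` with constant `1` for every `q ≤ 2`. -/
theorem satisfiesTypeInequality_of_innerProductSpace [InnerProductSpace 𝕜 E] {q K : ℝ}
    (hq1 : 1 < q) (hq2 : q ≤ 2) (hK : 1 ≤ K) (n : ℕ) : SatisfiesTypeInequality 𝕜 q K n E := by
  have hq0 : q ≠ 0 := by linarith
  have key : ∀ (n : ℕ) (x : Fin n → E) , ∑ ε : Fin n → ℤˣ, ‖∑ i, ε i • x i‖ ^ q ≤
      2 ^ n * ∑ i, ‖x i‖ ^ q := by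
    intro n
    induction n with
    | zero => intro x; simp [Real.zero_rpow hq0]
    | succ n ih =>
      intro x
      have h1 : ∑ ε : Fin (n + 1) → ℤˣ, ‖∑ i, ε i • x i‖ ^ q = ∑ ε : Fin n → ℤˣ,
          (‖∑ i, ε i • x i.succ + x 0‖ ^ q + ‖∑ i, ε i • x i.succ - x 0‖ ^ q) := by
        rw [← (Fin.consEquiv fun _ => ℤˣ).sum_comp, Fintype.sum_prod_type, Finset.sum_comm]
        refine Finset.sum_congr rfl fun ε _ => ?_
        have h2 : (Finset.univ : Finset ℤˣ) = {1, -1} := rfl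
        rw [h2, Finset.sum_pair (by decide)]
        simp only [Fin.consEquiv_apply, Fin.sum_univ_succ, Fin.cons_zero, Fin.cons_succ, one_smul]
        rw [add_comm (x 0), show ((-1 : ℤˣ) • x 0) = -x 0 by simp [Units.smul_def],
          neg_add_eq_sub]
      rw [h1, Fin.sum_univ_succ]
      calc _ ≤ ∑ ε : Fin n → ℤˣ, 2 * (‖∑ i, ε i • x i.succ‖ ^ q + ‖x 0‖ ^ q) :=
            Finset.sum_le_sum fun ε _ => norm_add_rpow_add_norm_sub_rpow_le (𝕜 := 𝕜) hq1 hq2 _ _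
        _ = 2 * ∑ ε : Fin n → ℤˣ, ‖∑ i, ε i • x i.succ‖ ^ q + 2 * (2 ^ n * ‖x 0‖ ^ q) := by
            rw [← Finset.mul_sum, Finset.sum_add_distrib, mul_add]
            simp
        _ ≤ 2 * (2 ^ n * ∑ i : Fin n, ‖x i.succ‖ ^ q) + 2 * (2 ^ n * ‖x 0‖ ^ q) := by
            gcongr
            exact ih _
        _ = _ := by ring
  refine satisfiesTypeInequality_iff.2 fun x => ?_
  have h1 : 0 ≤ ∑ i, ‖x i‖ ^ q := by positivity
  rw [div_le_iff₀ (by positivity), mul_comm, ← mul_assoc, mul_comm _ K, mul_assoc]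
  exact (key n x).trans (le_mul_of_one_le_left (by positivity) hK)

end RademacherType

/-! ### Hilbert spaces -/

/-- A Banach space over `𝕜` whose norm satisfies the parallelogram law is a real Hilbert space,
and affine isometric actions on it are in particular actions by real affine isometries. -/
theorem haagerupProperty_of_parallelogram {𝕜 : Type*} [RCLike 𝕜] {Γ X : Type u} [Group Γ]
    [NormedAddCommGroup X] [NormedSpace 𝕜 X] [CompleteSpace X]
    (hX : ∀ x y : X, ‖x + y‖ ^ 2 + ‖x - y‖ ^ 2 = 2 * (‖x‖ ^ 2 + ‖y‖ ^ 2))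
    (h : AdmitsProperAffineIsometricAction 𝕜 Γ X) : HaagerupProperty Γ := by
  obtain ⟨π, b, h1, hmul, hb, hprop⟩ := h.exists_cocycle
  let _ : NormedSpace ℝ X := NormedSpace.restrictScalars ℝ 𝕜 X
  let _ : InnerProductSpace ℝ X := InnerProductSpace.ofNorm ℝ fun x y => by
    simpa only [sq] using hX x y
  have hsmul : ∀ (r : ℝ) (x : X), r • x = (r : 𝕜) • x := fun r x => rfl
  let πr : Γ → X →ₗᵢ[ℝ] X := fun γ =>
    { toFun := π γ
      map_add' := map_add (π γ)
      map_smul' := fun r x => by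
        rw [RingHom.id_apply, hsmul, hsmul]
        exact map_smul (π γ) (r : 𝕜) x
      norm_map' := (π γ).norm_map }
  exact ⟨X, inferInstance, inferInstance, inferInstance, .of_cocycle πr b h1 hmul hb hprop⟩

/-- The two norm inequalities which make up the parallelogram law hold in inner product spaces. -/
theorem satisfiesNormInequality_parallelogram {𝕜 E : Type*} [RCLike 𝕜] [NormedAddCommGroup E]
    [InnerProductSpace 𝕜 E] (σ : ℝ) :
    SatisfiesNormInequality (𝕜 := 𝕜) (2 : ℝ≥0∞).toReal ![σ, σ, -2 * σ, -2 * σ]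
      ![![1, 1], ![1, -1], ![1, 0], ![0, 1]] E := by
  intro x
  have h := parallelogram_law_with_norm 𝕜 (x 0) (x 1)
  simp only [Fin.sum_univ_four, Fin.sum_univ_two, Matrix.cons_val, ENNReal.toReal_ofNat,
    one_smul, neg_smul, zero_smul, add_zero, zero_add, ← sub_eq_add_neg, Real.rpow_ofNat]
  refine le_of_eq ?_
  linear_combination -σ * h

theorem parallelogram_of_satisfiesNormInequality {𝕜 X : Type*} [RCLike 𝕜] [NormedAddCommGroup X]
    [NormedSpace 𝕜 X]
    (h : ∀ σ : ℝ, SatisfiesNormInequality (𝕜 := 𝕜) (2 : ℝ≥0∞).toReal ![σ, σ, -2 * σ, -2 * σ]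
      ![![1, 1], ![1, -1], ![1, 0], ![0, 1]] X) (x y : X) :
    ‖x + y‖ ^ 2 + ‖x - y‖ ^ 2 = 2 * (‖x‖ ^ 2 + ‖y‖ ^ 2) := by
  have h1 := h 1 ![x, y]
  have h2 := h (-1) ![x, y]
  simp only [Fin.sum_univ_four, Fin.sum_univ_two, Matrix.cons_val, ENNReal.toReal_ofNat,
    one_smul, neg_smul, zero_smul, add_zero, zero_add, ← sub_eq_add_neg, Real.rpow_ofNat] at h1 h2
  linarith

/-- A group with the Haagerup property has proper affine isometric actions on Hilbert spaces over
`ℝ` and over `ℂ`. -/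
theorem HaagerupProperty.exists_innerProductSpace (𝕜 : Type) [RCLike 𝕜] {Γ : Type u} [Group Γ]
    (h : HaagerupProperty Γ) : ∃ (E : Type u) (_ : NormedAddCommGroup E)
      (_ : InnerProductSpace 𝕜 E) (_ : CompleteSpace E),
      AdmitsProperAffineIsometricAction 𝕜 Γ E := by
  obtain ⟨H, _, _, _, hH⟩ := h
  obtain ⟨π, b, h1, hmul, hb, hprop⟩ := hH.exists_cocycle
  obtain ⟨w, B, -⟩ := exists_hilbertBasis ℝ H
  choose V hV using fun γ => B.exists_scalarExtension_map (𝕜 := 𝕜) (π γ)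
    fun x y => (π γ).inner_map_map x y
  have hext : ∀ A A' : lp (fun _ : w => 𝕜) 2 →ₗᵢ[𝕜] lp (fun _ : w => 𝕜) 2,
      (∀ x, A (B.scalarExtension 𝕜 x) = A' (B.scalarExtension 𝕜 x)) → ∀ z, A z = A' z := by
    intro A A' hA z
    refine B.denseRange_linearCombination_scalarExtension.induction_on z
      (isClosed_eq A.continuous A'.continuous) fun v => ?_
    simp only [Finsupp.linearCombination_apply, Finsupp.sum, map_sum, map_smul, hA]
  refine ⟨lp (fun _ : w => 𝕜) 2, inferInstance, inferInstance, inferInstance,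
    .of_cocycle V (fun γ => B.scalarExtension 𝕜 (b γ)) ?_ ?_ ?_ ?_⟩
  · exact hext (V 1) LinearIsometry.id fun x => by rw [hV, h1]; rfl
  · exact fun γ γ' => hext (V (γ * γ')) ((V γ).comp (V γ')) fun x => by
      change _ = V γ (V γ' _)
      rw [hV, hV, hV, hmul]
  · intro γ γ'
    rw [hV, hb, B.scalarExtension_add]
  · simpa only [B.norm_scalarExtension] using hprop

theorem exists_haar_probabilityMeasure (G : Type*) [Group G] [TopologicalSpace G]
    [IsTopologicalGroup G] [CompactSpace G] [MeasurableSpace G] [BorelSpace G] :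
    ∃ μ : Measure G, IsProbabilityMeasure μ ∧ μ.IsMulLeftInvariant := by
  refine ⟨Measure.haarMeasure ⊤, ⟨?_⟩, inferInstance⟩
  exact Measure.haarMeasure_self

/-! ### Fibred coarse embeddability of warped cones of dense subgroups -/

theorem theorem5p1 (𝕜 𝕂 : Type) [RCLike 𝕜] [RCLike 𝕂]
    (G : Type u) [Group G] [TopologicalSpace G] [IsTopologicalGroup G] [CompactSpace G]
    (hG : TopologicalSpace.MetrizableSpace G ∨ AdmitsLieGroupStructure G)
    (Γ : Subgroup G) (hΓ : Dense (Γ : Set G))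
    (S : Set Γ) (hSfin : S.Finite) (hS : Subgroup.closure S = ⊤)
    (H : Type u) [NormedAddCommGroup H] [InnerProductSpace 𝕂 H] [CompleteSpace H]
    (L : UnitaryLinearization 𝕂 Γ G H) :
    -- `L_p`-spaces
    (∀ (p : ℝ≥0∞) [Fact (1 ≤ p)], p ≠ ∞ →
      ((∃ (Ω : Type u) (_ : MeasurableSpace Ω) (μ : Measure Ω),
          AdmitsFibredCoarseEmbedding 𝕜 (L.warpedCone S hS) (Lp 𝕜 p μ)) ↔
        ∃ (Ω : Type u) (_ : MeasurableSpace Ω) (μ : Measure Ω),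
          AdmitsProperAffineIsometricAction 𝕜 Γ (Lp 𝕜 p μ))) ∧
    -- uniformly convex Banach spaces
    ((∃ (E : Type u) (_ : NormedAddCommGroup E) (_ : NormedSpace 𝕜 E) (_ : CompleteSpace E),
        UniformConvexSpace E ∧ AdmitsFibredCoarseEmbedding 𝕜 (L.warpedCone S hS) E) ↔
      ∃ (E : Type u) (_ : NormedAddCommGroup E) (_ : NormedSpace 𝕜 E) (_ : CompleteSpace E),
        UniformConvexSpace E ∧ AdmitsProperAffineIsometricAction 𝕜 Γ E) ∧
    -- Banach spaces with nontrivial type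
    ((∃ (E : Type u) (_ : NormedAddCommGroup E) (_ : NormedSpace 𝕜 E) (_ : CompleteSpace E),
        HasNontrivialType E ∧ AdmitsFibredCoarseEmbedding 𝕜 (L.warpedCone S hS) E) ↔
      ∃ (E : Type u) (_ : NormedAddCommGroup E) (_ : NormedSpace 𝕜 E) (_ : CompleteSpace E),
        HasNontrivialType E ∧ AdmitsProperAffineIsometricAction 𝕜 Γ E) ∧
    -- Hilbert spaces
    ((∃ (E : Type u) (_ : NormedAddCommGroup E) (_ : InnerProductSpace 𝕜 E)
        (_ : CompleteSpace E), AdmitsFibredCoarseEmbedding 𝕜 (L.warpedCone S hS) E) ↔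
      HaagerupProperty Γ) := by
  let _ : MeasurableSpace G := borel G
  have _ : BorelSpace G := ⟨rfl⟩
  obtain ⟨μ, _, _⟩ := exists_haar_probabilityMeasure G
  -- the scalars `𝕂` of the linearization need not be the scalars `𝕜` of the Banach spaces
  let _ : InnerProductSpace ℝ H := InnerProductSpace.rclikeToReal 𝕂 H
  obtain ⟨w, B, -⟩ := exists_hilbertBasis ℝ H
  have hJ : ∀ x y : H, ‖B.scalarExtension 𝕜 x - B.scalarExtension 𝕜 y‖ = 1 * ‖x - y‖ :=
    fun x y => by rw [← B.scalarExtension_sub, B.norm_scalarExtension, one_mul]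
  have two_ne : (2 : ℝ≥0∞) ≠ ∞ := ENNReal.ofNat_ne_top
  refine ⟨fun p hp1 hp => ⟨?_, ?_⟩, ⟨?_, ?_⟩, ⟨?_, ?_⟩, ⟨?_, ?_⟩⟩
  · rintro ⟨Ω, mΩ, ν, ⟨F⟩⟩
    have hpos : 0 < p.toReal :=
      ENNReal.toReal_pos (zero_lt_one.trans_le (Fact.out : 1 ≤ p)).ne' hp
    have h := F.admitsProperAffineIsometricAction (μ := μ) hSfin p
    obtain ⟨Ω', m', ν', ⟨e⟩⟩ := LpStructure.exists_equiv_Lp hp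
      (((LpStructure.ofLp 𝕜 ν p hp).bochner (μ := μ) hp).ultrapower hpos)
    exact ⟨Ω', m', ν', h.congr e⟩
  · rintro ⟨Ω, mΩ, ν, h⟩
    obtain ⟨J, c, hc, hJ⟩ := B.exists_gaussian_embedding 𝕜 hp
    have h1 := L.admitsFibredCoarseEmbedding_of_properAction μ hΓ hSfin hS p J hc hJ h
    obtain ⟨Ω', m', ν', ⟨e⟩⟩ := LpStructure.exists_equiv_Lp hp
      ((LpStructure.ofLp 𝕜 ν p hp).prod hp
        ((LpStructure.ofLp 𝕜 (gaussianProduct w) p hp).bochner (μ := μ) hp))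
    exact ⟨Ω', m', ν', h1.congr e⟩
  · rintro ⟨E, _, _, _, hE, ⟨F⟩⟩
    refine ⟨_, _, _, inferInstance, ?_,
      F.admitsProperAffineIsometricAction (μ := μ) hSfin 2⟩
    refine uniformConvexSpace_of_convexityInequality (𝕜 := 𝕜) fun ε hε => ?_
    obtain ⟨δ, hδ, -, h⟩ := UniformConvexSpace.exists_convexityInequality (E := E) 𝕜 hε
    exact ⟨δ, hδ, (h.Lp μ two_ne).ultrapower ENNReal.toReal_nonneg⟩
  · rintro ⟨E, _, _, _, hE, h⟩
    refine ⟨_, _, _, inferInstance, ?_,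
      L.admitsFibredCoarseEmbedding_of_properAction μ hΓ hSfin hS 2 _ one_pos hJ h⟩
    refine uniformConvexSpace_of_convexityInequality (𝕜 := 𝕜) fun ε hε => ?_
    obtain ⟨δ, hδ, hδ', h⟩ := UniformConvexSpace.exists_convexityInequality (E := E) 𝕜 hε
    exact ⟨δ, hδ, SatisfiesNormInequality.prod two_ne h (SatisfiesNormInequality.Lp μ two_ne
      (satisfiesConvexityInequality_of_innerProductSpace hε.le hδ.le hδ'))⟩
  · rintro ⟨E, _, _, _, hE, ⟨F⟩⟩
    obtain ⟨q, K, hq1, hq2, hK, h⟩ := hE.exists_typeInequality 𝕜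
    obtain ⟨p, rfl, hp⟩ : ∃ p : ℝ≥0∞, q = p.toReal ∧ p ≠ ∞ :=
      ⟨ENNReal.ofReal q, (ENNReal.toReal_ofReal (by linarith)).symm, ENNReal.ofReal_ne_top⟩
    have : Fact (1 ≤ p) :=
      ⟨(ENNReal.toReal_le_toReal ENNReal.one_ne_top hp).1 (by simpa using hq1.le)⟩
    refine ⟨_, _, _, inferInstance, ?_,
      F.admitsProperAffineIsometricAction (μ := μ) hSfin p⟩
    refine hasNontrivialType_of_typeInequality (𝕜 := 𝕜) hq1 hq2 (zero_le_one.trans hK) fun n => ?_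
    exact (SatisfiesNormInequality.Lp μ hp (h n)).ultrapower ENNReal.toReal_nonneg
  · rintro ⟨E, _, _, _, hE, h⟩
    obtain ⟨q, K, hq1, hq2, hK, hE⟩ := hE.exists_typeInequality 𝕜
    obtain ⟨p, rfl, hp⟩ : ∃ p : ℝ≥0∞, q = p.toReal ∧ p ≠ ∞ :=
      ⟨ENNReal.ofReal q, (ENNReal.toReal_ofReal (by linarith)).symm, ENNReal.ofReal_ne_top⟩
    have : Fact (1 ≤ p) :=
      ⟨(ENNReal.toReal_le_toReal ENNReal.one_ne_top hp).1 (by simpa using hq1.le)⟩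
    refine ⟨_, _, _, inferInstance, ?_,
      L.admitsFibredCoarseEmbedding_of_properAction μ hΓ hSfin hS p _ one_pos
        hJ h⟩
    refine hasNontrivialType_of_typeInequality (𝕜 := 𝕜) hq1 hq2 (zero_le_one.trans hK) fun n => ?_
    exact SatisfiesNormInequality.prod hp (hE n) (SatisfiesNormInequality.Lp μ hp
      (satisfiesTypeInequality_of_innerProductSpace hq1 hq2 hK n))
  · rintro ⟨E, _, _, _, ⟨F⟩⟩
    refine haagerupProperty_of_parallelogram (parallelogram_of_satisfiesNormInequality (𝕜 := 𝕜) fun σ => ?_)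
      (F.admitsProperAffineIsometricAction (μ := μ) hSfin 2)
    exact ((satisfiesNormInequality_parallelogram σ).Lp μ two_ne).ultrapower ENNReal.toReal_nonneg
  · intro h
    obtain ⟨E, _, _, _, hE⟩ := h.exists_innerProductSpace 𝕜
    exact ⟨WithLp 2 (E × Lp (lp (fun _ : w => 𝕜) 2) 2 μ), inferInstance, inferInstance,
      inferInstance,
      L.admitsFibredCoarseEmbedding_of_properAction μ hΓ hSfin hS 2 _ one_pos hJ hE⟩
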